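/- Let $G$ be a compact connected simple Lie group (that is, its Lie algebra $\mathfrak g$ is simple), let $T\subset G$ be a maximal torus with Lie algebra $\mathfrak t$, and let $G/T$ be the corresponding full flag manifold with base point $o=eT$ and its smooth structure as a homogeneous space (the one for which $G\to G/T$ is a smooth submersion). Let $R\subset(\mathfrak t\otimes\mathbb C)^*$ be the set of roots of $\mathfrak g\otimes\mathbb C$ with respect to $\mathfrak t\otimes\mathbb C$, let $\mathfrak g_\alpha\subset\mathfrak g\otimes\mathbb C$ be the root space of $\alpha\in R$, and put $\mathfrak u_\alpha=\mathfrak u_{-\alpha}=\mathfrak g\cap(\mathfrak g_\alpha\oplus\mathfrak g_{-\alpha})$. Let $\alpha_1,\dots,\alpha_r\in R$ satisfy $\alpha_p\neq\pm\alpha_q$ for $p\neq q$ (for example, distinct positive roots), let $X_{\alpha_p}\in\mathfrak u_{\alpha_p}$ be nonzero vectors, and put $X=X_{\alpha_1}+\dots+X_{\alpha_r}$. Then the curve $t\mapsto\exp(tX)\cdot o$ is a geodesic of every $G$-invariant Riemannian metric on $G/T$ if and only if neither $\alpha_p+\alpha_q$ nor $\alpha_p-\alpha_q$ is a root, for all $p,q\in\{1,\dots,r\}$.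 -/

import Mathlib

open scoped Manifold ContDiff TensorProduct
open Bundle

noncomputable section

/-! ### Lie groups, the exponential map, maximal tori -/

section LieGroups

instance leInfty_minSmoothness_three : ENat.LEInfty (minSmoothness ℝ 3) := by
  rw [minSmoothness_of_isRCLikeNormedField]
  infer_instance

variable {n : ℕ} {G : Type*} [TopologicalSpace G] [Group G]
  [ChartedSpace (EuclideanSpace ℝ (Fin n)) G]

open Classical in
/-- The exponential map of a Lie group: `lieExp X = γ 1`, where `γ` is the integral curve with
`γ 0 = 1` of the left-invariant vector field determined by `X`. -/
def lieExp (X : GroupLieAlgebra (𝓡 n) G) : G :=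
  if h : ∃ γ : ℝ → G, γ 0 = 1 ∧
      IsMIntegralCurve (I := 𝓡 n) γ (mulInvariantVectorField (I := 𝓡 n) X)
  then h.choose 1 else 1

/-- A torus: a compact connected abelian subgroup. -/
def IsTorusSubgroup (S : Subgroup G) : Prop :=
  IsCompact (S : Set G) ∧ IsConnected (S : Set G) ∧ ∀ a ∈ S, ∀ b ∈ S, a * b = b * a

/-- A maximal torus: a torus that is not properly contained in another torus. -/
def IsMaximalTorus (T : Subgroup G) : Prop :=
  Maximal IsTorusSubgroup T

/-- The Lie algebra `{X | exp (t X) ∈ T for all t}` of a closed subgroup `T`. This set is a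
linear subspace; the span only serves to record it as one. -/
def subgroupLieAlgebra (T : Subgroup G) : Submodule ℝ (GroupLieAlgebra (𝓡 n) G) :=
  Submodule.span ℝ {X | ∀ t : ℝ, lieExp (n := n) (t • X) ∈ T}

end LieGroups

/-! ### Roots and real root spaces -/

section Roots

variable {𝔤 : Type*} [LieRing 𝔤] [LieAlgebra ℝ 𝔤]

/-- The root space `{Z ∈ ℂ ⊗ 𝔤 | [H, Z] = α(H) Z for all H ∈ ℂ ⊗ 𝔱}` of a linear form `α` on
`ℂ ⊗ 𝔱`. -/
def complexRootSpace (𝔱 : Submodule ℝ 𝔤) (α : Module.Dual ℂ (𝔱.baseChange ℂ)) :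
    Submodule ℂ (ℂ ⊗[ℝ] 𝔤) where
  carrier := {Z | ∀ H : 𝔱.baseChange ℂ, ⁅(H : ℂ ⊗[ℝ] 𝔤), Z⁆ = α H • Z}
  add_mem' := by
    intro a b ha hb H
    rw [lie_add, ha H, hb H, smul_add]
  zero_mem' := by
    intro H
    simp
  smul_mem' := by
    intro c Z hZ H
    rw [lie_smul, hZ H, smul_comm]

/-- `α` is a root of `ℂ ⊗ 𝔤` with respect to `ℂ ⊗ 𝔱`. -/
def IsLieRoot (𝔱 : Submodule ℝ 𝔤) (α : Module.Dual ℂ (𝔱.baseChange ℂ)) : Prop :=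
  α ≠ 0 ∧ complexRootSpace 𝔱 α ≠ ⊥

/-- The real root space `𝔲_α = 𝔤 ∩ (𝔤_α ⊕ 𝔤_{-α})`; if `𝔤` is compact and `E_α, E_{-α}` belong to
a Weyl basis, this is the real span of `E_α - E_{-α}` and `i (E_α + E_{-α})`. -/
def realRootSpace (𝔱 : Submodule ℝ 𝔤) (α : Module.Dual ℂ (𝔱.baseChange ℂ)) : Set 𝔤 :=
  {X | (1 : ℂ) ⊗ₜ[ℝ] X ∈ complexRootSpace 𝔱 α ⊔ complexRootSpace 𝔱 (-α)}

end Roots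

/-! ### Riemannian metrics and geodesics -/

section Geodesics

variable {m : ℕ} {M : Type*} [TopologicalSpace M]
  [ChartedSpace (EuclideanSpace ℝ (Fin m)) M] [IsManifold (𝓡 m) ∞ M]

/-- Smooth Riemannian metrics on a smooth manifold of dimension `m`. -/
abbrev SmoothRiemannianMetric (m : ℕ) (M : Type*) [TopologicalSpace M]
    [ChartedSpace (EuclideanSpace ℝ (Fin m)) M] [IsManifold (𝓡 m) ∞ M] : Type _ :=
  ContMDiffRiemannianMetric (𝓡 m) ∞ (EuclideanSpace ℝ (Fin m))
    (fun x : M => TangentSpace (𝓡 m) x)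

/-- The components `g_y(v, w)` of the metric `g` in the chart at `p`, at the point of `M` with
coordinates `y`. -/
def metricInChart (g : SmoothRiemannianMetric m M) (p : M) (y v w : EuclideanSpace ℝ (Fin m)) : ℝ :=
  g.inner ((extChartAt (𝓡 m) p).symm y)
    (mfderiv (𝓡 m) (𝓡 m) (extChartAt (𝓡 m) p).symm y v)
    (mfderiv (𝓡 m) (𝓡 m) (extChartAt (𝓡 m) p).symm y w)

/-- The Christoffel symbols of the first kind of the Levi-Civita connection of `g` in the chart
at `p`: `g(∇_u v, w) = (∂_u g(v, w) + ∂_v g(u, w) - ∂_w g(u, v)) / 2` for constant `u, v, w`. -/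
def christoffelFirst (g : SmoothRiemannianMetric m M) (p : M)
    (y u v w : EuclideanSpace ℝ (Fin m)) : ℝ :=
  (fderiv ℝ (fun z => metricInChart g p z v w) y u
    + fderiv ℝ (fun z => metricInChart g p z u w) y v
    - fderiv ℝ (fun z => metricInChart g p z u v) y w) / 2

/-- A smooth curve `γ` is a geodesic of `g` if its covariant acceleration vanishes at each time
`t`: with `c` the expression of `γ` in the chart at `γ t`, one has
`g(c'' + Γ(c', c'), w) = 0` at `t` for all `w`. Constant curves are geodesics. -/
def IsGeodesic (g : SmoothRiemannianMetric m M) (γ : ℝ → M) : Prop :=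
  ContMDiff 𝓘(ℝ, ℝ) (𝓡 m) ∞ γ ∧
  ∀ (t : ℝ) (w : EuclideanSpace ℝ (Fin m)),
    let c : ℝ → EuclideanSpace ℝ (Fin m) := fun s => extChartAt (𝓡 m) (γ t) (γ s)
    metricInChart g (γ t) (c t) (deriv (deriv c) t) w
      + christoffelFirst g (γ t) (c t) (deriv c t) (deriv c t) w = 0

/-- The metric `g` is invariant under the action of `G` on `M`. -/
def IsInvariantMetric (G : Type*) [Group G] [MulAction G M] (g : SmoothRiemannianMetric m M) :
    Prop :=
  ∀ (a : G) (p : M) (v w : TangentSpace (𝓡 m) p),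
    g.inner (a • p)
      (mfderiv (𝓡 m) (𝓡 m) (fun q : M => a • q) p v)
      (mfderiv (𝓡 m) (𝓡 m) (fun q : M => a • q) p w) = g.inner p v w

/-- A curve that is a geodesic for every `G`-invariant Riemannian metric. -/
def IsEquigeodesic (G : Type*) [Group G] [MulAction G M] (m : ℕ)
    [ChartedSpace (EuclideanSpace ℝ (Fin m)) M] [IsManifold (𝓡 m) ∞ M] (γ : ℝ → M) : Prop :=
  ∀ g : SmoothRiemannianMetric m M, IsInvariantMetric G g → IsGeodesic g γ

end Geodesics

end

noncomputable section

open Filter Topology Set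

set_option linter.unusedSectionVars false

/-! ### Calculus: mixed partial derivatives and smoothness of solutions of autonomous equations. -/

section PartialDerivatives

variable {E F H : Type*} [NormedAddCommGroup E] [NormedSpace ℝ E] [NormedAddCommGroup F]
  [NormedSpace ℝ F] [NormedAddCommGroup H] [NormedSpace ℝ H]

/-! Averaging over the compact group gives an `Ad`-invariant inner product `B` on 𝔤. Writing o = eT
and identifying the tangent space at o with 𝔱^⊥, a `G`-invariant metric on `G ⧸ T` becomes B(A·,·)
with `A` positive, symmetric and commuting with `Ad T`.

The geometric input is `isGeodesic_oneParam_iff`: the orbit exp(tX)·o is a geodesic of an invariant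
metric g iff g_o(X, [X,Y]) = 0 for all Y. This is Noether's argument (`geodesic_expression`): the
pairing of the velocity with a Killing field has as derivative the pairing of the covariant
acceleration with that field, and by invariance the same pairing is a function of `Ad` at the base
point alone. For X in 𝔱^⊥ the condition reads B(AX, [X,Y]) = 0 for all Y, that is, [X, AX] = 0.

Suppose that no α_p ± α_q is a root. Then the X_p commute pairwise (`lie_eq_zero_of_not_isLieRoot`).
Complex root spaces are lines, so `A` is a real scalar on each real root space
(`exists_apply_eq_smul`). Hence AX is a combination of the X_p and commutes with X.

Conversely, apply the criterion to A = 1 + P, with P the orthogonal projection onto the real root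
space of α_p. It gives [X, X + X_p] = 0, so every X_p commutes with the sum X
(`sum_lie_eq_zero_of_forall_isGeodesic`). Split X_p = E_p + conj E_p into root vectors. If some
bracket of two of these vectors with non-opposite weights were nonzero, take one involving a weight
γ of maximal length. The vanishing of [X, X_p] forces another weight of the form δ + 2γ, and the
parallelogram law contradicts maximality (`CompactRealForm.lie_eq_zero_of_sum_lie_eq_zero`). So all
these brackets vanish, and `CompactRealForm.eq_zero_of_lie_eq_zero` turns this into the absence of
roots: a vanishing bracket of nonzero root vectors means that the sum of their roots is not a root.

The root theory is derived from a conjugation and a positive Hermitian form on ℂ ⊗ 𝔤, for which ad E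
has adjoint -ad(conj E). Its other ingredient is that 𝔱 is its own centralizer, which comes from
maximality of the torus (`IsMaximalTorus.mem_subgroupLieAlgebra_of_forall_lie_eq_zero`). -/

theorem fderiv_prodMk_left {f : E × F → H} {x : E} {y : F} (hf : DifferentiableAt ℝ f (x, y)) :
    fderiv ℝ (fun z => f (x, z)) y = (fderiv ℝ f (x, y)).comp (ContinuousLinearMap.inr ℝ E F) := by
  have h : HasFDerivAt (fun z : F => (x, z)) (ContinuousLinearMap.inr ℝ E F) y :=
    hasFDerivAt_prodMk_right x y
  exact (hf.hasFDerivAt.comp y h).fderiv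

theorem fderiv_prodMk_right {f : E × F → H} {x : E} {y : F} (hf : DifferentiableAt ℝ f (x, y)) :
    fderiv ℝ (fun z => f (z, y)) x = (fderiv ℝ f (x, y)).comp (ContinuousLinearMap.inl ℝ E F) := by
  have h : HasFDerivAt (fun z : E => (z, y)) (ContinuousLinearMap.inl ℝ E F) x :=
    hasFDerivAt_prodMk_left x y
  exact (hf.hasFDerivAt.comp x h).fderiv

theorem ContDiffAt.eventually_differentiableAt_of_two_le {f : E → H} {x : E}
    (hf : ContDiffAt ℝ 2 f x) : ∀ᶠ z in 𝓝 x, DifferentiableAt ℝ f z :=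
  (hf.eventually (by simp)).mono fun _ h => h.differentiableAt (by simp)

theorem ContDiffAt.hasFDerivAt_fderiv_of_two_le {f : E → H} {x : E} (hf : ContDiffAt ℝ 2 f x) :
    HasFDerivAt (fderiv ℝ f) (fderiv ℝ (fderiv ℝ f) x) x :=
  ((hf.fderiv_right (m := 1) (by norm_num)).differentiableAt (by simp)).hasFDerivAt

/-- The mixed second derivative, first in the second variable and then in the first one. -/
theorem ContDiffAt.hasFDerivAt_fderiv_snd {f : E × F → H} {x₀ : E} {y₀ : F}
    (hf : ContDiffAt ℝ 2 f (x₀, y₀)) (v : F) :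
    HasFDerivAt (fun x => fderiv ℝ (fun y => f (x, y)) y₀ v)
      ((ContinuousLinearMap.apply ℝ H ((0 : E), v)).comp
        ((fderiv ℝ (fderiv ℝ f) (x₀, y₀)).comp (ContinuousLinearMap.inl ℝ E F))) x₀ := by
  have h1 : HasFDerivAt (fun z : E => (z, y₀)) (ContinuousLinearMap.inl ℝ E F) x₀ :=
    hasFDerivAt_prodMk_left x₀ y₀
  have h2 := (ContinuousLinearMap.apply ℝ H ((0 : E), v)).hasFDerivAt.comp x₀
    ((hf.hasFDerivAt_fderiv_of_two_le).comp x₀ h1)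
  refine h2.congr_of_eventuallyEq ?_
  filter_upwards [h1.continuousAt.eventually hf.eventually_differentiableAt_of_two_le] with x hx
  rw [fderiv_prodMk_left hx]
  simp

/-- The mixed second derivative, first in the first variable and then in the second one. -/
theorem ContDiffAt.hasFDerivAt_fderiv_fst {f : E × F → H} {x₀ : E} {y₀ : F}
    (hf : ContDiffAt ℝ 2 f (x₀, y₀)) (u : E) :
    HasFDerivAt (fun y => fderiv ℝ (fun x => f (x, y)) x₀ u)
      ((ContinuousLinearMap.apply ℝ H (u, (0 : F))).comp
        ((fderiv ℝ (fderiv ℝ f) (x₀, y₀)).comp (ContinuousLinearMap.inr ℝ E F))) y₀ := by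
  have h1 : HasFDerivAt (fun z : F => (x₀, z)) (ContinuousLinearMap.inr ℝ E F) y₀ :=
    hasFDerivAt_prodMk_right x₀ y₀
  have h2 := (ContinuousLinearMap.apply ℝ H (u, (0 : F))).hasFDerivAt.comp y₀
    ((hf.hasFDerivAt_fderiv_of_two_le).comp y₀ h1)
  refine h2.congr_of_eventuallyEq ?_
  filter_upwards [h1.continuousAt.eventually hf.eventually_differentiableAt_of_two_le] with x hx
  rw [fderiv_prodMk_right hx]
  simp

theorem ContDiffAt.fderiv_fderiv_symm {f : E → H} {x : E} (hf : ContDiffAt ℝ 2 f x) (u v : E) :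
    fderiv ℝ (fderiv ℝ f) x u v = fderiv ℝ (fderiv ℝ f) x v u :=
  hf.isSymmSndFDerivAt (by simp) u v

/-- Regularity of the partial derivative in the second variable. -/
theorem ContDiffAt.fderiv_snd {f : E × F → H} {x₀ : E} {y₀ : F}
    (hf : ContDiffAt ℝ ∞ f (x₀, y₀)) :
    ContDiffAt ℝ ∞ (fun x => fderiv ℝ (fun y => f (x, y)) y₀) x₀ :=
  ContDiffAt.fderiv (f := fun x y => f (x, y)) (g := fun _ => y₀) (n := ∞) hf
    contDiffAt_const (by simp)

/-- Solutions of `c' = V(c)` with `V` smooth are smooth. -/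
theorem contDiffOn_of_hasDerivAt_vectorField {V : E → E} {U : Set E}
    (hV : ContDiffOn ℝ ∞ V U) {c : ℝ → E} {s : Set ℝ} (hs : IsOpen s) (hcU : MapsTo c s U)
    (hc : ∀ t ∈ s, HasDerivAt c (V (c t)) t) : ContDiffOn ℝ ∞ c s := by
  rw [contDiffOn_infty]
  intro k
  induction k with
  | zero =>
    exact contDiffOn_zero.2 fun t ht => (hc t ht).continuousAt.continuousWithinAt
  | succ k ih =>
    have : ContDiffOn ℝ (k + 1 : ℕ) c s := by
      push_cast
      rw [contDiffOn_succ_iff_deriv_of_isOpen hs]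
      refine ⟨fun t ht => (hc t ht).differentiableAt.differentiableWithinAt, by simp, ?_⟩
      refine ((hV.of_le (by exact_mod_cast le_top)).comp ih hcU).congr ?_
      intro t ht
      exact (hc t ht).deriv
    exact this

end PartialDerivatives

/-! ### Preferred charts and their inverses. -/

section Charts

variable {m : ℕ} {M : Type*} [TopologicalSpace M] [ChartedSpace (EuclideanSpace ℝ (Fin m)) M]

theorem extChartAt_target_mem_nhds_self (p : M) :
    (extChartAt (𝓡 m) p).target ∈ 𝓝 (extChartAt (𝓡 m) p p) :=
  extChartAt_target_mem_nhds p

theorem eventually_extChartAt_right_inv (p : M) :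
    ∀ᶠ y in 𝓝 (extChartAt (𝓡 m) p p), extChartAt (𝓡 m) p ((extChartAt (𝓡 m) p).symm y) = y := by
  filter_upwards [extChartAt_target_mem_nhds_self p] with y hy
  exact (extChartAt (𝓡 m) p).right_inv hy

variable [IsManifold (𝓡 m) ∞ M]

theorem contMDiffAt_extChartAt_symm_of_mem {p : M} {y : EuclideanSpace ℝ (Fin m)}
    (hy : y ∈ (extChartAt (𝓡 m) p).target) :
    ContMDiffAt 𝓘(ℝ, EuclideanSpace ℝ (Fin m)) (𝓡 m) ∞ (extChartAt (𝓡 m) p).symm y :=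
  (contMDiffOn_extChartAt_symm p).contMDiffAt ((isOpen_extChartAt_target p).mem_nhds hy)

theorem contMDiffAt_extChartAt_symm_self (p : M) :
    ContMDiffAt 𝓘(ℝ, EuclideanSpace ℝ (Fin m)) (𝓡 m) ∞ (extChartAt (𝓡 m) p).symm
      (extChartAt (𝓡 m) p p) :=
  contMDiffAt_extChartAt_symm_of_mem (mem_extChartAt_target p)

theorem hasMFDerivAt_extChartAt_symm_self (p : M) :
    HasMFDerivAt 𝓘(ℝ, EuclideanSpace ℝ (Fin m)) (𝓡 m) (extChartAt (𝓡 m) p).symm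
      (extChartAt (𝓡 m) p p) (ContinuousLinearMap.id ℝ (EuclideanSpace ℝ (Fin m))) := by
  have h := ((contMDiffAt_extChartAt_symm_self (m := m) p).mdifferentiableAt
    (by simp)).hasMFDerivAt
  have h2 := mfderivWithin_range_extChartAt_symm (I := 𝓡 m) (x := p)
  rw [ModelWithCorners.range_eq_univ, mfderivWithin_univ] at h2
  rw [h2] at h
  exact h

end Charts

/-! ### Manifold derivatives as ordinary derivatives in charts. -/

section ChartDerivative

variable {n m : ℕ} {M N : Type*} [TopologicalSpace M] [ChartedSpace (EuclideanSpace ℝ (Fin n)) M]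
  [TopologicalSpace N] [ChartedSpace (EuclideanSpace ℝ (Fin m)) N]

theorem HasMFDerivAt.hasFDerivAt_chart {f : M → N} {x : M} {y : N} (hy : f x = y)
    {f' : EuclideanSpace ℝ (Fin n) →L[ℝ] EuclideanSpace ℝ (Fin m)}
    (h : HasMFDerivAt (𝓡 n) (𝓡 m) f x f') :
    HasFDerivAt (fun z => extChartAt (𝓡 m) y (f ((extChartAt (𝓡 n) x).symm z))) f'
      (extChartAt (𝓡 n) x x) := by
  subst hy
  have h2 := h.2
  rw [ModelWithCorners.range_eq_univ] at h2
  exact h2.hasFDerivAt_of_univ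

theorem HasMFDerivAt.hasDerivAt_chart {c : ℝ → N} {s : ℝ} {y : N} (hy : c s = y)
    {f' : ℝ →L[ℝ] EuclideanSpace ℝ (Fin m)} (h : HasMFDerivAt 𝓘(ℝ, ℝ) (𝓡 m) c s f') :
    HasDerivAt (fun t => extChartAt (𝓡 m) y (c t)) (f' 1) s := by
  subst hy
  have h2 := h.2
  rw [ModelWithCorners.range_eq_univ] at h2
  have h3 : HasFDerivAt (fun t => extChartAt (𝓡 m) (c s) (c t)) f' s := h2.hasFDerivAt_of_univ
  exact h3.hasDerivAt

theorem HasMFDerivAt.hasDerivAt_of_normedSpace {E : Type*} [NormedAddCommGroup E]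
    [NormedSpace ℝ E] {c : ℝ → E} {s : ℝ} {f' : ℝ →L[ℝ] E}
    (h : HasMFDerivAt 𝓘(ℝ, ℝ) 𝓘(ℝ, E) c s f') : HasDerivAt c (f' 1) s := by
  have h2 : HasFDerivAt c f' s := h.hasFDerivAt
  exact h2.hasDerivAt

end ChartDerivative

/-! ### Multiplication and conjugation in the chart at the identity; the adjoint representation. -/

section LieGroupChart

variable {n : ℕ} {G : Type*} [TopologicalSpace G] [Group G]
  [ChartedSpace (EuclideanSpace ℝ (Fin n)) G]

variable (n G) in
/-- Multiplication read in the chart at the identity. -/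
def mulChart (p : EuclideanSpace ℝ (Fin n) × EuclideanSpace ℝ (Fin n)) :
    EuclideanSpace ℝ (Fin n) :=
  extChartAt (𝓡 n) (1 : G) ((extChartAt (𝓡 n) (1 : G)).symm p.1 *
    (extChartAt (𝓡 n) (1 : G)).symm p.2)

variable (n G) in
/-- Conjugation `(x, y) ↦ x y x⁻¹` read in the chart at the identity. -/
def conjChart (p : EuclideanSpace ℝ (Fin n) × EuclideanSpace ℝ (Fin n)) :
    EuclideanSpace ℝ (Fin n) :=
  extChartAt (𝓡 n) (1 : G) ((extChartAt (𝓡 n) (1 : G)).symm p.1 *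
    (extChartAt (𝓡 n) (1 : G)).symm p.2 * ((extChartAt (𝓡 n) (1 : G)).symm p.1)⁻¹)

variable (n G) in
/-- The coordinates of the identity. -/
abbrev chartOne : EuclideanSpace ℝ (Fin n) := extChartAt (𝓡 n) (1 : G) 1

theorem extChartAt_symm_chartOne :
    (extChartAt (𝓡 n) (1 : G)).symm (chartOne n G) = 1 :=
  extChartAt_to_inv (I := 𝓡 n) (1 : G)

variable [LieGroup (𝓡 n) ∞ G]

theorem contMDiffAt_symm_fst : ContMDiffAt 𝓘(ℝ, EuclideanSpace ℝ (Fin n) × EuclideanSpace ℝ (Fin n))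
    (𝓡 n) ∞ (fun p : EuclideanSpace ℝ (Fin n) × EuclideanSpace ℝ (Fin n) =>
      (extChartAt (𝓡 n) (1 : G)).symm p.1) (chartOne n G, chartOne n G) :=
  (contMDiffAt_extChartAt_symm_self (1 : G)).comp (chartOne n G, chartOne n G)
    contDiffAt_fst.contMDiffAt

theorem contMDiffAt_symm_snd : ContMDiffAt 𝓘(ℝ, EuclideanSpace ℝ (Fin n) × EuclideanSpace ℝ (Fin n))
    (𝓡 n) ∞ (fun p : EuclideanSpace ℝ (Fin n) × EuclideanSpace ℝ (Fin n) =>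
      (extChartAt (𝓡 n) (1 : G)).symm p.2) (chartOne n G, chartOne n G) :=
  (contMDiffAt_extChartAt_symm_self (1 : G)).comp (chartOne n G, chartOne n G)
    contDiffAt_snd.contMDiffAt

theorem contDiffAt_mulChart : ContDiffAt ℝ ∞ (mulChart n G) (chartOne n G, chartOne n G) := by
  refine ContMDiffAt.contDiffAt ?_
  refine ContMDiffAt.comp_of_eq (y := 1) (contMDiffAt_extChartAt (I := 𝓡 n))
    (contMDiffAt_symm_fst.mul contMDiffAt_symm_snd) ?_
  simp only [extChartAt_symm_chartOne, mul_one]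

theorem contDiffAt_conjChart : ContDiffAt ℝ ∞ (conjChart n G) (chartOne n G, chartOne n G) := by
  refine ContMDiffAt.contDiffAt ?_
  refine ContMDiffAt.comp_of_eq (y := 1) (contMDiffAt_extChartAt (I := 𝓡 n))
    ((contMDiffAt_symm_fst.mul contMDiffAt_symm_snd).mul contMDiffAt_symm_fst.inv) ?_
  simp only [extChartAt_symm_chartOne, mul_one, inv_one]

/-- The adjoint representation. -/
def lieAd (g : G) : GroupLieAlgebra (𝓡 n) G →L[ℝ] GroupLieAlgebra (𝓡 n) G :=
  fderiv ℝ (fun y => extChartAt (𝓡 n) (1 : G) (g * (extChartAt (𝓡 n) (1 : G)).symm y * g⁻¹))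
    (chartOne n G)

theorem contMDiff_conj (g : G) : ContMDiff (𝓡 n) (𝓡 n) ∞ (fun x : G => g * x * g⁻¹) :=
  (contMDiff_const.mul contMDiff_id).mul contMDiff_const

theorem hasMFDerivAt_conj (g : G) :
    HasMFDerivAt (𝓡 n) (𝓡 n) (fun x : G => g * x * g⁻¹) 1 (lieAd (n := n) g) := by
  have h := ((contMDiff_conj (n := n) g).mdifferentiableAt (by simp) (x := 1)).hasMFDerivAt
  have h2 := h.hasFDerivAt_chart (y := (1 : G)) (by simp)
  have h3 : lieAd (n := n) g = mfderiv (𝓡 n) (𝓡 n) (fun x : G => g * x * g⁻¹) 1 := h2.fderiv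
  rw [← h3] at h
  exact h

theorem lieAd_one : lieAd (n := n) (1 : G) = ContinuousLinearMap.id ℝ _ := by
  have h := hasMFDerivAt_conj (n := n) (1 : G)
  have h2 : HasMFDerivAt (𝓡 n) (𝓡 n) (fun x : G => (1 : G) * x * (1 : G)⁻¹) 1
      (ContinuousLinearMap.id ℝ (TangentSpace (𝓡 n) (1 : G))) := by
    have : (fun x : G => (1 : G) * x * (1 : G)⁻¹) = id := by ext; simp
    rw [this]
    exact hasMFDerivAt_id _
  exact hasMFDerivAt_unique h h2

theorem lieAd_mul (g h : G) : lieAd (n := n) (g * h) = (lieAd g).comp (lieAd h) := by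
  have h1 := hasMFDerivAt_conj (n := n) (g * h)
  have h3 : HasMFDerivAt (𝓡 n) (𝓡 n) (fun x : G => g * x * g⁻¹) (h * 1 * h⁻¹) (lieAd (n := n) g) := by
    have e : h * 1 * h⁻¹ = 1 := by simp
    rw [e]
    exact hasMFDerivAt_conj g
  have h2 := h3.comp (1 : G) (hasMFDerivAt_conj (n := n) h)
  have e : (fun x : G => g * x * g⁻¹) ∘ (fun x : G => h * x * h⁻¹) =
      fun x => g * h * x * (g * h)⁻¹ := by ext; simp [mul_assoc]
  rw [e] at h2
  exact hasMFDerivAt_unique h1 h2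

theorem lieAd_mul_apply (g h : G) (Y : GroupLieAlgebra (𝓡 n) G) :
    lieAd (g * h) Y = lieAd g (lieAd h Y) := by
  rw [lieAd_mul]; rfl

theorem lieAd_inv_apply (g : G) (Y : GroupLieAlgebra (𝓡 n) G) :
    lieAd g⁻¹ (lieAd g Y) = Y := by
  rw [← lieAd_mul_apply, inv_mul_cancel, lieAd_one]; rfl

theorem lieAd_apply_inv (g : G) (Y : GroupLieAlgebra (𝓡 n) G) :
    lieAd g (lieAd g⁻¹ Y) = Y := by
  rw [← lieAd_mul_apply, mul_inv_cancel, lieAd_one]; rfl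

end LieGroupChart

/-! ### The derivative of `Ad` is the Lie bracket. -/

section AdjointDerivative

variable {n : ℕ} {G : Type*} [TopologicalSpace G] [Group G]
  [ChartedSpace (EuclideanSpace ℝ (Fin n)) G]

theorem mulChart_chartOne_left : (fun y => mulChart n G (chartOne n G, y)) =ᶠ[𝓝 (chartOne n G)] id := by
  filter_upwards [eventually_extChartAt_right_inv (m := n) (1 : G)] with y hy
  simp only [mulChart, extChartAt_symm_chartOne, one_mul, hy, id]

theorem mulChart_chartOne_right : (fun y => mulChart n G (y, chartOne n G)) =ᶠ[𝓝 (chartOne n G)] id := by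
  filter_upwards [eventually_extChartAt_right_inv (m := n) (1 : G)] with y hy
  simp only [mulChart, extChartAt_symm_chartOne, mul_one, hy, id]

variable [LieGroup (𝓡 n) ∞ G]

theorem contMDiff_mul_left_infty (g : G) : ContMDiff (𝓡 n) (𝓡 n) ∞ (fun x : G => g * x) :=
  contMDiff_mul_left

/-- In the chart at 1 a left-invariant field is a partial derivative of multiplication. This
expression serves both for the bracket and for the smoothness of one-parameter subgroups. -/
theorem mfderiv_extChartAt_mulInvariantVectorField (Y : EuclideanSpace ℝ (Fin n))
    {g : G} (hg : g ∈ (extChartAt (𝓡 n) (1 : G)).source) :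
    mfderiv (𝓡 n) 𝓘(ℝ, EuclideanSpace ℝ (Fin n)) (extChartAt (𝓡 n) (1 : G)) g
        (mulInvariantVectorField (I := 𝓡 n) Y g) =
      fderiv ℝ (fun y => mulChart n G (extChartAt (𝓡 n) (1 : G) g, y)) (chartOne n G) Y := by
  have h1 := hasMFDerivAt_extChartAt_symm_self (m := n) (1 : G)
  have h2 : HasMFDerivAt (𝓡 n) (𝓡 n) (fun x : G => g * x)
      ((extChartAt (𝓡 n) (1 : G)).symm (extChartAt (𝓡 n) (1 : G) 1))
      (mfderiv (𝓡 n) (𝓡 n) (fun x : G => g * x) (1 : G)) := by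
    rw [extChartAt_symm_chartOne]
    exact ((contMDiff_mul_left_infty g).mdifferentiableAt (by simp)).hasMFDerivAt
  have h3 : HasMFDerivAt (𝓡 n) 𝓘(ℝ, EuclideanSpace ℝ (Fin n)) (extChartAt (𝓡 n) (1 : G))
      (((fun x : G => g * x) ∘ (extChartAt (𝓡 n) (1 : G)).symm) (extChartAt (𝓡 n) (1 : G) 1))
      (mfderiv (𝓡 n) 𝓘(ℝ, EuclideanSpace ℝ (Fin n)) (extChartAt (𝓡 n) (1 : G)) g) := by
    have : ((fun x : G => g * x) ∘ (extChartAt (𝓡 n) (1 : G)).symm)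
        (extChartAt (𝓡 n) (1 : G) 1) = g := by
      simp only [Function.comp_apply, extChartAt_symm_chartOne, mul_one]
    rw [this]
    exact (mdifferentiableAt_extChartAt (by simpa using hg)).hasMFDerivAt
  let A : EuclideanSpace ℝ (Fin n) →L[ℝ] EuclideanSpace ℝ (Fin n) :=
    mfderiv (𝓡 n) 𝓘(ℝ, EuclideanSpace ℝ (Fin n)) (extChartAt (𝓡 n) (1 : G)) g
  let B : EuclideanSpace ℝ (Fin n) →L[ℝ] EuclideanSpace ℝ (Fin n) :=
    mfderiv (𝓡 n) (𝓡 n) (fun x : G => g * x) (1 : G)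
  have h4 : HasFDerivAt (fun y => extChartAt (𝓡 n) (1 : G)
      (g * (extChartAt (𝓡 n) (1 : G)).symm y)) (A.comp (B.comp
      (ContinuousLinearMap.id ℝ (EuclideanSpace ℝ (Fin n))))) (chartOne n G) :=
    (h3.comp _ (h2.comp _ h1)).hasFDerivAt
  simp only [mulChart, (extChartAt (𝓡 n) (1 : G)).left_inv hg]
  rw [h4.fderiv]
  rfl

/-- The left-invariant vector field of `Y`, read in the chart at the identity. -/
theorem mpullbackWithin_mulInvariantVectorField (Y : EuclideanSpace ℝ (Fin n))
    {x : EuclideanSpace ℝ (Fin n)} (hx : x ∈ (extChartAt (𝓡 n) (1 : G)).target) :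
    VectorField.mpullbackWithin 𝓘(ℝ, EuclideanSpace ℝ (Fin n)) (𝓡 n)
        (extChartAt (𝓡 n) (1 : G)).symm (mulInvariantVectorField Y) (range (𝓡 n)) x =
      fderiv ℝ (fun y => mulChart n G (x, y)) (chartOne n G) Y := by
  set g : G := (extChartAt (𝓡 n) (1 : G)).symm x with hg
  have hgs : g ∈ (extChartAt (𝓡 n) (1 : G)).source := (extChartAt (𝓡 n) (1 : G)).map_target hx
  have h5 := mfderiv_extChartAt_mulInvariantVectorField Y hgs
  rw [(extChartAt (𝓡 n) (1 : G)).right_inv hx] at h5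
  have h6 : (mfderivWithin 𝓘(ℝ, EuclideanSpace ℝ (Fin n)) (𝓡 n)
      (extChartAt (𝓡 n) (1 : G)).symm (range (𝓡 n)) x).inverse =
      mfderiv (𝓡 n) 𝓘(ℝ, EuclideanSpace ℝ (Fin n)) (extChartAt (𝓡 n) (1 : G)) g :=
    ContinuousLinearMap.inverse_eq
      (mfderivWithin_extChartAt_symm_comp_mfderiv_extChartAt hx)
      (mfderiv_extChartAt_comp_mfderivWithin_extChartAt_symm hx)
  rw [← h5, VectorField.mpullbackWithin_apply, h6]

/-- Differentiating xy = (x y x⁻¹) x in y at the identity gives dL_x = dR_x ∘ Ad(x). -/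
theorem eventually_fderiv_mulChart :
    ∀ᶠ x in 𝓝 (chartOne n G), ∀ Y : EuclideanSpace ℝ (Fin n),
      fderiv ℝ (fun y => mulChart n G (x, y)) (chartOne n G) Y =
        fderiv ℝ (fun y => mulChart n G (y, x)) (chartOne n G)
          (lieAd (n := n) ((extChartAt (𝓡 n) (1 : G)).symm x) Y) := by
  have hd := (contDiffAt_mulChart (n := n) (G := G)).of_le (m := 2) ENat.LEInfty.out
    |>.eventually_differentiableAt_of_two_le
  have hc : ContinuousAt (fun x : EuclideanSpace ℝ (Fin n) => (chartOne n G, x)) (chartOne n G) := by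
    fun_prop
  filter_upwards [extChartAt_target_mem_nhds_self (m := n) (1 : G), hc.eventually hd]
    with x hx hdx Y
  set g : G := (extChartAt (𝓡 n) (1 : G)).symm x with hg
  have hconj := (hasMFDerivAt_conj (n := n) g).hasFDerivAt_chart (y := (1 : G)) (by simp)
  have hval : extChartAt (𝓡 n) (1 : G) (g * (extChartAt (𝓡 n) (1 : G)).symm
      (extChartAt (𝓡 n) (1 : G) 1) * g⁻¹) = chartOne n G := by
    rw [extChartAt_symm_chartOne, mul_one, mul_inv_cancel]
  have h1 : HasFDerivAt (fun y => mulChart n G (y, x))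
      (fderiv ℝ (fun y => mulChart n G (y, x)) (chartOne n G)) (chartOne n G) := by
    refine DifferentiableAt.hasFDerivAt ?_
    exact DifferentiableAt.comp (g := mulChart n G) (f := fun y => (y, x)) (chartOne n G) hdx
      (hasFDerivAt_prodMk_left (𝕜 := ℝ) (chartOne n G) x).differentiableAt
  have h2 := HasFDerivAt.comp (g := fun y => mulChart n G (y, x))
    (f := fun y => extChartAt (𝓡 n) (1 : G) (g * (extChartAt (𝓡 n) (1 : G)).symm y * g⁻¹))
    (chartOne n G) (by rw [hval]; exact h1) hconj
  have h3 : (fun y => mulChart n G (x, y)) =ᶠ[𝓝 (chartOne n G)]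
      (fun y => mulChart n G (y, x)) ∘ fun y => extChartAt (𝓡 n) (1 : G)
        (g * (extChartAt (𝓡 n) (1 : G)).symm y * g⁻¹) := by
    have hcs : ContinuousAt (fun y => g * (extChartAt (𝓡 n) (1 : G)).symm y * g⁻¹)
        (chartOne n G) := by
      have h0 := (contMDiffAt_extChartAt_symm_self (m := n) (1 : G)).continuousAt
      exact (((contMDiff_conj (n := n) g).continuous).continuousAt).comp h0
    have hs : (extChartAt (𝓡 n) (1 : G)).source ∈
        𝓝 (g * (extChartAt (𝓡 n) (1 : G)).symm (chartOne n G) * g⁻¹) := by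
      rw [extChartAt_symm_chartOne]
      simpa using extChartAt_source_mem_nhds (I := 𝓡 n) (1 : G)
    filter_upwards [hcs.preimage_mem_nhds hs] with y hy
    simp only [Function.comp_apply, mulChart]
    rw [(extChartAt (𝓡 n) (1 : G)).left_inv hy, ← hg]
    simp
  have h4 := (h2.congr_of_eventuallyEq h3).fderiv
  rw [h4]
  rfl

/-- The bracket of left-invariant fields is computed in the chart at 1. The fields take the values X
and Y there, so it is a difference of mixed second derivatives of multiplication. -/
theorem bracket_eq_fderiv_mulChart (X Y : EuclideanSpace ℝ (Fin n)) :
    @Bracket.bracket (GroupLieAlgebra (𝓡 n) G) (GroupLieAlgebra (𝓡 n) G) _ X Y =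
      fderiv ℝ (fun x => fderiv ℝ (fun y => mulChart n G (x, y)) (chartOne n G) Y) (chartOne n G) X
      - fderiv ℝ (fun x => fderiv ℝ (fun y => mulChart n G (x, y)) (chartOne n G) X)
          (chartOne n G) Y := by
  let X' : GroupLieAlgebra (𝓡 n) G := X
  let Y' : GroupLieAlgebra (𝓡 n) G := Y
  change ⁅X', Y'⁆ = _
  rw [GroupLieAlgebra.bracket_def, ← VectorField.mlieBracketWithin_univ,
    VectorField.mlieBracketWithin_apply]
  have hinv : (mfderiv (𝓡 n) 𝓘(ℝ, EuclideanSpace ℝ (Fin n)) (extChartAt (𝓡 n) (1 : G)) 1).inverse =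
      ContinuousLinearMap.id ℝ (EuclideanSpace ℝ (Fin n)) := by
    rw [mfderiv_extChartAt_self]
    exact ContinuousLinearMap.inverse_id
  rw [hinv]
  let V (Z : EuclideanSpace ℝ (Fin n)) : EuclideanSpace ℝ (Fin n) → EuclideanSpace ℝ (Fin n) :=
    VectorField.mpullbackWithin 𝓘(ℝ, EuclideanSpace ℝ (Fin n)) (𝓡 n)
        (extChartAt (𝓡 n) (1 : G)).symm (mulInvariantVectorField Z) (range (𝓡 n))
  have key (Z : EuclideanSpace ℝ (Fin n)) : V Z
      =ᶠ[𝓝 (chartOne n G)] fun x => fderiv ℝ (fun y => mulChart n G (x, y)) (chartOne n G) Z := by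
    filter_upwards [extChartAt_target_mem_nhds_self (m := n) (1 : G)] with x hx
    exact mpullbackWithin_mulInvariantVectorField Z hx
  have hu : (extChartAt (𝓡 n) (1 : G)).symm ⁻¹' univ ∩ range (𝓡 n) = univ := by
    simp
  rw [hu]
  change VectorField.lieBracketWithin ℝ (V X) (V Y) univ (chartOne n G) = _
  rw [VectorField.lieBracketWithin_univ, (key X).lieBracket_vectorField_eq (key Y)]
  have h1 (Z : EuclideanSpace ℝ (Fin n)) :
      fderiv ℝ (fun y => mulChart n G (chartOne n G, y)) (chartOne n G) Z = Z := by
    rw [mulChart_chartOne_left.fderiv_eq, fderiv_id]; rfl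
  simp only [VectorField.lieBracket_eq]
  rw [h1, h1]

/-- The derivative of `Ad`, read in the chart at the identity. -/
theorem hasFDerivAt_lieAd_chart (Y : EuclideanSpace ℝ (Fin n)) :
    HasFDerivAt (fun x => fderiv ℝ (fun y => conjChart n G (x, y)) (chartOne n G) Y)
      (fderiv ℝ (fun x => fderiv ℝ (fun y => mulChart n G (x, y)) (chartOne n G) Y) (chartOne n G) -
        (fderiv ℝ (fun y => fderiv ℝ (fun x => mulChart n G (x, y)) (chartOne n G) Y)
          (chartOne n G))) (chartOne n G) := by
  have hm := (contDiffAt_mulChart (n := n) (G := G)).of_le (m := 2) ENat.LEInfty.out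
  have hA : ContDiffAt ℝ ∞ (fun x => fderiv ℝ (fun y => conjChart n G (x, y)) (chartOne n G))
      (chartOne n G) := contDiffAt_conjChart.fderiv_snd
  have hA1 := (hA.differentiableAt (by simp)).hasFDerivAt
  have hB : ContDiffAt ℝ ∞ (fun x => fderiv ℝ (fun y => mulChart n G (y, x)) (chartOne n G))
      (chartOne n G) := by
    have : ContDiffAt ℝ ∞ (mulChart n G ∘ Prod.swap) (chartOne n G, chartOne n G) :=
      ContDiffAt.comp _ (by exact contDiffAt_mulChart)
        (contDiff_snd.prodMk contDiff_fst).contDiffAt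
    exact this.fderiv_snd
  have hB1 := (hB.differentiableAt (by simp)).hasFDerivAt
  have hAY := hA1.clm_apply (hasFDerivAt_const Y (chartOne n G))
  have hBA := hB1.clm_apply hAY
  have hL := hm.hasFDerivAt_fderiv_snd Y
  -- Both sides of dL_x Y = dR_x(Ad(x) Y) are differentiated at the identity. Since dR and `Ad` are
  -- the identity there, the product rule isolates the derivative of `Ad`.
  have heq := (hBA.congr_of_eventuallyEq
    (eventually_fderiv_mulChart.mono fun x hx => hx Y)).unique hL
  have hBY := (hB1.clm_apply (hasFDerivAt_const Y (chartOne n G))).fderiv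
  have h1 : fderiv ℝ (fun y => mulChart n G (y, chartOne n G)) (chartOne n G) =
      ContinuousLinearMap.id ℝ _ := by
    rw [mulChart_chartOne_right.fderiv_eq, fderiv_id]
  have h2 : fderiv ℝ (fun y => conjChart n G (chartOne n G, y)) (chartOne n G) =
      ContinuousLinearMap.id ℝ _ := by
    have : fderiv ℝ (fun y => conjChart n G (chartOne n G, y)) (chartOne n G) =
        lieAd (n := n) (1 : G) := by
      simp only [conjChart, extChartAt_symm_chartOne]; rfl
    rw [this, lieAd_one]; rfl
  rw [hL.fderiv, hBY]
  rw [h1, h2] at heq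
  refine hAY.congr_fderiv ?_
  rw [← heq, h2]
  ext X
  simp

/-- Symmetry of the second derivative of multiplication at (1, 1). It exchanges right translations
for left ones, so that the derivative of `Ad` matches `bracket_eq_fderiv_mulChart`. -/
theorem fderiv_fderiv_mulChart_swap (X Y : EuclideanSpace ℝ (Fin n)) :
    fderiv ℝ (fun y => fderiv ℝ (fun x => mulChart n G (x, y)) (chartOne n G) Y)
        (chartOne n G) X =
      fderiv ℝ (fun x => fderiv ℝ (fun y => mulChart n G (x, y)) (chartOne n G) X)
        (chartOne n G) Y := by
  have hm := (contDiffAt_mulChart (n := n) (G := G)).of_le (m := 2) ENat.LEInfty.out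
  rw [(hm.hasFDerivAt_fderiv_snd X).fderiv, (hm.hasFDerivAt_fderiv_fst Y).fderiv]
  simpa using hm.fderiv_fderiv_symm (0, X) (Y, 0)

/-- The derivative of `Ad` along a curve through the identity is the Lie bracket. -/
theorem hasDerivAt_lieAd_of_eq_one {c : ℝ → G} {s : ℝ} (hs : c s = 1)
    {f' : ℝ →L[ℝ] EuclideanSpace ℝ (Fin n)} (h : HasMFDerivAt 𝓘(ℝ, ℝ) (𝓡 n) c s f')
    (Y : EuclideanSpace ℝ (Fin n)) :
    HasDerivAt (fun t => lieAd (n := n) (c t) Y)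
      (@Bracket.bracket (GroupLieAlgebra (𝓡 n) G) (GroupLieAlgebra (𝓡 n) G) _ (f' 1) Y) s := by
  have h1 := h.hasDerivAt_chart hs
  have h2 := hasFDerivAt_lieAd_chart (n := n) (G := G) Y
  have h3 := HasFDerivAt.comp_hasDerivAt_of_eq s h2 h1 (by rw [hs])
  have hev : (fun t => lieAd (n := n) (c t) Y) =ᶠ[𝓝 s]
      (fun x => fderiv ℝ (fun y => conjChart n G (x, y)) (chartOne n G) Y) ∘
        fun t => extChartAt (𝓡 n) (1 : G) (c t) := by
    have hsrc := h.continuousAt.preimage_mem_nhds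
      (by rw [hs]; exact extChartAt_source_mem_nhds (I := 𝓡 n) (1 : G))
    filter_upwards [hsrc] with t ht
    have e := (extChartAt (𝓡 n) (1 : G)).left_inv ht
    change _ = fderiv ℝ (fun y => conjChart n G (extChartAt (𝓡 n) (1 : G) (c t), y))
      (chartOne n G) Y
    simp only [conjChart, e]
    rfl
  have h4 := h3.congr_of_eventuallyEq hev
  have h5 := bracket_eq_fderiv_mulChart (G := G) (f' 1) Y
  rw [← fderiv_fderiv_mulChart_swap (f' 1) Y] at h5
  rw [h5]
  exact h4

end AdjointDerivative

/-! ### One-parameter subgroups and the exponential map. -/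

section OneParameterSubgroups

variable {n : ℕ} {G : Type*} [TopologicalSpace G] [Group G]
  [ChartedSpace (EuclideanSpace ℝ (Fin n)) G]

theorem mulInvariantVectorField_one (X : GroupLieAlgebra (𝓡 n) G) :
    mulInvariantVectorField X (1 : G) = X := by
  have : (fun x : G => 1 * x) = id := by ext; simp
  rw [mulInvariantVectorField, this, mfderiv_id]
  rfl

variable [LieGroup (𝓡 n) ∞ G]

theorem contDiffAt_mulChart_of_mem {x : EuclideanSpace ℝ (Fin n)}
    (hx : x ∈ (extChartAt (𝓡 n) (1 : G)).target) :
    ContDiffAt ℝ ∞ (mulChart n G) (x, chartOne n G) := by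
  refine ContMDiffAt.contDiffAt ?_
  have h1 : ContMDiffAt 𝓘(ℝ, EuclideanSpace ℝ (Fin n) × EuclideanSpace ℝ (Fin n))
    (𝓡 n) ∞ (fun p : EuclideanSpace ℝ (Fin n) × EuclideanSpace ℝ (Fin n) =>
      (extChartAt (𝓡 n) (1 : G)).symm p.1) (x, chartOne n G) :=
    (contMDiffAt_extChartAt_symm_of_mem hx).comp (x, chartOne n G) contDiffAt_fst.contMDiffAt
  have h2 : ContMDiffAt 𝓘(ℝ, EuclideanSpace ℝ (Fin n) × EuclideanSpace ℝ (Fin n))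
    (𝓡 n) ∞ (fun p : EuclideanSpace ℝ (Fin n) × EuclideanSpace ℝ (Fin n) =>
      (extChartAt (𝓡 n) (1 : G)).symm p.2) (x, chartOne n G) :=
    (contMDiffAt_extChartAt_symm_self (1 : G)).comp (x, chartOne n G) contDiffAt_snd.contMDiffAt
  refine ContMDiffAt.comp_of_eq (y := (extChartAt (𝓡 n) (1 : G)).symm x)
    (contMDiffAt_extChartAt' (I := 𝓡 n) ?_) (h1.mul h2) ?_
  · simpa using (extChartAt (𝓡 n) (1 : G)).map_target hx
  · simp only [extChartAt_symm_chartOne, mul_one]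

theorem contMDiff_one_mulInvariantVectorField (X : GroupLieAlgebra (𝓡 n) G) :
    ContMDiff (𝓡 n) (𝓡 n).tangent 1
      (fun g : G => (⟨g, mulInvariantVectorField X g⟩ : TangentBundle (𝓡 n) G)) :=
  (contMDiff_mulInvariantVectorField X).of_le (by
    rw [minSmoothness_of_isRCLikeNormedField]; exact one_le_two)

theorem mfderiv_mul_left_mulInvariantVectorField (X : GroupLieAlgebra (𝓡 n) G) (g h : G) :
    mfderiv (𝓡 n) (𝓡 n) (fun x : G => g * x) h (mulInvariantVectorField X h) =
      mulInvariantVectorField X (g * h) := by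
  have h1 : MDifferentiableAt (𝓡 n) (𝓡 n) (fun x : G => g * x) (h * 1) :=
    (contMDiff_mul_left_infty g).mdifferentiableAt (by simp)
  have h2 : MDifferentiableAt (𝓡 n) (𝓡 n) (fun x : G => h * x) 1 :=
    (contMDiff_mul_left_infty h).mdifferentiableAt (by simp)
  have h3 := mfderiv_comp (1 : G) h1 h2
  have e : (fun x : G => g * x) ∘ (fun x : G => h * x) = fun x => g * h * x := by
    ext; simp [mul_assoc]
  rw [e, mul_one] at h3
  exact (congrArg (fun L : EuclideanSpace ℝ (Fin n) →L[ℝ] EuclideanSpace ℝ (Fin n) => L X) h3).symm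

theorem IsMIntegralCurveOn.mul_left {X : GroupLieAlgebra (𝓡 n) G} {γ : ℝ → G} {s : Set ℝ}
    (h : IsMIntegralCurveOn (I := 𝓡 n) γ (mulInvariantVectorField X) s) (g : G) :
    IsMIntegralCurveOn (I := 𝓡 n) (fun t => g * γ t) (mulInvariantVectorField X) s := by
  intro t ht
  have h1 : HasMFDerivAt (𝓡 n) (𝓡 n) (fun x : G => g * x) (γ t) _ :=
    ((contMDiff_mul_left_infty g).mdifferentiableAt (by simp)).hasMFDerivAt
  have h2 := h1.comp_hasMFDerivWithinAt t (h t ht)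
  have e : (mfderiv (𝓡 n) (𝓡 n) (fun x : G => g * x) (γ t)).comp
      ((1 : ℝ →L[ℝ] ℝ).smulRight (mulInvariantVectorField X (γ t))) =
      (1 : ℝ →L[ℝ] ℝ).smulRight (mulInvariantVectorField X (g * γ t)) := by
    rw [← mfderiv_mul_left_mulInvariantVectorField]
    ext
    simp
  exact h2.congr_mfderiv e

variable [T2Space G]

/-- Left translates of one local solution through 1 give, at every point, a solution living for the
same time ε. Hence the field is complete. -/
theorem exists_isMIntegralCurve_mulInvariantVectorField (X : GroupLieAlgebra (𝓡 n) G) :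
    ∃ γ : ℝ → G, γ 0 = 1 ∧
      IsMIntegralCurve (I := 𝓡 n) γ (mulInvariantVectorField (I := 𝓡 n) X) := by
  obtain ⟨γ, h0, hγ⟩ := exists_isMIntegralCurveAt_of_contMDiffAt_boundaryless (I := 𝓡 n) 0
    ((contMDiff_one_mulInvariantVectorField X).contMDiffAt (x := (1 : G)))
  obtain ⟨ε, hε, hγ⟩ := isMIntegralCurveAt_iff'.1 hγ
  refine exists_isMIntegralCurve_of_isMIntegralCurveOn (contMDiff_one_mulInvariantVectorField X) hε
    (fun x => ⟨fun t => x * γ t, by simp [h0], ?_⟩) 1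
  have := hγ.mul_left x
  rwa [Real.ball_eq_Ioo, zero_sub, zero_add] at this

/-- The one-parameter subgroup `t ↦ exp (t X)`. -/
def oneParam (X : GroupLieAlgebra (𝓡 n) G) : ℝ → G :=
  (exists_isMIntegralCurve_mulInvariantVectorField X).choose

theorem oneParam_zero (X : GroupLieAlgebra (𝓡 n) G) : oneParam X 0 = 1 :=
  (exists_isMIntegralCurve_mulInvariantVectorField X).choose_spec.1

theorem isMIntegralCurve_oneParam (X : GroupLieAlgebra (𝓡 n) G) :
    IsMIntegralCurve (I := 𝓡 n) (oneParam X) (mulInvariantVectorField (I := 𝓡 n) X) :=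
  (exists_isMIntegralCurve_mulInvariantVectorField X).choose_spec.2

theorem IsMIntegralCurve.eq_of_mulInvariantVectorField {X : GroupLieAlgebra (𝓡 n) G} {γ γ' : ℝ → G}
    (h : IsMIntegralCurve (I := 𝓡 n) γ (mulInvariantVectorField X))
    (h' : IsMIntegralCurve (I := 𝓡 n) γ' (mulInvariantVectorField X)) (h0 : γ 0 = γ' 0) : γ = γ' :=
  isMIntegralCurve_Ioo_eq_of_contMDiff_boundaryless (t₀ := 0)
    (contMDiff_one_mulInvariantVectorField X) h h' h0

/-- Running the curve of X at speed t gives an integral curve for t • X, and integral curves are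
unique. In particular the default value of `lieExp` is never taken. -/
theorem lieExp_smul (t : ℝ) (X : GroupLieAlgebra (𝓡 n) G) :
    lieExp (n := n) (t • X) = oneParam X t := by
  have h := exists_isMIntegralCurve_mulInvariantVectorField (t • X)
  rw [lieExp, dif_pos h]
  have h1 : IsMIntegralCurve (I := 𝓡 n) (oneParam X ∘ (· * t)) (mulInvariantVectorField (t • X)) := by
    rw [mulInvariantVectorField_smul]
    exact (isMIntegralCurve_oneParam X).comp_mul t
  have h2 := h.choose_spec.2.eq_of_mulInvariantVectorField h1 (by
    rw [h.choose_spec.1]; simp [oneParam_zero])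
  rw [h2]
  simp

theorem oneParam_add (X : GroupLieAlgebra (𝓡 n) G) (s t : ℝ) :
    oneParam X (s + t) = oneParam X s * oneParam X t := by
  have h1 := (isMIntegralCurve_oneParam X).comp_add s
  have h2 : IsMIntegralCurve (I := 𝓡 n) (fun t => oneParam X s * oneParam X t)
      (mulInvariantVectorField X) := by
    rw [isMIntegralCurve_iff_isMIntegralCurveOn]
    exact ((isMIntegralCurve_oneParam X).isMIntegralCurveOn univ).mul_left _
  have h3 := h1.eq_of_mulInvariantVectorField h2 (by simp [oneParam_zero])
  have := congrFun h3 t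
  simp only [Function.comp_apply] at this
  rw [add_comm, this]

theorem oneParam_neg (X : GroupLieAlgebra (𝓡 n) G) (t : ℝ) :
    oneParam X (-t) = (oneParam X t)⁻¹ := by
  rw [eq_inv_iff_mul_eq_one, ← oneParam_add, neg_add_cancel, oneParam_zero]

theorem continuous_oneParam (X : GroupLieAlgebra (𝓡 n) G) : Continuous (oneParam X) :=
  (isMIntegralCurve_oneParam X).continuous

theorem hasMFDerivAt_oneParam_zero (X : GroupLieAlgebra (𝓡 n) G) :
    HasMFDerivAt 𝓘(ℝ, ℝ) (𝓡 n) (oneParam X) 0 ((1 : ℝ →L[ℝ] ℝ).smulRight X) := by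
  have h := isMIntegralCurve_oneParam X 0
  rw [oneParam_zero, mulInvariantVectorField_one] at h
  exact h

/-- A homomorphism differentiable at 0 is a one-parameter subgroup: c(s) = c(t) c(s - t) transports
its velocity from time 0 to time t. -/
theorem isMIntegralCurve_of_map_add {c : ℝ → G} (hc : ∀ s t, c (s + t) = c s * c t)
    {X : GroupLieAlgebra (𝓡 n) G}
    (h : HasMFDerivAt 𝓘(ℝ, ℝ) (𝓡 n) c 0 ((1 : ℝ →L[ℝ] ℝ).smulRight X)) : c = oneParam X := by
  have h0 : c 0 = 1 := by
    have := hc 0 0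
    simpa using this
  have h1 : IsMIntegralCurve (I := 𝓡 n) c (mulInvariantVectorField X) := by
    intro t
    have h2 : HasMFDerivAt 𝓘(ℝ, ℝ) 𝓘(ℝ, ℝ) (fun s : ℝ => s - t) t (ContinuousLinearMap.id ℝ ℝ) :=
      ((hasFDerivAt_id t).sub_const t).hasMFDerivAt
    have h3 : HasMFDerivAt 𝓘(ℝ, ℝ) (𝓡 n) c ((fun s : ℝ => s - t) t)
        ((1 : ℝ →L[ℝ] ℝ).smulRight X) := by
      have e : (fun s : ℝ => s - t) t = 0 := sub_self t
      rw [e]; exact h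
    have h4 : HasMFDerivAt (𝓡 n) (𝓡 n) (fun x : G => c t * x) ((c ∘ fun s : ℝ => s - t) t)
        (mfderiv (𝓡 n) (𝓡 n) (fun x : G => c t * x) 1) := by
      have e : (c ∘ fun s : ℝ => s - t) t = 1 := by simp [h0]
      rw [e]
      exact ((contMDiff_mul_left_infty (n := n) (c t)).mdifferentiableAt (by simp)).hasMFDerivAt
    have h5 := h4.comp t (h3.comp (f := fun s : ℝ => s - t) t h2)
    have e : (fun x : G => c t * x) ∘ (c ∘ fun s : ℝ => s - t) = c := by
      ext s
      simp [← hc]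
    rw [e] at h5
    refine h5.congr_mfderiv ?_
    refine ContinuousLinearMap.ext_ring ?_
    change mfderiv (𝓡 n) (𝓡 n) (fun x : G => c t * x) 1 ((1 : ℝ) • X) =
      (1 : ℝ) • mulInvariantVectorField X (c t)
    rw [one_smul, one_smul]
    rfl
  exact h1.eq_of_mulInvariantVectorField (isMIntegralCurve_oneParam X) (by rw [h0, oneParam_zero])

theorem conj_oneParam (g : G) (X : GroupLieAlgebra (𝓡 n) G) (t : ℝ) :
    g * oneParam X t * g⁻¹ = oneParam (lieAd g X) t := by
  have h1 : HasMFDerivAt (𝓡 n) (𝓡 n) (fun x : G => g * x * g⁻¹) (oneParam X 0) (lieAd (n := n) g) := by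
    rw [oneParam_zero]
    exact hasMFDerivAt_conj g
  have h2 := h1.comp 0 (hasMFDerivAt_oneParam_zero X)
  refine congrFun (isMIntegralCurve_of_map_add (c := fun t => g * oneParam X t * g⁻¹) ?_ ?_) t
  · intro s t
    simp [oneParam_add, mul_assoc]
  · refine h2.congr_mfderiv ?_
    refine ContinuousLinearMap.ext_ring ?_
    change lieAd g ((1 : ℝ) • X) = (1 : ℝ) • lieAd g X
    rw [one_smul, one_smul]

/-- Integral curves are a priori only differentiable. The equation in the chart at 1 bootstraps this
to smoothness at time 0, and the homomorphism property carries it to all times. -/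
theorem contMDiff_oneParam (X : GroupLieAlgebra (𝓡 n) G) :
    ContMDiff 𝓘(ℝ, ℝ) (𝓡 n) ∞ (oneParam X) := by
  let V : EuclideanSpace ℝ (Fin n) → EuclideanSpace ℝ (Fin n) :=
    fun x => fderiv ℝ (fun y => mulChart n G (x, y)) (chartOne n G) X
  have hV : ContDiffOn ℝ ∞ V (extChartAt (𝓡 n) (1 : G)).target := fun x hx =>
    ((contDiffAt_mulChart_of_mem hx).fderiv_snd.clm_apply contDiffAt_const).contDiffWithinAt
  let s := oneParam X ⁻¹' (extChartAt (𝓡 n) (1 : G)).source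
  have hs : IsOpen s := (isOpen_extChartAt_source (1 : G)).preimage (continuous_oneParam X)
  have hc : ContDiffOn ℝ ∞ (fun t => extChartAt (𝓡 n) (1 : G) (oneParam X t)) s := by
    refine contDiffOn_of_hasDerivAt_vectorField hV hs
      (fun t ht => (extChartAt (𝓡 n) (1 : G)).map_source ht) fun t ht => ?_
    have h1 : HasMFDerivAt (𝓡 n) 𝓘(ℝ, EuclideanSpace ℝ (Fin n)) (extChartAt (𝓡 n) (1 : G))
        (oneParam X t) _ := (mdifferentiableAt_extChartAt (by simpa [s] using ht)).hasMFDerivAt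
    have h3 := (h1.comp t (isMIntegralCurve_oneParam X t)).hasDerivAt_of_normedSpace
    refine h3.congr_deriv ?_
    change mfderiv (𝓡 n) 𝓘(ℝ, EuclideanSpace ℝ (Fin n)) (extChartAt (𝓡 n) (1 : G)) (oneParam X t)
      ((1 : ℝ) • mulInvariantVectorField X (oneParam X t)) = _
    rw [one_smul]
    exact mfderiv_extChartAt_mulInvariantVectorField X ht
  have h0 : ContMDiffAt 𝓘(ℝ, ℝ) (𝓡 n) ∞ (oneParam X) 0 := by
    have hmem : (0 : ℝ) ∈ s := by
      rw [mem_preimage, oneParam_zero]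
      exact mem_extChartAt_source (1 : G)
    have h1 := (hc.contDiffAt (hs.mem_nhds hmem)).contMDiffAt
    have h2 := ContMDiffAt.comp_of_eq (x := (0 : ℝ)) (contMDiffAt_extChartAt_symm_self (m := n) (1 : G))
      h1 (by rw [oneParam_zero])
    refine h2.congr_of_eventuallyEq ?_
    filter_upwards [hs.mem_nhds hmem] with t ht
    exact ((extChartAt (𝓡 n) (1 : G)).left_inv ht).symm
  intro t
  have h1 : ContMDiffAt 𝓘(ℝ, ℝ) (𝓡 n) ∞ (fun u => oneParam X t * oneParam X (u - t)) t := by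
    refine contMDiffAt_const.mul ?_
    refine ContMDiffAt.comp_of_eq (y := 0) h0 ?_ (sub_self t)
    exact (contDiff_id.sub contDiff_const).contMDiff.contMDiffAt
  convert h1 using 1
  ext u
  rw [← oneParam_add, add_sub_cancel]

/-- The derivative of `t ↦ Ad (exp (t X)) Y`. -/
theorem hasDerivAt_lieAd_oneParam (X Y : GroupLieAlgebra (𝓡 n) G) (t : ℝ) :
    HasDerivAt (F := EuclideanSpace ℝ (Fin n)) (fun s => lieAd (oneParam X s) Y)
      (⁅X, lieAd (oneParam X t) Y⁆ : GroupLieAlgebra (𝓡 n) G) t := by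
  have h1 := hasDerivAt_lieAd_of_eq_one (c := oneParam X) (s := 0) (oneParam_zero X)
    (hasMFDerivAt_oneParam_zero X) (lieAd (oneParam X t) Y)
  have e : ((1 : ℝ →L[ℝ] ℝ).smulRight X) 1 = X := one_smul ℝ X
  -- Since Ad(exp sX) = Ad(exp (s-t)X) Ad(exp tX), the derivative at t reduces to the derivative at
  -- 0.
  have h2 : HasDerivAt (F := EuclideanSpace ℝ (Fin n))
      (fun s => lieAd (oneParam X s) (lieAd (oneParam X t) Y))
      (⁅X, lieAd (oneParam X t) Y⁆ : GroupLieAlgebra (𝓡 n) G) (t - t) := by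
    rw [sub_self]
    exact h1.congr_deriv (congrArg (fun Z : GroupLieAlgebra (𝓡 n) G =>
      (⁅Z, lieAd (oneParam X t) Y⁆ : GroupLieAlgebra (𝓡 n) G)) e)
  have h3 := h2.comp_sub_const t t
  refine h3.congr_of_eventuallyEq (Eventually.of_forall fun s => ?_)
  have e2 := lieAd_mul_apply (oneParam X (s - t)) (oneParam X t) Y
  rw [← oneParam_add, sub_add_cancel] at e2
  exact e2

end OneParameterSubgroups

/-! ### Local sections and fibres of submersions. -/

section Submersions

variable {n m : ℕ} {M N : Type*} [TopologicalSpace M] [ChartedSpace (EuclideanSpace ℝ (Fin n)) M]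
  [TopologicalSpace N] [ChartedSpace (EuclideanSpace ℝ (Fin m)) N]
  [IsManifold (𝓡 n) ∞ M] [IsManifold (𝓡 m) ∞ N]

theorem contMDiffAt_extend_symm_euclidean
    {φ : OpenPartialHomeomorph M (EuclideanSpace ℝ (Fin n))}
    (hφ : φ ∈ IsManifold.maximalAtlas (𝓡 n) ∞ M) {y : EuclideanSpace ℝ (Fin n)}
    (hy : y ∈ (φ.extend (𝓡 n)).target) :
    ContMDiffAt 𝓘(ℝ, EuclideanSpace ℝ (Fin n)) (𝓡 n) ∞ (φ.extend (𝓡 n)).symm y := by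
  have h := contMDiffOn_extend_symm hφ
  have e : Set.image (𝓡 n) φ.target = (φ.extend (𝓡 n)).target := by
    rw [φ.extend_target_eq_image_source, ← φ.image_source_eq_target, ← image_comp]
    rfl
  rw [e] at h
  exact h.contMDiffAt (φ.isOpen_extend_target.mem_nhds hy)

/-- A submersion has smooth local sections through every point. -/
theorem Manifold.IsSubmersion.exists_section {f : M → N}
    (hf : Manifold.IsSubmersion (𝓡 n) (𝓡 m) ∞ f) (a : M) :
    ∃ σ : N → M, σ (f a) = a ∧ ContMDiffAt (𝓡 m) (𝓡 n) ∞ σ (f a) ∧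
      ∀ᶠ q in 𝓝 (f a), f (σ q) = q := by
  obtain ⟨F, _, _, hF⟩ := hf
  have h := hF a
  set φ := h.domChart with hφ
  set ψ := h.codChart with hψ
  have hw := h.writtenInCharts
  have hasrc : a ∈ (φ.extend (𝓡 n)).source := by
    rw [φ.extend_source]; exact h.mem_domChart_source
  have hfsrc : f a ∈ (ψ.extend (𝓡 m)).source := by
    rw [ψ.extend_source]; exact h.mem_codChart_source
  let y₀ := φ.extend (𝓡 n) a
  have hy₀ : y₀ ∈ (φ.extend (𝓡 n)).target := (φ.extend (𝓡 n)).map_source hasrc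
  -- In the normal form, f is the projection to the first factor. The section freezes the second
  -- coordinate at its value at a.
  let τ : N → EuclideanSpace ℝ (Fin n) :=
    fun q => h.equiv.symm (ψ.extend (𝓡 m) q, (h.equiv y₀).2)
  have hfst : (h.equiv y₀).1 = ψ.extend (𝓡 m) (f a) := by
    have := hw hy₀
    simp only [Function.comp_apply] at this
    rw [← this, (φ.extend (𝓡 n)).left_inv hasrc]
  have hτa : τ (f a) = y₀ := by
    simp only [τ, ← hfst, Prod.mk.eta, ContinuousLinearEquiv.symm_apply_apply]
  have hψ1 : ContMDiffAt (𝓡 m) 𝓘(ℝ, EuclideanSpace ℝ (Fin m)) ∞ (ψ.extend (𝓡 m)) (f a) :=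
    ψ.contMDiffAt_extend h.codChart_mem_maximalAtlas h.mem_codChart_source
  have hτ : ContMDiffAt (𝓡 m) 𝓘(ℝ, EuclideanSpace ℝ (Fin n)) ∞ τ (f a) := by
    have h1 : ContDiff ℝ ∞ (fun z : EuclideanSpace ℝ (Fin m) => h.equiv.symm (z, (h.equiv y₀).2)) :=
      h.equiv.symm.contDiff.comp (contDiff_id.prodMk contDiff_const)
    exact h1.contMDiff.contMDiffAt.comp (f a) hψ1
  refine ⟨fun q => (φ.extend (𝓡 n)).symm (τ q), ?_, ?_, ?_⟩
  · simp only [hτa]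
    exact (φ.extend (𝓡 n)).left_inv hasrc
  · refine ContMDiffAt.comp_of_eq (contMDiffAt_extend_symm_euclidean
      h.domChart_mem_maximalAtlas hy₀) hτ hτa
  · have ht : ∀ᶠ q in 𝓝 (f a), τ q ∈ (φ.extend (𝓡 n)).target :=
      hτ.continuousAt.preimage_mem_nhds (by
        rw [hτa]; exact φ.isOpen_extend_target.mem_nhds hy₀)
    filter_upwards [ht, ψ.open_source.mem_nhds h.mem_codChart_source] with q hq hqs
    have h1 := hw hq
    simp only [Function.comp_apply, τ, ContinuousLinearEquiv.apply_symm_apply] at h1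
    have h2 : f ((φ.extend (𝓡 n)).symm (τ q)) ∈ ψ.source := by
      apply h.source_subset_preimage_source
      rw [← φ.extend_source (I := 𝓡 n)]
      exact (φ.extend (𝓡 n)).map_target hq
    refine (ψ.extend (𝓡 m)).injOn ?_ ?_ h1
    · rw [ψ.extend_source]; exact h2
    · rw [ψ.extend_source]; exact hqs

/-- The fibres of a submersion are locally connected by smooth curves. -/
theorem Manifold.IsSubmersion.exists_curve_in_fibre {f : M → N}
    (hf : Manifold.IsSubmersion (𝓡 n) (𝓡 m) ∞ f) (a : M) :
    ∀ᶠ b in 𝓝 a, f b = f a → ∃ (c : ℝ → M) (I : Set ℝ), IsOpen I ∧ Icc 0 1 ⊆ I ∧ c 0 = a ∧ c 1 = b ∧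
      ∀ s ∈ I, MDifferentiableAt 𝓘(ℝ, ℝ) (𝓡 n) c s ∧ f (c s) = f a := by
  obtain ⟨F, _, _, hF⟩ := hf
  have h := hF a
  set φ := h.domChart with hφ
  set ψ := h.codChart with hψ
  have hw := h.writtenInCharts
  have hasrc : a ∈ (φ.extend (𝓡 n)).source := by
    rw [φ.extend_source]; exact h.mem_domChart_source
  let y₀ := φ.extend (𝓡 n) a
  have hy₀ : y₀ ∈ (φ.extend (𝓡 n)).target := (φ.extend (𝓡 n)).map_source hasrc
  obtain ⟨ε, hε, hball⟩ := Metric.isOpen_iff.1 φ.isOpen_extend_target y₀ hy₀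
  have hφc : ContinuousAt (φ.extend (𝓡 n)) a := φ.continuousAt_extend h.mem_domChart_source
  filter_upwards [φ.open_source.mem_nhds h.mem_domChart_source,
    hφc.preimage_mem_nhds (Metric.ball_mem_nhds y₀ hε)] with b hbs hb hfb
  have hbsrc : b ∈ (φ.extend (𝓡 n)).source := by
    rw [φ.extend_source]; exact hbs
  -- The curve is a straight segment in the normal-form chart. Its first component is constant
  -- because a and b have the same image.
  let ℓ : ℝ → EuclideanSpace ℝ (Fin n) := fun s => y₀ + s • (φ.extend (𝓡 n) b - y₀)
  have hℓ : ContDiff ℝ ∞ ℓ := by fun_prop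
  have key (z : M) (hz : z ∈ (φ.extend (𝓡 n)).source) :
      (h.equiv (φ.extend (𝓡 n) z)).1 = ψ.extend (𝓡 m) (f z) := by
    have := hw ((φ.extend (𝓡 n)).map_source hz)
    simp only [Function.comp_apply] at this
    rw [← this, (φ.extend (𝓡 n)).left_inv hz]
  refine ⟨fun s => (φ.extend (𝓡 n)).symm (ℓ s), ℓ ⁻¹' Metric.ball y₀ ε,
    Metric.isOpen_ball.preimage hℓ.continuous, ?_, ?_, ?_, ?_⟩
  · intro s hs
    have h1 : ℓ s ∈ segment ℝ y₀ (φ.extend (𝓡 n) b) := by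
      rw [segment_eq_image']
      exact ⟨s, hs, rfl⟩
    exact (convex_ball y₀ ε).segment_subset (Metric.mem_ball_self hε) hb h1
  · simp only [ℓ, zero_smul, add_zero]
    exact (φ.extend (𝓡 n)).left_inv hasrc
  · simp only [ℓ, one_smul, add_sub_cancel]
    exact (φ.extend (𝓡 n)).left_inv hbsrc
  · intro s hs
    have hst : ℓ s ∈ (φ.extend (𝓡 n)).target := hball hs
    constructor
    · have h1 := (contMDiffAt_extend_symm_euclidean h.domChart_mem_maximalAtlas hst).comp s
        hℓ.contMDiff.contMDiffAt
      exact h1.mdifferentiableAt (by simp)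
    · have h1 : (φ.extend (𝓡 n)).symm (ℓ s) ∈ (φ.extend (𝓡 n)).source :=
        (φ.extend (𝓡 n)).map_target hst
      have h2 := key _ h1
      rw [(φ.extend (𝓡 n)).right_inv hst] at h2
      have h3 : (h.equiv (ℓ s)).1 = ψ.extend (𝓡 m) (f a) := by
        have ha := key a hasrc
        have hb := key b hbsrc
        rw [hfb] at hb
        simp only [ℓ, map_add, map_smul, map_sub, Prod.fst_add, Prod.smul_fst, Prod.fst_sub]
        rw [ha, hb]
        simp
      refine (ψ.extend (𝓡 m)).injOn ?_ ?_ (h2.symm.trans h3)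
      · rw [ψ.extend_source]
        apply h.source_subset_preimage_source
        rw [← φ.extend_source (I := 𝓡 n)]
        exact h1
      · rw [ψ.extend_source]; exact h.mem_codChart_source

/-- A curve with vanishing derivative is constant. -/
theorem eq_of_forall_hasMFDerivAt_zero {c : ℝ → N}
    (hc : ∀ t, HasMFDerivAt 𝓘(ℝ, ℝ) (𝓡 m) c t
      (0 : ℝ →L[ℝ] EuclideanSpace ℝ (Fin m))) (s t : ℝ) : c s = c t := by
  have hl : IsLocallyConstant c := by
    rw [IsLocallyConstant.iff_eventually_eq]
    intro t₀
    have hcont : Continuous c := continuous_iff_continuousAt.2 fun t => (hc t).continuousAt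
    obtain ⟨ε, hε, hball⟩ := Metric.mem_nhds_iff.1
      (hcont.continuousAt.preimage_mem_nhds (extChartAt_source_mem_nhds (I := 𝓡 m) (c t₀)))
    have hd : ∀ u ∈ Metric.ball t₀ ε,
        HasDerivAt (fun t => extChartAt (𝓡 m) (c t₀) (c t)) 0 u := by
      intro u hu
      have h1 : HasMFDerivAt (𝓡 m) 𝓘(ℝ, EuclideanSpace ℝ (Fin m)) (extChartAt (𝓡 m) (c t₀))
        (c u) _ := (mdifferentiableAt_extChartAt (by simpa using hball hu)).hasMFDerivAt
      have h2 := (h1.comp u (hc u)).hasDerivAt_of_normedSpace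
      refine h2.congr_deriv ?_
      exact map_zero (mfderiv (𝓡 m) 𝓘(ℝ, EuclideanSpace ℝ (Fin m)) (extChartAt (𝓡 m) (c t₀)) (c u))
    filter_upwards [Metric.ball_mem_nhds t₀ hε] with u hu
    have h3 := Metric.isOpen_ball.is_const_of_deriv_eq_zero (convex_ball t₀ ε).isPreconnected
      (fun u hu => (hd u hu).differentiableAt.differentiableWithinAt)
      (fun u hu => (hd u hu).deriv) hu (Metric.mem_ball_self hε)
    exact (extChartAt (𝓡 m) (c t₀)).injOn (hball hu) (hball (Metric.mem_ball_self hε)) h3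
  exact hl.apply_eq_of_preconnectedSpace s t

end Submersions

/-! ### The quotient as a homogeneous space and the Lie algebra of the isotropy group. -/

section HomogeneousSpaces

variable {n m : ℕ} {G : Type*} [TopologicalSpace G] [Group G]
  [ChartedSpace (EuclideanSpace ℝ (Fin n)) G] [LieGroup (𝓡 n) ∞ G] {T : Subgroup G}
  [ChartedSpace (EuclideanSpace ℝ (Fin m)) (G ⧸ T)] [IsManifold (𝓡 m) ∞ (G ⧸ T)]

/-- Only the submersion property of the projection is given, so smoothness of the action is obtained
by lifting the point to the group along a local section and multiplying there. -/
theorem ContMDiffAt.smul_quotient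
    (hπ : Manifold.IsSubmersion (𝓡 n) (𝓡 m) ∞ (QuotientGroup.mk : G → G ⧸ T))
    {E' H' M' : Type*} [NormedAddCommGroup E'] [NormedSpace ℝ E'] [TopologicalSpace H']
    {I' : ModelWithCorners ℝ E' H'} [TopologicalSpace M'] [ChartedSpace H' M']
    {f : M' → G} {h : M' → G ⧸ T} {x : M'}
    (hf : ContMDiffAt I' (𝓡 n) ∞ f x) (hh : ContMDiffAt I' (𝓡 m) ∞ h x) :
    ContMDiffAt I' (𝓡 m) ∞ (fun y => f y • h y) x := by
  obtain ⟨b, hb⟩ := QuotientGroup.mk_surjective (h x)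
  obtain ⟨σ, -, hσ, hσe⟩ := hπ.exists_section b
  rw [hb] at hσ hσe
  have h1 : ContMDiffAt I' (𝓡 m) ∞ (fun y => (QuotientGroup.mk (f y * σ (h y)) : G ⧸ T)) x :=
    hπ.contMDiff.contMDiffAt.comp x (hf.mul (hσ.comp x hh))
  refine h1.congr_of_eventuallyEq ?_
  filter_upwards [hh.continuousAt.eventually hσe] with y hy
  conv_lhs => rw [← hy]
  rfl

theorem contMDiff_const_smul_quotient
    (hπ : Manifold.IsSubmersion (𝓡 n) (𝓡 m) ∞ (QuotientGroup.mk : G → G ⧸ T)) (a : G) :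
    ContMDiff (𝓡 m) (𝓡 m) ∞ (fun q : G ⧸ T => a • q) := fun _ =>
  ContMDiffAt.smul_quotient hπ contMDiffAt_const contMDiffAt_id

variable (n m T) in
/-- The derivative of the projection `G → G ⧸ T` at the identity. -/
def projDeriv : GroupLieAlgebra (𝓡 n) G →L[ℝ] EuclideanSpace ℝ (Fin m) :=
  mfderiv (𝓡 n) (𝓡 m) (QuotientGroup.mk : G → G ⧸ T) 1

variable (m T) in
/-- The derivative of the translation by `a` at the base point. -/
def smulDeriv (a : G) : EuclideanSpace ℝ (Fin m) →L[ℝ] EuclideanSpace ℝ (Fin m) :=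
  mfderiv (𝓡 m) (𝓡 m) (fun q : G ⧸ T => a • q) ((1 : G) : G ⧸ T)

theorem hasMFDerivAt_proj
    (hπ : Manifold.IsSubmersion (𝓡 n) (𝓡 m) ∞ (QuotientGroup.mk : G → G ⧸ T)) :
    HasMFDerivAt (𝓡 n) (𝓡 m) (QuotientGroup.mk : G → G ⧸ T) 1 (projDeriv n m T) :=
  (hπ.contMDiff.mdifferentiableAt (by simp)).hasMFDerivAt

theorem hasMFDerivAt_smul
    (hπ : Manifold.IsSubmersion (𝓡 n) (𝓡 m) ∞ (QuotientGroup.mk : G → G ⧸ T)) (a : G) :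
    HasMFDerivAt (𝓡 m) (𝓡 m) (fun q : G ⧸ T => a • q) ((1 : G) : G ⧸ T) (smulDeriv m T a) :=
  ((contMDiff_const_smul_quotient hπ a).mdifferentiableAt (by simp)).hasMFDerivAt

/-- Differentiate π ∘ σ = id for a local section σ with σ(o) = 1. -/
theorem projDeriv_surjective
    (hπ : Manifold.IsSubmersion (𝓡 n) (𝓡 m) ∞ (QuotientGroup.mk : G → G ⧸ T)) :
    Function.Surjective (projDeriv n m T) := by
  obtain ⟨σ, h1, hσ, hσe⟩ := hπ.exists_section 1
  have h2 : HasMFDerivAt (𝓡 n) (𝓡 m) (QuotientGroup.mk : G → G ⧸ T) (σ ((1 : G) : G ⧸ T))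
      (projDeriv n m T) := by
    rw [h1]
    exact hasMFDerivAt_proj hπ
  let S : EuclideanSpace ℝ (Fin m) →L[ℝ] EuclideanSpace ℝ (Fin n) :=
    mfderiv (𝓡 m) (𝓡 n) σ ((1 : G) : G ⧸ T)
  have h3 : HasMFDerivAt (𝓡 m) (𝓡 n) σ ((1 : G) : G ⧸ T) S :=
    (hσ.mdifferentiableAt (by simp)).hasMFDerivAt
  have h4 := (h2.comp _ h3)
  have h5 : HasMFDerivAt (𝓡 m) (𝓡 m) ((QuotientGroup.mk : G → G ⧸ T) ∘ σ) ((1 : G) : G ⧸ T)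
      (ContinuousLinearMap.id ℝ (TangentSpace (𝓡 m) ((1 : G) : G ⧸ T))) :=
    (hasMFDerivAt_id _).congr_of_eventuallyEq hσe
  have h6 := hasMFDerivAt_unique h4 h5
  intro v
  exact ⟨S v, DFunLike.congr_fun h6 v⟩

/-- The isotropy representation of T is induced by `Ad`: differentiate (t x t⁻¹)T = t · xT. -/
theorem projDeriv_lieAd
    (hπ : Manifold.IsSubmersion (𝓡 n) (𝓡 m) ∞ (QuotientGroup.mk : G → G ⧸ T)) {t : G}
    (ht : t ∈ T) (X : GroupLieAlgebra (𝓡 n) G) :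
    projDeriv n m T (lieAd t X) = smulDeriv m T t (projDeriv n m T X) := by
  have h1 : HasMFDerivAt (𝓡 n) (𝓡 m) (QuotientGroup.mk : G → G ⧸ T) (t * 1 * t⁻¹)
      (projDeriv n m T) := by
    have e : t * 1 * t⁻¹ = 1 := by simp
    rw [e]
    exact hasMFDerivAt_proj hπ
  have h2 := h1.comp (1 : G) (hasMFDerivAt_conj (n := n) t)
  have h3 := (hasMFDerivAt_smul hπ t).comp (1 : G) (hasMFDerivAt_proj hπ)
  have e : (QuotientGroup.mk : G → G ⧸ T) ∘ (fun x : G => t * x * t⁻¹) =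
      (fun q : G ⧸ T => t • q) ∘ (QuotientGroup.mk : G → G ⧸ T) := by
    ext x
    simp only [Function.comp_apply, MulAction.Quotient.smul_mk, smul_eq_mul]
    rw [QuotientGroup.eq]
    simpa [mul_assoc] using ht
  rw [e] at h2
  exact DFunLike.congr_fun (hasMFDerivAt_unique h2 h3) X

section

variable [T2Space G]

/-- The velocity at time t is the translate by exp(tX) of the velocity at time 0. -/
theorem hasMFDerivAt_oneParam_smul
    (hπ : Manifold.IsSubmersion (𝓡 n) (𝓡 m) ∞ (QuotientGroup.mk : G → G ⧸ T))
    (X : GroupLieAlgebra (𝓡 n) G) (t : ℝ) :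
    HasMFDerivAt 𝓘(ℝ, ℝ) (𝓡 m) (fun s => oneParam X s • ((1 : G) : G ⧸ T)) t
      (ContinuousLinearMap.toSpanSingleton ℝ
        (smulDeriv m T (oneParam X t) (projDeriv n m T X))) := by
  have h2 : HasMFDerivAt 𝓘(ℝ, ℝ) 𝓘(ℝ, ℝ) (fun s : ℝ => s - t) t (ContinuousLinearMap.id ℝ ℝ) :=
    ((hasFDerivAt_id t).sub_const t).hasMFDerivAt
  have h3 : HasMFDerivAt 𝓘(ℝ, ℝ) (𝓡 n) (oneParam X) ((fun s : ℝ => s - t) t)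
      ((1 : ℝ →L[ℝ] ℝ).smulRight X) := by
    have e : (fun s : ℝ => s - t) t = 0 := sub_self t
    rw [e]; exact hasMFDerivAt_oneParam_zero X
  have h4 : HasMFDerivAt (𝓡 n) (𝓡 m) (QuotientGroup.mk : G → G ⧸ T)
      ((oneParam X ∘ fun s : ℝ => s - t) t) (projDeriv n m T) := by
    have e : (oneParam X ∘ fun s : ℝ => s - t) t = 1 := by simp [oneParam_zero]
    rw [e]
    exact hasMFDerivAt_proj hπ
  have h5 : HasMFDerivAt (𝓡 m) (𝓡 m) (fun q : G ⧸ T => oneParam X t • q)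
      (((QuotientGroup.mk : G → G ⧸ T) ∘ (oneParam X ∘ fun s : ℝ => s - t)) t)
      (smulDeriv m T (oneParam X t)) := by
    have e : (((QuotientGroup.mk : G → G ⧸ T) ∘ (oneParam X ∘ fun s : ℝ => s - t)) t) =
      ((1 : G) : G ⧸ T) := by simp [oneParam_zero]
    rw [e]
    exact hasMFDerivAt_smul hπ _
  have h6 := h5.comp t (h4.comp t (h3.comp (f := fun s : ℝ => s - t) t h2))
  have e : (fun q : G ⧸ T => oneParam X t • q) ∘
      ((QuotientGroup.mk : G → G ⧸ T) ∘ (oneParam X ∘ fun s : ℝ => s - t)) =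
      (fun s => oneParam X s • ((1 : G) : G ⧸ T)) := by
    ext s
    simp only [Function.comp_apply, MulAction.Quotient.smul_mk, smul_eq_mul, mul_one]
    rw [← oneParam_add, add_sub_cancel]
  rw [e] at h6
  refine h6.congr_mfderiv ?_
  refine ContinuousLinearMap.ext_ring ?_
  change smulDeriv m T (oneParam X t) (projDeriv n m T ((1 : ℝ) • X)) =
    (1 : ℝ) • smulDeriv m T (oneParam X t) (projDeriv n m T X)
  rw [one_smul, one_smul]

/-- If dπ(X) = 0, the orbit curve of o has zero velocity at every time, hence stays at o, which
means that exp(tX) stays in T. -/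
theorem forall_oneParam_mem_iff
    (hπ : Manifold.IsSubmersion (𝓡 n) (𝓡 m) ∞ (QuotientGroup.mk : G → G ⧸ T))
    (X : GroupLieAlgebra (𝓡 n) G) :
    (∀ t : ℝ, oneParam X t ∈ T) ↔ projDeriv n m T X = 0 := by
  have key (t : ℝ) : oneParam X t ∈ T ↔
      oneParam X t • ((1 : G) : G ⧸ T) = oneParam X 0 • ((1 : G) : G ⧸ T) := by
    rw [oneParam_zero, one_smul, MulAction.Quotient.smul_mk, eq_comm, QuotientGroup.eq]
    simp
  constructor
  · intro h
    have h1 := (hasMFDerivAt_proj hπ)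
    have h2 : HasMFDerivAt (𝓡 n) (𝓡 m) (QuotientGroup.mk : G → G ⧸ T) (oneParam X 0)
      (projDeriv n m T) := by
      rw [oneParam_zero]; exact h1
    have h3 := h2.comp 0 (hasMFDerivAt_oneParam_zero X)
    have e : (QuotientGroup.mk : G → G ⧸ T) ∘ oneParam X = fun _ => ((1 : G) : G ⧸ T) := by
      ext t
      simp only [Function.comp_apply]
      rw [eq_comm, QuotientGroup.eq]
      simpa using h t
    rw [e] at h3
    have h4 := hasMFDerivAt_unique h3 (hasMFDerivAt_const _ _)
    have h5 : projDeriv n m T ((1 : ℝ) • X) = 0 := DFunLike.congr_fun h4 (1 : ℝ)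
    rwa [one_smul] at h5
  · intro h t
    rw [key]
    refine eq_of_forall_hasMFDerivAt_zero (m := m)
      (c := fun s => oneParam X s • ((1 : G) : G ⧸ T)) (fun s => ?_) t 0
    have h1 := hasMFDerivAt_oneParam_smul hπ X s
    rw [h, map_zero] at h1
    refine h1.congr_mfderiv ?_
    exact ContinuousLinearMap.ext_ring (smul_zero (1 : ℝ))

/-- By `forall_oneParam_mem_iff` the set spanning the Lie algebra of T is already the kernel of dπ,
so taking its span adds nothing. -/
theorem mem_subgroupLieAlgebra_iff
    (hπ : Manifold.IsSubmersion (𝓡 n) (𝓡 m) ∞ (QuotientGroup.mk : G → G ⧸ T))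
    (X : GroupLieAlgebra (𝓡 n) G) :
    X ∈ subgroupLieAlgebra (n := n) T ↔ projDeriv n m T X = 0 := by
  have e : {X : GroupLieAlgebra (𝓡 n) G | ∀ t : ℝ, lieExp (n := n) (t • X) ∈ T} =
      LinearMap.ker (projDeriv n m T).toLinearMap := by
    ext Y
    simp only [lieExp_smul, mem_ofPred_eq, SetLike.mem_coe, LinearMap.mem_ker]
    exact forall_oneParam_mem_iff hπ Y
  rw [subgroupLieAlgebra, e, Submodule.span_eq]
  rfl

theorem mem_subgroupLieAlgebra_iff_oneParam
    (hπ : Manifold.IsSubmersion (𝓡 n) (𝓡 m) ∞ (QuotientGroup.mk : G → G ⧸ T))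
    (X : GroupLieAlgebra (𝓡 n) G) :
    X ∈ subgroupLieAlgebra (n := n) T ↔ ∀ t : ℝ, oneParam X t ∈ T := by
  rw [mem_subgroupLieAlgebra_iff hπ, forall_oneParam_mem_iff hπ]

end

end HomogeneousSpaces

/-! ### Tori: triviality of the adjoint action on 𝔱, and self-centralization. -/

section Tori

variable {n m : ℕ} {G : Type*} [TopologicalSpace G] [Group G]
  [ChartedSpace (EuclideanSpace ℝ (Fin n)) G] [LieGroup (𝓡 n) ∞ G] [T2Space G] {T : Subgroup G}
  [ChartedSpace (EuclideanSpace ℝ (Fin m)) (G ⧸ T)] [IsManifold (𝓡 m) ∞ (G ⧸ T)]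

theorem oneParam_injective : Function.Injective
    (oneParam : GroupLieAlgebra (𝓡 n) G → ℝ → G) := by
  intro X Y h
  have h1 := hasMFDerivAt_oneParam_zero X
  rw [h] at h1
  have h2 : (1 : ℝ) • X = (1 : ℝ) • Y :=
    DFunLike.congr_fun (hasMFDerivAt_unique h1 (hasMFDerivAt_oneParam_zero Y)) (1 : ℝ)
  rwa [one_smul, one_smul] at h2

/-- Conjugation by g takes exp(tX) to exp(t Ad(g)X), and the one-parameter subgroup determines its
generator. -/
theorem lieAd_eq_self_iff (g : G) (X : GroupLieAlgebra (𝓡 n) G) :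
    lieAd g X = X ↔ ∀ t, g * oneParam X t = oneParam X t * g := by
  constructor
  · intro h t
    have := conj_oneParam g X t
    rw [h] at this
    exact mul_inv_eq_iff_eq_mul.1 this
  · intro h
    refine oneParam_injective (funext fun t => ?_)
    rw [← conj_oneParam, h, mul_inv_cancel_right]

theorem hasDerivAt_lieAd_oneParam_zero (X Y : GroupLieAlgebra (𝓡 n) G) :
    HasDerivAt (F := EuclideanSpace ℝ (Fin n)) (fun s => lieAd (oneParam X s) Y)
      (⁅X, Y⁆ : GroupLieAlgebra (𝓡 n) G) 0 := by
  have h := hasDerivAt_lieAd_oneParam X Y 0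
  rw [oneParam_zero, lieAd_one] at h
  exact h

theorem lie_eq_zero_of_lieAd_eq_self {X Y : GroupLieAlgebra (𝓡 n) G}
    (h : ∀ t, lieAd (oneParam X t) Y = Y) : ⁅X, Y⁆ = 0 := by
  have h1 := hasDerivAt_lieAd_oneParam_zero X Y
  simp only [h] at h1
  have h2 : HasDerivAt (F := EuclideanSpace ℝ (Fin n)) (fun _ => Y) 0 (0 : ℝ) :=
    hasDerivAt_const (F := EuclideanSpace ℝ (Fin n)) _ _
  exact HasDerivAt.unique (F := EuclideanSpace ℝ (Fin n)) h1 h2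

/-- As g commutes with exp(sX), Ad(g) commutes with Ad(exp sX); differentiate at s = 0. -/
theorem lie_lieAd_of_commute {g : G} {X : GroupLieAlgebra (𝓡 n) G}
    (h : lieAd g X = X) (Y : GroupLieAlgebra (𝓡 n) G) : ⁅X, lieAd g Y⁆ = lieAd g ⁅X, Y⁆ := by
  have h1 := hasDerivAt_lieAd_oneParam_zero X (lieAd g Y)
  let A : EuclideanSpace ℝ (Fin n) →L[ℝ] EuclideanSpace ℝ (Fin n) := lieAd (n := n) g
  have h2 := A.hasFDerivAt.comp_hasDerivAt (0 : ℝ) (hasDerivAt_lieAd_oneParam_zero X Y)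
  refine h1.unique (h2.congr_of_eventuallyEq (Eventually.of_forall fun s => ?_))
  have h3 := (lieAd_eq_self_iff g X).1 h s
  change lieAd (oneParam X s) (lieAd g Y) = lieAd g (lieAd (oneParam X s) Y)
  rw [← lieAd_mul_apply, ← lieAd_mul_apply, h3]

theorem lieAd_eq_self_of_mem
    (hπ : Manifold.IsSubmersion (𝓡 n) (𝓡 m) ∞ (QuotientGroup.mk : G → G ⧸ T))
    (hT : ∀ a ∈ T, ∀ b ∈ T, a * b = b * a) {t : G} (ht : t ∈ T) {H : GroupLieAlgebra (𝓡 n) G}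
    (hH : H ∈ subgroupLieAlgebra (n := n) T) : lieAd t H = H :=
  (lieAd_eq_self_iff t H).2 fun s =>
    hT _ ht _ ((mem_subgroupLieAlgebra_iff_oneParam hπ H).1 hH s)

theorem lie_eq_zero_of_mem_subgroupLieAlgebra
    (hπ : Manifold.IsSubmersion (𝓡 n) (𝓡 m) ∞ (QuotientGroup.mk : G → G ⧸ T))
    (hT : ∀ a ∈ T, ∀ b ∈ T, a * b = b * a) {H H' : GroupLieAlgebra (𝓡 n) G}
    (hH : H ∈ subgroupLieAlgebra (n := n) T) (hH' : H' ∈ subgroupLieAlgebra (n := n) T) :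
    ⁅H, H'⁆ = 0 :=
  lie_eq_zero_of_lieAd_eq_self fun s =>
    lieAd_eq_self_of_mem hπ hT ((mem_subgroupLieAlgebra_iff_oneParam hπ H).1 hH s) hH'

/-- The adjoint orbit of a vector centralizing the Lie algebra of `T` is stationary along curves
in `T`. -/
theorem hasDerivAt_lieAd_of_mem
    (hπ : Manifold.IsSubmersion (𝓡 n) (𝓡 m) ∞ (QuotientGroup.mk : G → G ⧸ T))
    {Z : GroupLieAlgebra (𝓡 n) G} (hZ : ∀ H ∈ subgroupLieAlgebra (n := n) T, ⁅H, Z⁆ = 0)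
    {c : ℝ → G} {s : ℝ} (hc : MDifferentiableAt 𝓘(ℝ, ℝ) (𝓡 n) c s) (hcT : ∀ᶠ u in 𝓝 s, c u ∈ T) :
    HasDerivAt (F := EuclideanSpace ℝ (Fin n)) (fun u => lieAd (c u) Z) 0 s := by
  have hl : HasMFDerivAt (𝓡 n) (𝓡 n) (fun x : G => (c s)⁻¹ * x) (c s) _ :=
    ((contMDiff_mul_left_infty (n := n) (c s)⁻¹).mdifferentiableAt (by simp)).hasMFDerivAt
  have h1 := hl.comp s hc.hasMFDerivAt
  set f' : ℝ →L[ℝ] EuclideanSpace ℝ (Fin n) :=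
    (mfderiv (𝓡 n) (𝓡 n) (fun x : G => (c s)⁻¹ * x) (c s)).comp
      (mfderiv 𝓘(ℝ, ℝ) (𝓡 n) c s) with hf'
  have h1' : HasMFDerivAt 𝓘(ℝ, ℝ) (𝓡 n) (fun u => (c s)⁻¹ * c u) s f' := h1
  have h2 := hasDerivAt_lieAd_of_eq_one (c := fun u => (c s)⁻¹ * c u) (inv_mul_cancel (c s)) h1' Z
  -- The left logarithmic derivative of c at s is tangent to T, since c(s)⁻¹c(u) stays in T near u =
  -- s.
  have h3 : projDeriv n m T (f' 1) = 0 := by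
    have h4 : HasMFDerivAt (𝓡 n) (𝓡 m) (QuotientGroup.mk : G → G ⧸ T)
        ((fun u => (c s)⁻¹ * c u) s) (projDeriv n m T) := by
      have e : (fun u => (c s)⁻¹ * c u) s = 1 := inv_mul_cancel (c s)
      rw [e]
      exact hasMFDerivAt_proj hπ
    have h5 := h4.comp s h1'
    have h6 : HasMFDerivAt 𝓘(ℝ, ℝ) (𝓡 m)
        ((QuotientGroup.mk : G → G ⧸ T) ∘ fun u => (c s)⁻¹ * c u) s
        (0 : ℝ →L[ℝ] EuclideanSpace ℝ (Fin m)) := by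
      refine (hasMFDerivAt_const ((1 : G) : G ⧸ T) s).congr_of_eventuallyEq ?_
      filter_upwards [hcT] with u hu
      simp only [Function.comp_apply]
      rw [eq_comm, QuotientGroup.eq]
      simpa using T.mul_mem (T.inv_mem hcT.self_of_nhds) hu
    exact DFunLike.congr_fun (hasMFDerivAt_unique h5 h6) (1 : ℝ)
  have h7 : (@Bracket.bracket (GroupLieAlgebra (𝓡 n) G) (GroupLieAlgebra (𝓡 n) G) _ (f' 1) Z) = 0 :=
    hZ _ ((mem_subgroupLieAlgebra_iff hπ _).2 h3)
  rw [h7] at h2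
  let A : EuclideanSpace ℝ (Fin n) →L[ℝ] EuclideanSpace ℝ (Fin n) := lieAd (n := n) (c s)
  have h8 := A.hasFDerivAt.comp_hasDerivAt s h2
  have h9 := h8.congr_deriv (map_zero A)
  refine h9.congr_of_eventuallyEq (Eventually.of_forall fun u => ?_)
  change lieAd (c u) Z = lieAd (c s) (lieAd ((c s)⁻¹ * c u) Z)
  rw [← lieAd_mul_apply, mul_inv_cancel_left]

/-- T is the fibre of the projection over o. An element of T close to 1 is therefore joined to 1 by
a curve inside T, along which Ad(·)Z has zero derivative. -/
theorem eventually_lieAd_eq_self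
    (hπ : Manifold.IsSubmersion (𝓡 n) (𝓡 m) ∞ (QuotientGroup.mk : G → G ⧸ T))
    {Z : GroupLieAlgebra (𝓡 n) G} (hZ : ∀ H ∈ subgroupLieAlgebra (n := n) T, ⁅H, Z⁆ = 0) :
    ∀ᶠ g in 𝓝 (1 : G), g ∈ T → lieAd g Z = Z := by
  filter_upwards [hπ.exists_curve_in_fibre 1] with g hg hgT
  obtain ⟨c, I, hI, hsub, h0, h1, hc⟩ := hg (by rw [eq_comm, QuotientGroup.eq]; simpa using hgT)
  have hcT : ∀ s ∈ I, c s ∈ T := by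
    intro s hs
    have := (hc s hs).2
    rw [eq_comm, QuotientGroup.eq] at this
    simpa using this
  have hd : ∀ s ∈ I, HasDerivAt (F := EuclideanSpace ℝ (Fin n)) (fun u => lieAd (c u) Z) 0 s :=
    fun s hs => hasDerivAt_lieAd_of_mem hπ hZ (hc s hs).1
      (by filter_upwards [hI.mem_nhds hs] with u hu using hcT u hu)
  have h3 := constant_of_has_deriv_right_zero (E := EuclideanSpace ℝ (Fin n))
    (f := fun u => lieAd (c u) Z) (a := 0) (b := 1)
    (fun s hs => (hd s (hsub hs)).continuousAt.continuousWithinAt)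
    (fun s hs => (hd s (hsub (Ico_subset_Icc_self hs))).hasDerivWithinAt) 1 (by simp)
  simp only [h0, h1, lieAd_one] at h3
  exact h3

/-- The stabilizer of Z in T contains a neighbourhood of 1. It is an open, hence closed, subgroup of
the connected group T. -/
theorem lieAd_eq_self_of_forall_lie_eq_zero
    (hπ : Manifold.IsSubmersion (𝓡 n) (𝓡 m) ∞ (QuotientGroup.mk : G → G ⧸ T))
    (hT : IsConnected (T : Set G))
    {Z : GroupLieAlgebra (𝓡 n) G} (hZ : ∀ H ∈ subgroupLieAlgebra (n := n) T, ⁅H, Z⁆ = 0)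
    {t : G} (ht : t ∈ T) : lieAd t Z = Z := by
  have : IsTopologicalGroup G := topologicalGroup_of_lieGroup (𝓡 n) ∞
  have : ConnectedSpace T := isConnected_iff_connectedSpace.1 hT
  let S : Subgroup T :=
    { carrier := {g | lieAd (g : G) Z = Z}
      mul_mem' := fun {a b} ha hb => by
        simp only [mem_ofPred_eq] at ha hb ⊢
        rw [Subgroup.coe_mul, lieAd_mul_apply, hb, ha]
      one_mem' := by
        simp only [mem_ofPred_eq, Subgroup.coe_one, lieAd_one]
        rfl
      inv_mem' := fun {a} ha => by
        simp only [mem_ofPred_eq, Subgroup.coe_inv] at ha ⊢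
        have := lieAd_inv_apply (a : G) Z
        rwa [ha] at this }
  have hS : (S : Set T) ∈ 𝓝 (1 : T) := by
    have h1 := (continuous_subtype_val.tendsto (1 : T)).eventually (eventually_lieAd_eq_self hπ hZ)
    filter_upwards [h1] with g hg using hg g.2
  have hopen : IsOpen (S : Set T) := S.isOpen_of_mem_nhds hS
  have hcl : IsClopen (S : Set T) := ⟨S.isClosed_of_isOpen hopen, hopen⟩
  have := hcl.eq_univ ⟨1, S.one_mem⟩
  have h2 : (⟨t, ht⟩ : T) ∈ (S : Set T) := by rw [this]; trivial
  exact h2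

/-- A maximal torus has a self-centralizing Lie algebra. -/
theorem IsMaximalTorus.mem_subgroupLieAlgebra_of_forall_lie_eq_zero [CompactSpace G]
    (hπ : Manifold.IsSubmersion (𝓡 n) (𝓡 m) ∞ (QuotientGroup.mk : G → G ⧸ T))
    (hT : IsMaximalTorus T)
    {Z : GroupLieAlgebra (𝓡 n) G} (hZ : ∀ H ∈ subgroupLieAlgebra (n := n) T, ⁅H, Z⁆ = 0) :
    Z ∈ subgroupLieAlgebra (n := n) T := by
  have : IsTopologicalGroup G := topologicalGroup_of_lieGroup (𝓡 n) ∞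
  have hcomm (t : G) (ht : t ∈ T) (s : ℝ) : t * oneParam Z s = oneParam Z s * t :=
    (lieAd_eq_self_iff t Z).1 (lieAd_eq_self_of_forall_lie_eq_zero hπ hT.1.2.1 hZ ht) s
  have hexp (s t : ℝ) : oneParam Z s * oneParam Z t = oneParam Z t * oneParam Z s := by
    rw [← oneParam_add, ← oneParam_add, add_comm]
  -- K = T · exp(ℝZ) is a connected abelian subgroup, since T fixes Z under `Ad` and so commutes
  -- with exp(ℝZ).
  let K : Subgroup G :=
    { carrier := (fun p : G × ℝ => p.1 * oneParam Z p.2) '' ((T : Set G) ×ˢ univ)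
      mul_mem' := by
        rintro _ _ ⟨⟨a, s⟩, ha, rfl⟩ ⟨⟨b, t⟩, hb, rfl⟩
        refine ⟨(a * b, s + t), ⟨T.mul_mem ha.1 hb.1, trivial⟩, ?_⟩
        simp only [oneParam_add]
        rw [mul_assoc, mul_assoc, ← mul_assoc b, hcomm b hb.1, mul_assoc]
      one_mem' := ⟨(1, 0), ⟨T.one_mem, trivial⟩, by simp [oneParam_zero]⟩
      inv_mem' := by
        rintro _ ⟨⟨a, s⟩, ha, rfl⟩
        refine ⟨(a⁻¹, -s), ⟨T.inv_mem ha.1, trivial⟩, ?_⟩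
        simp only [oneParam_neg, mul_inv_rev]
        rw [← oneParam_neg, hcomm _ (T.inv_mem ha.1)] }
  have hKcomm (x y : K) : x * y = y * x := by
    obtain ⟨_, ⟨⟨a, s⟩, ha, rfl⟩⟩ := x
    obtain ⟨_, ⟨⟨b, t⟩, hb, rfl⟩⟩ := y
    refine Subtype.ext ?_
    change a * oneParam Z s * (b * oneParam Z t) = b * oneParam Z t * (a * oneParam Z s)
    rw [mul_assoc, ← mul_assoc _ b, ← hcomm b hb.1, mul_assoc b, ← mul_assoc a, hexp,
      hT.1.2.2 a ha.1 b hb.1, mul_assoc b (oneParam Z t), ← mul_assoc _ a, ← hcomm a ha.1]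
    simp only [mul_assoc]
  have hKconn : IsConnected (K : Set G) := by
    refine (hT.1.2.1.prod isConnected_univ).image _ ?_
    have := continuous_oneParam Z
    fun_prop
  have hle : T ≤ K.topologicalClosure := fun t ht =>
    K.le_topologicalClosure ⟨(t, 0), ⟨ht, trivial⟩, by simp [oneParam_zero]⟩
  -- Being a one-parameter extension of T, K need not be closed; its closure is compact and still
  -- connected and abelian, so maximality of T applies to the closure.
  have hKT : IsTorusSubgroup K.topologicalClosure := by
    refine ⟨K.isClosed_topologicalClosure.isCompact, hKconn.closure, fun a ha b hb => ?_⟩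
    exact congrArg Subtype.val ((K.commGroupTopologicalClosure hKcomm).mul_comm ⟨a, ha⟩ ⟨b, hb⟩)
  rw [mem_subgroupLieAlgebra_iff_oneParam hπ]
  intro s
  exact hT.2 hKT hle (K.le_topologicalClosure ⟨(1, s), ⟨T.one_mem, trivial⟩, by simp⟩)

end Tori

/-! ### The components of a Riemannian metric in a chart. -/

section MetricInChart

variable {m : ℕ} {M : Type*} [TopologicalSpace M]
  [ChartedSpace (EuclideanSpace ℝ (Fin m)) M] [IsManifold (𝓡 m) ∞ M]

theorem contMDiffOn_mfderiv_extChartAt_symm (p : M) (v : EuclideanSpace ℝ (Fin m)) :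
    ContMDiffOn 𝓘(ℝ, EuclideanSpace ℝ (Fin m)) (𝓡 m).tangent ∞
      (fun y => (⟨(extChartAt (𝓡 m) p).symm y,
        mfderiv 𝓘(ℝ, EuclideanSpace ℝ (Fin m)) (𝓡 m) (extChartAt (𝓡 m) p).symm y v⟩ :
          TangentBundle (𝓡 m) M)) (extChartAt (𝓡 m) p).target := by
  have h1 := (contMDiffOn_extChartAt_symm (I := 𝓡 m) (n := ∞) p).contMDiffOn_tangentMapWithin
    (m := ∞) (by simp) (isOpen_extChartAt_target p).uniqueMDiffOn
  have h2 : ContMDiff 𝓘(ℝ, EuclideanSpace ℝ (Fin m)) 𝓘(ℝ, EuclideanSpace ℝ (Fin m)).tangent ∞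
      (fun y => (⟨y, v⟩ : TangentBundle 𝓘(ℝ, EuclideanSpace ℝ (Fin m))
        (EuclideanSpace ℝ (Fin m)))) := contMDiff_vectorSpace_iff_contDiff.2 contDiff_const
  refine (h1.comp h2.contMDiffOn (fun y hy => hy)).congr fun y hy => ?_
  simp only [Function.comp_apply, tangentMapWithin]
  rw [mfderivWithin_of_isOpen (isOpen_extChartAt_target p) hy]

theorem contDiffOn_metricInChart (g : SmoothRiemannianMetric m M) (p : M)
    (v w : EuclideanSpace ℝ (Fin m)) :
    ContDiffOn ℝ ∞ (fun y => metricInChart g p y v w) (extChartAt (𝓡 m) p).target := by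
  intro y hy
  refine ContMDiffWithinAt.contDiffWithinAt ?_
  have h2 : ContMDiffWithinAt 𝓘(ℝ, EuclideanSpace ℝ (Fin m)) ((𝓡 m).prod 𝓘(ℝ, ℝ)) ∞
      (fun y => TotalSpace.mk' ℝ (E := Bundle.Trivial M ℝ) ((extChartAt (𝓡 m) p).symm y)
        (metricInChart g p y v w)) (extChartAt (𝓡 m) p).target y := by
    apply ContMDiffWithinAt.clm_bundle_apply₂ (F₁ := EuclideanSpace ℝ (Fin m))
      (F₂ := EuclideanSpace ℝ (Fin m))
    · exact ContMDiffAt.comp_contMDiffWithinAt y g.contMDiff.contMDiffAt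
        (contMDiffOn_extChartAt_symm p y hy)
    · exact contMDiffOn_mfderiv_extChartAt_symm p v y hy
    · exact contMDiffOn_mfderiv_extChartAt_symm p w y hy
  rw [contMDiffWithinAt_totalSpace] at h2
  exact h2.2

/-- The derivative of the inverse of the chart at `p`. -/
def chartSymmDeriv (p : M) (y : EuclideanSpace ℝ (Fin m)) :
    EuclideanSpace ℝ (Fin m) →L[ℝ] EuclideanSpace ℝ (Fin m) :=
  mfderiv 𝓘(ℝ, EuclideanSpace ℝ (Fin m)) (𝓡 m) (extChartAt (𝓡 m) p).symm y

theorem chartSymmDeriv_self (p : M) :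
    chartSymmDeriv p (extChartAt (𝓡 m) p p) = ContinuousLinearMap.id ℝ _ :=
  (hasMFDerivAt_extChartAt_symm_self p).mfderiv

/-- The inner product of a Riemannian metric on a tangent space, identified with its model. -/
def metricAt (g : SmoothRiemannianMetric m M) (q : M) :
    EuclideanSpace ℝ (Fin m) →L[ℝ] EuclideanSpace ℝ (Fin m) →L[ℝ] ℝ :=
  g.inner q

theorem metricAt_symm (g : SmoothRiemannianMetric m M) (q : M) (v w : EuclideanSpace ℝ (Fin m)) :
    metricAt g q v w = metricAt g q w v :=
  g.symm q v w

/-- The components of a Riemannian metric in a chart, as a function to bilinear forms. -/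
def metricCLM (g : SmoothRiemannianMetric m M) (p : M) (y : EuclideanSpace ℝ (Fin m)) :
    EuclideanSpace ℝ (Fin m) →L[ℝ] EuclideanSpace ℝ (Fin m) →L[ℝ] ℝ :=
  (metricAt g ((extChartAt (𝓡 m) p).symm y)).bilinearComp
    (chartSymmDeriv p y) (chartSymmDeriv p y)

theorem metricCLM_apply (g : SmoothRiemannianMetric m M) (p : M)
    (y v w : EuclideanSpace ℝ (Fin m)) : metricCLM g p y v w = metricInChart g p y v w :=
  rfl

theorem metricCLM_symm (g : SmoothRiemannianMetric m M) (p : M)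
    (y v w : EuclideanSpace ℝ (Fin m)) : metricCLM g p y v w = metricCLM g p y w v :=
  metricAt_symm g _ _ _

theorem metricCLM_extChartAt (g : SmoothRiemannianMetric m M) {p q : M}
    (hq : q ∈ (extChartAt (𝓡 m) p).source) (v w : EuclideanSpace ℝ (Fin m)) :
    metricCLM g p (extChartAt (𝓡 m) p q) v w =
      metricAt g q (chartSymmDeriv p (extChartAt (𝓡 m) p q) v)
        (chartSymmDeriv p (extChartAt (𝓡 m) p q) w) := by
  conv_rhs => rw [← (extChartAt (𝓡 m) p).left_inv hq]
  rw [(extChartAt (𝓡 m) p).left_inv hq]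
  conv_lhs => rw [metricCLM, (extChartAt (𝓡 m) p).left_inv hq]
  rfl

theorem contDiffOn_metricCLM (g : SmoothRiemannianMetric m M) (p : M) :
    ContDiffOn ℝ ∞ (metricCLM g p) (extChartAt (𝓡 m) p).target :=
  contDiffOn_clm_apply.2 fun v => contDiffOn_clm_apply.2 fun w => contDiffOn_metricInChart g p v w

/-- The derivative of a map read in a chart on the target. -/
theorem HasMFDerivAt.exists_hasFDerivAt_extChartAt {E : Type*} [NormedAddCommGroup E]
    [NormedSpace ℝ E] {f : E → M} {x : E} {f' : E →L[ℝ] EuclideanSpace ℝ (Fin m)}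
    (hf : HasMFDerivAt 𝓘(ℝ, E) (𝓡 m) f x f') {p : M} (hp : f x ∈ (extChartAt (𝓡 m) p).source) :
    ∃ L : E →L[ℝ] EuclideanSpace ℝ (Fin m), HasFDerivAt (fun z => extChartAt (𝓡 m) p (f z)) L x ∧
      ∀ v, chartSymmDeriv p (extChartAt (𝓡 m) p (f x)) (L v) = f' v := by
  have h1 : HasMFDerivAt (𝓡 m) 𝓘(ℝ, EuclideanSpace ℝ (Fin m)) (extChartAt (𝓡 m) p) (f x) _ :=
    (mdifferentiableAt_extChartAt (by simpa using hp)).hasMFDerivAt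
  let D : EuclideanSpace ℝ (Fin m) →L[ℝ] EuclideanSpace ℝ (Fin m) :=
    mfderiv (𝓡 m) 𝓘(ℝ, EuclideanSpace ℝ (Fin m)) (extChartAt (𝓡 m) p) (f x)
  have h2 : HasMFDerivAt 𝓘(ℝ, E) 𝓘(ℝ, EuclideanSpace ℝ (Fin m))
      (fun z => extChartAt (𝓡 m) p (f z)) x (D.comp f') := h1.comp x hf
  refine ⟨D.comp f', h2.hasFDerivAt, fun v => ?_⟩
  have h3 : HasMFDerivAt 𝓘(ℝ, EuclideanSpace ℝ (Fin m)) (𝓡 m) (extChartAt (𝓡 m) p).symm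
      (extChartAt (𝓡 m) p (f x)) (chartSymmDeriv p (extChartAt (𝓡 m) p (f x))) :=
    ((contMDiffAt_extChartAt_symm_of_mem ((extChartAt (𝓡 m) p).map_source hp)).mdifferentiableAt
      (by simp)).hasMFDerivAt
  have h4 := h3.comp x h2
  have h5 := hf.congr_of_eventuallyEq (f₁ := (extChartAt (𝓡 m) p).symm ∘
    fun z => extChartAt (𝓡 m) p (f z)) (by
      filter_upwards [hf.continuousAt.preimage_mem_nhds
        ((isOpen_extChartAt_source p).mem_nhds hp)] with z hz
      exact (extChartAt (𝓡 m) p).left_inv hz)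
  exact DFunLike.congr_fun (hasMFDerivAt_unique h4 h5) v

end MetricInChart

/-! ### Killing's equation and the momentum identity in coordinates. -/

section Noether

variable {E E' : Type*} [NormedAddCommGroup E] [NormedSpace ℝ E]
  [NormedAddCommGroup E'] [NormedSpace ℝ E']

set_option synthInstance.maxHeartbeats 400000 in
set_option maxHeartbeats 1000000 in
/-- The Killing equation for the velocity field of a family of isometries. -/
theorem killing_equation {Gm : E → E →L[ℝ] E →L[ℝ] ℝ} {Gm' : E →L[ℝ] E →L[ℝ] E →L[ℝ] ℝ} {y₀ : E}
    (hG : HasFDerivAt Gm Gm' y₀) (hsymm : ∀ v w, Gm y₀ v w = Gm y₀ w v) {F : E' × E → E} {e : E'}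
    (hF : ContDiffAt ℝ 2 F (e, y₀)) (hFe : ∀ᶠ y in 𝓝 y₀, F (e, y) = y) {v : E}
    (hinv : ∀ᶠ z in 𝓝 e, Gm (F (z, y₀)) (fderiv ℝ (fun y => F (z, y)) y₀ v)
      (fderiv ℝ (fun y => F (z, y)) y₀ v) = Gm y₀ v v) (Y : E') :
    Gm' (fderiv ℝ (fun z => F (z, y₀)) e Y) v v
      + 2 * Gm y₀ v (fderiv ℝ (fun y => fderiv ℝ (fun z => F (z, y)) e Y) y₀ v) = 0 := by
  have hD := hF.hasFDerivAt_fderiv_snd v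
  have hK := (hF.hasFDerivAt_fderiv_fst Y).fderiv
  have hy : F (e, y₀) = y₀ := hFe.self_of_nhds
  have hDe : fderiv ℝ (fun y => F (e, y)) y₀ v = v := by
    have h1 : HasFDerivAt (fun y => F (e, y)) (ContinuousLinearMap.id ℝ E) y₀ :=
      (hasFDerivAt_id y₀).congr_of_eventuallyEq hFe
    rw [h1.fderiv]
    rfl
  have hF1 : HasFDerivAt (fun z => F (z, y₀)) (fderiv ℝ (fun z => F (z, y₀)) e) e := by
    have h1 : DifferentiableAt ℝ F (e, y₀) := hF.differentiableAt (by simp)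
    exact (h1.comp e (hasFDerivAt_prodMk_left e y₀).differentiableAt).hasFDerivAt
  have hG1 : HasFDerivAt (fun z => Gm (F (z, y₀)))
      (Gm'.comp (fderiv ℝ (fun z => F (z, y₀)) e)) e := by
    have h1 : HasFDerivAt Gm Gm' (F (e, y₀)) := by rw [hy]; exact hG
    exact HasFDerivAt.comp (g := Gm) (f := fun z => F (z, y₀)) e h1 hF1
  have h2 := (hG1.clm_apply hD).clm_apply hD
  have h3 : HasFDerivAt (fun z => Gm (F (z, y₀)) (fderiv ℝ (fun y => F (z, y)) y₀ v)
      (fderiv ℝ (fun y => F (z, y)) y₀ v)) (0 : E' →L[ℝ] ℝ) e :=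
    (hasFDerivAt_const (Gm y₀ v v) e).congr_of_eventuallyEq hinv
  have h4 := DFunLike.congr_fun (h2.unique h3) Y
  simp only [hy, hDe, add_apply, ContinuousLinearMap.comp_apply,
    ContinuousLinearMap.flip_apply, zero_apply,
    ContinuousLinearMap.apply_apply, ContinuousLinearMap.inl_apply] at h4
  simp only [hK, ContinuousLinearMap.comp_apply, ContinuousLinearMap.apply_apply,
    ContinuousLinearMap.inr_apply]
  -- Interchanging the mixed derivatives of F identifies the parameter derivative of the
  -- differential of the isometries with the differential of their velocity field.
  rw [hF.fderiv_fderiv_symm] at h4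
  rw [hsymm _ v] at h4
  linarith

set_option synthInstance.maxHeartbeats 400000 in
set_option maxHeartbeats 1000000 in
/-- The derivative of the momentum of a curve along a Killing field. -/
theorem hasDerivAt_momentum {Gm : E → E →L[ℝ] E →L[ℝ] ℝ} {Gm' : E →L[ℝ] E →L[ℝ] E →L[ℝ] ℝ}
    {c c₁ : ℝ → E} {t : ℝ} (hG : HasFDerivAt Gm Gm' (c t)) (hc : HasDerivAt c (c₁ t) t)
    {a : E} (hc₁ : HasDerivAt c₁ a t)
    {K : E → E} {K' : E →L[ℝ] E} (hK : HasFDerivAt K K' (c t))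
    (hkill : Gm' (K (c t)) (c₁ t) (c₁ t) + 2 * Gm (c t) (c₁ t) (K' (c₁ t)) = 0) :
    HasDerivAt (fun s => Gm (c s) (c₁ s) (K (c s)))
      (Gm (c t) a (K (c t)) + (Gm' (c₁ t) (c₁ t) (K (c t))
        + Gm' (c₁ t) (c₁ t) (K (c t)) - Gm' (K (c t)) (c₁ t) (c₁ t)) / 2) t := by
  have h1 : HasFDerivAt (fun s => Gm (c s))
      (Gm'.comp (ContinuousLinearMap.toSpanSingleton ℝ (c₁ t))) t :=
    HasFDerivAt.comp (g := Gm) (f := c) t hG hc.hasFDerivAt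
  have h2 : HasFDerivAt (fun s => K (c s))
      (K'.comp (ContinuousLinearMap.toSpanSingleton ℝ (c₁ t))) t :=
    HasFDerivAt.comp (g := K) (f := c) t hK hc.hasFDerivAt
  have h3 := ((h1.clm_apply hc₁.hasFDerivAt).clm_apply h2).hasDerivAt
  refine h3.congr_deriv ?_
  simp only [add_apply, ContinuousLinearMap.comp_apply, ContinuousLinearMap.flip_apply,
    ContinuousLinearMap.toSpanSingleton_apply, one_smul]
  -- Killing's equation replaces Gm(c', K'c') by -½ Gm'(K)(c', c'), which is the last term of the
  -- Christoffel symbol of the first kind.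
  linarith

end Noether

/-! ### The criterion for orbits of one-parameter subgroups to be geodesics. -/

section GeodesicCriterion

variable {n m : ℕ} {G : Type*} [TopologicalSpace G] [Group G]
  [ChartedSpace (EuclideanSpace ℝ (Fin n)) G] [LieGroup (𝓡 n) ∞ G] {T : Subgroup G}
  [ChartedSpace (EuclideanSpace ℝ (Fin m)) (G ⧸ T)] [IsManifold (𝓡 m) ∞ (G ⧸ T)]

variable (n m T) in
/-- The action of `G` on `G ⧸ T` read in the charts at `1` and `p`. -/
def actionChart (p : G ⧸ T) (q : EuclideanSpace ℝ (Fin n) × EuclideanSpace ℝ (Fin m)) :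
    EuclideanSpace ℝ (Fin m) :=
  extChartAt (𝓡 m) p ((extChartAt (𝓡 n) (1 : G)).symm q.1 • (extChartAt (𝓡 m) p).symm q.2)

theorem contDiffAt_actionChart
    (hπ : Manifold.IsSubmersion (𝓡 n) (𝓡 m) ∞ (QuotientGroup.mk : G → G ⧸ T)) (p : G ⧸ T) :
    ContDiffAt ℝ ∞ (actionChart n m T p) (chartOne n G, extChartAt (𝓡 m) p p) := by
  refine ContMDiffAt.contDiffAt ?_
  refine ContMDiffAt.comp_of_eq (y := p) (contMDiffAt_extChartAt (I := 𝓡 m))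
    (ContMDiffAt.smul_quotient hπ
      ((contMDiffAt_extChartAt_symm_self (1 : G)).comp (chartOne n G, extChartAt (𝓡 m) p p)
        contDiffAt_fst.contMDiffAt)
      ((contMDiffAt_extChartAt_symm_self p).comp (chartOne n G, extChartAt (𝓡 m) p p)
        contDiffAt_snd.contMDiffAt)) ?_
  simp only
  rw [extChartAt_symm_chartOne, one_smul, extChartAt_to_inv]

theorem actionChart_chartOne {p : G ⧸ T} {y : EuclideanSpace ℝ (Fin m)}
    (hy : y ∈ (extChartAt (𝓡 m) p).target) : actionChart n m T p (chartOne n G, y) = y := by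
  rw [actionChart, extChartAt_symm_chartOne, one_smul, (extChartAt (𝓡 m) p).right_inv hy]

theorem actionChart_extChartAt {p q : G ⧸ T} (hq : q ∈ (extChartAt (𝓡 m) p).source)
    (z : EuclideanSpace ℝ (Fin n)) :
    actionChart n m T p (z, extChartAt (𝓡 m) p q) =
      extChartAt (𝓡 m) p ((extChartAt (𝓡 n) (1 : G)).symm z • q) := by
  rw [actionChart, (extChartAt (𝓡 m) p).left_inv hq]

/-- The derivative of the orbit map of the point `a T`. -/
theorem hasMFDerivAt_orbit
    (hπ : Manifold.IsSubmersion (𝓡 n) (𝓡 m) ∞ (QuotientGroup.mk : G → G ⧸ T)) (a : G) :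
    HasMFDerivAt 𝓘(ℝ, EuclideanSpace ℝ (Fin n)) (𝓡 m)
      (fun z => (extChartAt (𝓡 n) (1 : G)).symm z • a • ((1 : G) : G ⧸ T)) (chartOne n G)
      ((smulDeriv m T a).comp ((projDeriv n m T).comp (lieAd (n := n) a⁻¹))) := by
  have h1 : HasMFDerivAt (𝓡 n) (𝓡 n) (fun x : G => a⁻¹ * x * a⁻¹⁻¹)
      ((extChartAt (𝓡 n) (1 : G)).symm (chartOne n G)) (lieAd (n := n) a⁻¹) := by
    rw [extChartAt_symm_chartOne]; exact hasMFDerivAt_conj a⁻¹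
  have h2 := h1.comp (chartOne n G) (hasMFDerivAt_extChartAt_symm_self (1 : G))
  have h3 : HasMFDerivAt (𝓡 n) (𝓡 m) (QuotientGroup.mk : G → G ⧸ T)
      (((fun x : G => a⁻¹ * x * a⁻¹⁻¹) ∘ (extChartAt (𝓡 n) (1 : G)).symm) (chartOne n G))
      (projDeriv n m T) := by
    have e : (((fun x : G => a⁻¹ * x * a⁻¹⁻¹) ∘ (extChartAt (𝓡 n) (1 : G)).symm)
      (chartOne n G)) = 1 := by
      simp only [Function.comp_apply, extChartAt_symm_chartOne]
      simp
    rw [e]; exact hasMFDerivAt_proj hπ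
  have h4 := h3.comp (chartOne n G) h2
  have h5 : HasMFDerivAt (𝓡 m) (𝓡 m) (fun q : G ⧸ T => a • q)
      (((QuotientGroup.mk : G → G ⧸ T) ∘ ((fun x : G => a⁻¹ * x * a⁻¹⁻¹) ∘
        (extChartAt (𝓡 n) (1 : G)).symm)) (chartOne n G)) (smulDeriv m T a) := by
    have e : (((QuotientGroup.mk : G → G ⧸ T) ∘ ((fun x : G => a⁻¹ * x * a⁻¹⁻¹) ∘
        (extChartAt (𝓡 n) (1 : G)).symm)) (chartOne n G)) = ((1 : G) : G ⧸ T) := by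
      simp only [Function.comp_apply, extChartAt_symm_chartOne]
      simp
    rw [e]; exact hasMFDerivAt_smul hπ a
  have h6 := h5.comp (chartOne n G) h4
  -- The composition computes the orbit map through x · aT = a · (a⁻¹ x a)T.
  have e : (fun q : G ⧸ T => a • q) ∘ ((QuotientGroup.mk : G → G ⧸ T) ∘
      ((fun x : G => a⁻¹ * x * a⁻¹⁻¹) ∘ (extChartAt (𝓡 n) (1 : G)).symm)) =
      (fun z => (extChartAt (𝓡 n) (1 : G)).symm z • a • ((1 : G) : G ⧸ T)) := by
    ext z
    simp only [Function.comp_apply, MulAction.Quotient.smul_mk, smul_eq_mul]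
    congr 1
    simp [mul_assoc]
  rw [e] at h6
  exact h6

theorem smulDeriv_surjective
    (hπ : Manifold.IsSubmersion (𝓡 n) (𝓡 m) ∞ (QuotientGroup.mk : G → G ⧸ T)) (a : G) :
    Function.Surjective (smulDeriv m T a) := by
  let D : EuclideanSpace ℝ (Fin m) →L[ℝ] EuclideanSpace ℝ (Fin m) :=
    mfderiv (𝓡 m) (𝓡 m) (fun q : G ⧸ T => a⁻¹ • q) (a • ((1 : G) : G ⧸ T))
  have h1 : HasMFDerivAt (𝓡 m) (𝓡 m) (fun q : G ⧸ T => a⁻¹ • q) (a • ((1 : G) : G ⧸ T)) D :=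
    ((contMDiff_const_smul_quotient hπ a⁻¹).mdifferentiableAt (by simp)).hasMFDerivAt
  have h2 : HasMFDerivAt (𝓡 m) (𝓡 m) (fun q : G ⧸ T => a • q)
      ((fun q : G ⧸ T => a⁻¹ • q) (a • ((1 : G) : G ⧸ T))) (smulDeriv m T a) := by
    have e : (fun q : G ⧸ T => a⁻¹ • q) (a • ((1 : G) : G ⧸ T)) = ((1 : G) : G ⧸ T) :=
      inv_smul_smul a _
    rw [e]; exact hasMFDerivAt_smul hπ a
  have h3 := h2.comp _ h1
  have e : (fun q : G ⧸ T => a • q) ∘ (fun q : G ⧸ T => a⁻¹ • q) = id := by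
    ext q; simp
  rw [e] at h3
  have h4 := hasMFDerivAt_unique h3 (hasMFDerivAt_id _)
  exact fun v => ⟨D v, DFunLike.congr_fun h4 v⟩

theorem IsInvariantMetric.metricAt_smulDeriv {g : SmoothRiemannianMetric m (G ⧸ T)}
    (hg : IsInvariantMetric G g) (a : G) (v w : EuclideanSpace ℝ (Fin m)) :
    metricAt g (a • ((1 : G) : G ⧸ T)) (smulDeriv m T a v) (smulDeriv m T a w) =
      metricAt g ((1 : G) : G ⧸ T) v w :=
  hg a _ v w

/-- Invariance of the metric in the chart at `p`. -/
theorem IsInvariantMetric.eventually_metricCLM_actionChart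
    (hπ : Manifold.IsSubmersion (𝓡 n) (𝓡 m) ∞ (QuotientGroup.mk : G → G ⧸ T))
    {g : SmoothRiemannianMetric m (G ⧸ T)} (hg : IsInvariantMetric G g) (p : G ⧸ T)
    (v : EuclideanSpace ℝ (Fin m)) :
    ∀ᶠ z in 𝓝 (chartOne n G),
      metricCLM g p (actionChart n m T p (z, extChartAt (𝓡 m) p p))
        (fderiv ℝ (fun y => actionChart n m T p (z, y)) (extChartAt (𝓡 m) p p) v)
        (fderiv ℝ (fun y => actionChart n m T p (z, y)) (extChartAt (𝓡 m) p p) v) =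
      metricCLM g p (extChartAt (𝓡 m) p p) v v := by
  have hc : ContinuousAt (fun z => (extChartAt (𝓡 n) (1 : G)).symm z • p) (chartOne n G) :=
    (ContMDiffAt.smul_quotient hπ (contMDiffAt_extChartAt_symm_self (1 : G))
      (contMDiffAt_const (c := p))).continuousAt
  have hmem : (extChartAt (𝓡 m) p).source ∈
      𝓝 ((extChartAt (𝓡 n) (1 : G)).symm (chartOne n G) • p) := by
    rw [extChartAt_symm_chartOne, one_smul]
    exact extChartAt_source_mem_nhds p
  filter_upwards [hc.preimage_mem_nhds hmem] with z hz
  set x : G := (extChartAt (𝓡 n) (1 : G)).symm z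
  let D : EuclideanSpace ℝ (Fin m) →L[ℝ] EuclideanSpace ℝ (Fin m) :=
    mfderiv (𝓡 m) (𝓡 m) (fun q : G ⧸ T => x • q) p
  have h1 : HasMFDerivAt (𝓡 m) (𝓡 m) (fun q : G ⧸ T => x • q)
      ((extChartAt (𝓡 m) p).symm (extChartAt (𝓡 m) p p)) D := by
    rw [extChartAt_to_inv]
    exact ((contMDiff_const_smul_quotient hπ x).mdifferentiableAt (by simp)).hasMFDerivAt
  have h2 : HasMFDerivAt 𝓘(ℝ, EuclideanSpace ℝ (Fin m)) (𝓡 m)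
      (fun y => x • (extChartAt (𝓡 m) p).symm y) (extChartAt (𝓡 m) p p) D :=
    h1.comp (extChartAt (𝓡 m) p p) (hasMFDerivAt_extChartAt_symm_self p)
  have hz' : x • (extChartAt (𝓡 m) p).symm (extChartAt (𝓡 m) p p) ∈
      (extChartAt (𝓡 m) p).source := by
    rw [extChartAt_to_inv]; exact hz
  obtain ⟨L, hL, hLv⟩ := h2.exists_hasFDerivAt_extChartAt hz'
  have e1 : fderiv ℝ (fun y => actionChart n m T p (z, y)) (extChartAt (𝓡 m) p p) = L := hL.fderiv
  rw [extChartAt_to_inv] at hLv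
  rw [e1, actionChart_extChartAt (mem_extChartAt_source p), metricCLM_extChartAt g hz,
    metricCLM_extChartAt g (mem_extChartAt_source p), hLv, chartSymmDeriv_self]
  exact hg x p v v

variable [T2Space G]

theorem contMDiff_oneParam_smul
    (hπ : Manifold.IsSubmersion (𝓡 n) (𝓡 m) ∞ (QuotientGroup.mk : G → G ⧸ T))
    (X : GroupLieAlgebra (𝓡 n) G) :
    ContMDiff 𝓘(ℝ, ℝ) (𝓡 m) ∞ (fun s => oneParam X s • ((1 : G) : G ⧸ T)) := fun s =>
  ContMDiffAt.smul_quotient hπ (contMDiff_oneParam X s) contMDiffAt_const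

/-- This is the derivative of the momentum after it has been moved to the base point, in the form
used in `geodesic_expression`. -/
theorem hasDerivAt_lieAd_oneParam_inv (X Y : GroupLieAlgebra (𝓡 n) G) (t : ℝ) :
    HasDerivAt (F := EuclideanSpace ℝ (Fin n))
      (fun s => lieAd (oneParam X s)⁻¹ (lieAd (oneParam X t) Y))
      (-⁅X, Y⁆ : GroupLieAlgebra (𝓡 n) G) t := by
  let f : ℝ → EuclideanSpace ℝ (Fin n) := fun s => lieAd (oneParam X s) (lieAd (oneParam X t) Y)
  have h1 : HasDerivAt f (⁅X, Y⁆ : GroupLieAlgebra (𝓡 n) G) (-t) := by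
    have e : lieAd (oneParam X (-t)) (lieAd (oneParam X t) Y) = Y := by
      rw [oneParam_neg, lieAd_inv_apply]
    have h := hasDerivAt_lieAd_oneParam X (lieAd (oneParam X t) Y) (-t)
    rw [e] at h
    exact h
  have h2 := HasDerivAt.scomp (g₁ := f) (h := fun s => -s) t h1 (hasDerivAt_neg t)
  have h3 := h2.congr_deriv (neg_one_smul ℝ _)
  refine h3.congr_of_eventuallyEq (Eventually.of_forall fun s => ?_)
  change lieAd (oneParam X s)⁻¹ (lieAd (oneParam X t) Y) =
    lieAd (oneParam X (-s)) (lieAd (oneParam X t) Y)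
  rw [oneParam_neg]

/-- Noether's argument. The left-hand side is the covariant acceleration tested against the Killing
field K of Ad(exp tX)Y, that is, the derivative at t of the momentum g(c', K). Invariance computes
the same derivative at the base point. The point p and the curve c are free variables tied down by
equations so that they can be rewritten. -/
theorem geodesic_expression
    (hπ : Manifold.IsSubmersion (𝓡 n) (𝓡 m) ∞ (QuotientGroup.mk : G → G ⧸ T))
    {g : SmoothRiemannianMetric m (G ⧸ T)} (hg : IsInvariantMetric G g)
    (X Y : GroupLieAlgebra (𝓡 n) G) (t : ℝ) {p : G ⧸ T}
    (hp : p = oneParam X t • ((1 : G) : G ⧸ T)) {c : ℝ → EuclideanSpace ℝ (Fin m)}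
    (hc : c = fun s => extChartAt (𝓡 m) p (oneParam X s • ((1 : G) : G ⧸ T))) :
    metricInChart g p (c t) (deriv (deriv c) t)
        (smulDeriv m T (oneParam X t) (projDeriv n m T Y))
      + christoffelFirst g p (c t) (deriv c t) (deriv c t)
        (smulDeriv m T (oneParam X t) (projDeriv n m T Y)) =
      -metricAt g ((1 : G) : G ⧸ T) (projDeriv n m T X) (projDeriv n m T ⁅X, Y⁆) := by
  set γ : ℝ → G ⧸ T := fun s => oneParam X s • ((1 : G) : G ⧸ T) with hγ
  have hct : c t = extChartAt (𝓡 m) p p := by rw [hc, hp]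
  -- With this generator, the Killing field at the point of time t is the translate by exp(tX) of
  -- the vector dπ(Y).
  set Y₁ : EuclideanSpace ℝ (Fin n) := lieAd (oneParam X t) Y with hY₁
  set K : EuclideanSpace ℝ (Fin m) → EuclideanSpace ℝ (Fin m) := fun y =>
    fderiv ℝ (fun z => actionChart n m T p (z, y)) (chartOne n G) Y₁ with hKdef
  have hF : ContDiffAt ℝ 2 (actionChart n m T p) (chartOne n G, extChartAt (𝓡 m) p p) :=
    (contDiffAt_actionChart hπ p).of_le ENat.LEInfty.out
  have hK : HasFDerivAt K (fderiv ℝ K (c t)) (c t) := by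
    rw [hct]
    exact (hF.hasFDerivAt_fderiv_fst Y₁).differentiableAt.hasFDerivAt
  have hsrc : ∀ᶠ s in 𝓝 t, γ s ∈ (extChartAt (𝓡 m) p).source := by
    refine (contMDiff_oneParam_smul hπ X).continuous.continuousAt.preimage_mem_nhds ?_
    rw [← hp]
    exact extChartAt_source_mem_nhds p
  have hγd (s : ℝ) (hs : γ s ∈ (extChartAt (𝓡 m) p).source) :
      HasDerivAt c (deriv c s) s ∧ chartSymmDeriv p (c s) (deriv c s) =
        smulDeriv m T (oneParam X s) (projDeriv n m T X) := by
    obtain ⟨L, hL, hLv⟩ := (hasMFDerivAt_oneParam_smul hπ X s).exists_hasFDerivAt_extChartAt hs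
    have h1 : HasDerivAt c (L 1) s := by rw [hc]; exact hL.hasDerivAt
    rw [h1.deriv]
    refine ⟨h1, ?_⟩
    have h2 := hLv 1
    rw [hc]
    exact h2.trans (one_smul ℝ (smulDeriv m T (oneParam X s) (projDeriv n m T X)))
  have hKd (s : ℝ) (hs : γ s ∈ (extChartAt (𝓡 m) p).source) :
      chartSymmDeriv p (c s) (K (c s)) = smulDeriv m T (oneParam X s)
        (projDeriv n m T (lieAd (oneParam X s)⁻¹ Y₁)) := by
    have hs' : (extChartAt (𝓡 n) (1 : G)).symm (chartOne n G) • oneParam X s •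
        ((1 : G) : G ⧸ T) ∈ (extChartAt (𝓡 m) p).source := by
      rw [extChartAt_symm_chartOne, one_smul]; exact hs
    obtain ⟨L, hL, hLv⟩ := (hasMFDerivAt_orbit hπ (oneParam X s)).exists_hasFDerivAt_extChartAt hs'
    rw [extChartAt_symm_chartOne, one_smul] at hLv
    have e1 : K (c s) = L Y₁ := by
      rw [hKdef, ← hL.fderiv]
      simp only [hc]
      rw [show (fun z => actionChart n m T p (z, extChartAt (𝓡 m) p (γ s))) = _ from
        funext fun z => actionChart_extChartAt hs z]
    rw [e1, hc]
    exact hLv Y₁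
  have hts := hsrc.self_of_nhds
  have hKt : K (c t) = smulDeriv m T (oneParam X t) (projDeriv n m T Y) := by
    have h1 := hKd t hts
    rw [hct, chartSymmDeriv_self] at h1
    rw [hct]
    refine h1.trans ?_
    rw [hY₁, lieAd_inv_apply]
  have hGd : DifferentiableAt ℝ (metricCLM g p) (c t) := by
    rw [hct]
    exact ((contDiffOn_metricCLM g p).contDiffAt (extChartAt_target_mem_nhds_self p)).differentiableAt
      (by simp)
  have hcd : ContDiffAt ℝ 2 c t := by
    have h1 : ContMDiffAt 𝓘(ℝ, ℝ) 𝓘(ℝ, EuclideanSpace ℝ (Fin m)) ∞ c t := by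
      rw [hc]
      exact ContMDiffAt.comp_of_eq (contMDiffAt_extChartAt (I := 𝓡 m))
        (contMDiff_oneParam_smul hπ X t) hp.symm
    exact h1.contDiffAt.of_le ENat.LEInfty.out
  have hc2 : HasDerivAt (deriv c) (deriv (deriv c) t) t := by
    have h : ContDiffAt ℝ 1 (deriv c) t :=
      (hcd.fderiv_right (m := 1) (by norm_num)).clm_apply (contDiffAt_const (c := (1 : ℝ)))
    exact (h.differentiableAt (by simp)).hasDerivAt
  have hkill := killing_equation (Gm := metricCLM g p) (v := deriv c t)
    (by rw [← hct]; exact hGd.hasFDerivAt)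
    (fun v w => metricCLM_symm g p _ v w) hF
    (by filter_upwards [extChartAt_target_mem_nhds_self p] with y hy using actionChart_chartOne hy)
    (hg.eventually_metricCLM_actionChart hπ p _) Y₁
  have hmom := hasDerivAt_momentum hGd.hasFDerivAt (hγd t hts).1 hc2 hK (by
    rw [hct] at hkill ⊢; exact hkill)
  -- Translating back by exp(sX), the momentum at time s is g_o(dπ X, dπ Ad(exp sX)⁻¹Y₁).
  have hN : HasDerivAt (fun s => metricCLM g p (c s) (deriv c s) (K (c s)))
      (-metricAt g ((1 : G) : G ⧸ T) (projDeriv n m T X) (projDeriv n m T ⁅X, Y⁆)) t := by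
    let B : EuclideanSpace ℝ (Fin n) →L[ℝ] ℝ :=
      (metricAt g ((1 : G) : G ⧸ T) (projDeriv n m T X)).comp (projDeriv n m T)
    have h1 := B.hasFDerivAt.comp_hasDerivAt t (hasDerivAt_lieAd_oneParam_inv X Y t)
    have h2 := h1.congr_deriv (map_neg B _)
    refine h2.congr_of_eventuallyEq ?_
    filter_upwards [hsrc] with s hs
    have h3 : c s = extChartAt (𝓡 m) p (γ s) := by rw [hc]
    have h4 := (hγd s hs).2
    have h5 := hKd s hs
    rw [h3] at h4 h5
    rw [h3, metricCLM_extChartAt g hs, h4, h5]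
    exact hg.metricAt_smulDeriv _ _ _
  have hfd (u v w : EuclideanSpace ℝ (Fin m)) :
      fderiv ℝ (fun z => metricInChart g p z v w) (c t) u =
        fderiv ℝ (metricCLM g p) (c t) u v w := by
    have h1 := (hGd.hasFDerivAt.clm_apply (hasFDerivAt_const v (c t))).clm_apply
      (hasFDerivAt_const w (c t))
    have h2 := h1.fderiv
    have h3 := DFunLike.congr_fun h2 u
    refine h3.trans ?_
    simp
  have := hmom.unique hN
  rw [hKt] at this
  rw [← this, christoffelFirst, hfd, hfd, metricCLM_apply]

/-- The orbit of a one-parameter subgroup through the base point is a geodesic of an invariant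
metric if and only if its generator is a geodesic vector. -/
theorem isGeodesic_oneParam_iff
    (hπ : Manifold.IsSubmersion (𝓡 n) (𝓡 m) ∞ (QuotientGroup.mk : G → G ⧸ T))
    {g : SmoothRiemannianMetric m (G ⧸ T)} (hg : IsInvariantMetric G g)
    (X : GroupLieAlgebra (𝓡 n) G) :
    IsGeodesic g (fun s => oneParam X s • ((1 : G) : G ⧸ T)) ↔
      ∀ Y, metricAt g ((1 : G) : G ⧸ T) (projDeriv n m T X) (projDeriv n m T ⁅X, Y⁆) = 0 := by
  constructor
  · rintro ⟨-, h⟩ Y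
    have h1 := h 0 (smulDeriv m T (oneParam X 0) (projDeriv n m T Y))
    have h2 := geodesic_expression hπ hg X Y 0 rfl rfl
    rw [← neg_eq_zero, ← h2]
    exact h1
  · intro h
    refine ⟨contMDiff_oneParam_smul hπ X, fun t w => ?_⟩
    -- Every test vector at time t is a translate of some dπ(Y), so the momentum identities
    -- determine the whole acceleration.
    obtain ⟨v, rfl⟩ := smulDeriv_surjective hπ (oneParam X t) w
    obtain ⟨Y, rfl⟩ := projDeriv_surjective hπ v
    have h2 := geodesic_expression hπ hg X Y t rfl rfl
    rw [h Y, neg_zero] at h2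
    exact h2

end GeodesicCriterion

/-! ### Construction of invariant metrics from their value at the base point. -/

section InvariantMetrics

theorem contDiffAt_clm_of_forall_apply {D E F : Type*} [NormedAddCommGroup D] [NormedSpace ℝ D]
    [NormedAddCommGroup E] [NormedSpace ℝ E] [FiniteDimensional ℝ E]
    [NormedAddCommGroup F] [NormedSpace ℝ F] {k : WithTop ℕ∞} {f : D → E →L[ℝ] F} {x : D}
    (h : ∀ v, ContDiffAt ℝ k (fun y => f y v) x) : ContDiffAt ℝ k f x := by
  have hd : Module.finrank ℝ E = Module.finrank ℝ (Fin (Module.finrank ℝ E) → ℝ) :=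
    (Module.finrank_fin_fun ℝ).symm
  let e₁ := ContinuousLinearEquiv.ofFinrankEq hd
  let e₂ := (e₁.arrowCongr (1 : F ≃L[ℝ] F)).trans
    (ContinuousLinearEquiv.piRing (Fin (Module.finrank ℝ E)))
  rw [← Function.id_comp f, ← e₂.symm_comp_self]
  exact e₂.symm.contDiff.contDiffAt.comp x (contDiffAt_pi.mpr fun i => h _)

theorem isVonNBounded_of_posDef {E : Type*} [NormedAddCommGroup E] [NormedSpace ℝ E]
    [FiniteDimensional ℝ E] (b : E →L[ℝ] E →L[ℝ] ℝ) (hb : ∀ v, v ≠ 0 → 0 < b v v) :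
    Bornology.IsVonNBounded ℝ {v | b v v < 1} := by
  rw [NormedSpace.isVonNBounded_iff]
  have hcont : Continuous fun v => b v v := by fun_prop
  rcases (Metric.sphere (0 : E) 1).eq_empty_or_nonempty with h | h
  · have h0 : ∀ v : E, v = 0 := by
      intro v
      by_contra hv
      have : ‖v‖⁻¹ • v ∈ Metric.sphere (0 : E) 1 := by
        simp [norm_smul, inv_mul_cancel₀ (norm_ne_zero_iff.2 hv)]
      simp [h] at this
    have : Subsingleton E := ⟨fun a b => (h0 a).trans (h0 b).symm⟩
    exact (Set.toFinite _).isBounded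
  · obtain ⟨u, hu, hmin⟩ := (isCompact_sphere (0 : E) 1).exists_isMinOn h hcont.continuousOn
    have hu0 : u ≠ 0 := by
      rintro rfl
      simp at hu
    have hpos := hb u hu0
    -- If b is at least b(u,u) on the unit sphere, then ‖v‖² < b(u,u)⁻¹. The radius 1 + b(u,u)⁻¹
    -- avoids a square root.
    refine (Metric.isBounded_ball (x := (0 : E)) (r := 1 + (b u u)⁻¹)).subset fun v hv => ?_
    rw [mem_ball_zero_iff]
    by_cases hv0 : v = 0
    · subst hv0
      simp only [norm_zero]
      positivity
    have hn : 0 < ‖v‖ := norm_pos_iff.2 hv0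
    have h1 : ‖v‖⁻¹ • v ∈ Metric.sphere (0 : E) 1 := by
      simp [norm_smul, inv_mul_cancel₀ hn.ne']
    have h2 : b u u ≤ b (‖v‖⁻¹ • v) (‖v‖⁻¹ • v) := hmin h1
    simp only [map_smul, smul_apply, smul_eq_mul] at h2
    have h3 : b u u * ‖v‖ ^ 2 < 1 := by
      have h4 : b u u * ‖v‖ ^ 2 ≤ b v v := by
        have := mul_le_mul_of_nonneg_right h2 (sq_nonneg ‖v‖)
        refine this.trans (le_of_eq ?_)
        field_simp
      exact h4.trans_lt hv
    have h5 : ‖v‖ ^ 2 < (b u u)⁻¹ := by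
      rw [← one_div, lt_div_iff₀' hpos]
      exact h3
    nlinarith [sq_nonneg (‖v‖ - 1)]

variable {n m : ℕ} {G : Type*} [TopologicalSpace G] [Group G]
  [ChartedSpace (EuclideanSpace ℝ (Fin n)) G] [LieGroup (𝓡 n) ∞ G] {T : Subgroup G}
  [ChartedSpace (EuclideanSpace ℝ (Fin m)) (G ⧸ T)] [IsManifold (𝓡 m) ∞ (G ⧸ T)]

variable (m T) in
/-- The derivative of the translation by `a` at `p`. -/
def smulDerivAt (a : G) (p : G ⧸ T) : EuclideanSpace ℝ (Fin m) →L[ℝ] EuclideanSpace ℝ (Fin m) :=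
  mfderiv (𝓡 m) (𝓡 m) (fun q : G ⧸ T => a • q) p

theorem hasMFDerivAt_smulDerivAt
    (hπ : Manifold.IsSubmersion (𝓡 n) (𝓡 m) ∞ (QuotientGroup.mk : G → G ⧸ T)) (a : G) (p : G ⧸ T) :
    HasMFDerivAt (𝓡 m) (𝓡 m) (fun q : G ⧸ T => a • q) p (smulDerivAt m T a p) :=
  ((contMDiff_const_smul_quotient hπ a).mdifferentiableAt (by simp)).hasMFDerivAt

theorem smulDerivAt_mul
    (hπ : Manifold.IsSubmersion (𝓡 n) (𝓡 m) ∞ (QuotientGroup.mk : G → G ⧸ T)) (a b : G) (p : G ⧸ T) :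
    smulDerivAt m T (a * b) p = (smulDerivAt m T a (b • p)).comp (smulDerivAt m T b p) := by
  have h := (hasMFDerivAt_smulDerivAt hπ a (b • p)).comp p (hasMFDerivAt_smulDerivAt hπ b p)
  have e : (fun q : G ⧸ T => a • q) ∘ (fun q : G ⧸ T => b • q) = fun q => (a * b) • q := by
    ext q
    simp [mul_smul]
  rw [e] at h
  exact h.mfderiv

theorem smulDerivAt_one (p : G ⧸ T) :
    smulDerivAt m T (1 : G) p = ContinuousLinearMap.id ℝ _ := by
  have h : HasMFDerivAt (𝓡 m) (𝓡 m) (fun q : G ⧸ T => (1 : G) • q) p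
      (ContinuousLinearMap.id ℝ (TangentSpace (𝓡 m) p)) := by
    have e : (fun q : G ⧸ T => (1 : G) • q) = id := by ext q; simp
    rw [e]
    exact hasMFDerivAt_id _
  exact h.mfderiv

theorem smulDerivAt_injective
    (hπ : Manifold.IsSubmersion (𝓡 n) (𝓡 m) ∞ (QuotientGroup.mk : G → G ⧸ T)) (a : G) (p : G ⧸ T) :
    Function.Injective (smulDerivAt m T a p) := by
  have h := smulDerivAt_mul hπ a⁻¹ a p
  rw [inv_mul_cancel, smulDerivAt_one] at h
  exact Function.LeftInverse.injective (g := smulDerivAt m T a⁻¹ (a • p))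
    fun v => (DFunLike.congr_fun h v).symm

/-- The translate of a bilinear form on the tangent space at the base point. -/
def translateForm (Q : EuclideanSpace ℝ (Fin m) →L[ℝ] EuclideanSpace ℝ (Fin m) →L[ℝ] ℝ) (a : G)
    (p : G ⧸ T) : EuclideanSpace ℝ (Fin m) →L[ℝ] EuclideanSpace ℝ (Fin m) →L[ℝ] ℝ :=
  Q.bilinearComp (smulDerivAt m T a⁻¹ p) (smulDerivAt m T a⁻¹ p)

theorem translateForm_apply
    (Q : EuclideanSpace ℝ (Fin m) →L[ℝ] EuclideanSpace ℝ (Fin m) →L[ℝ] ℝ) (a : G)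
    (p : G ⧸ T) (v w : EuclideanSpace ℝ (Fin m)) :
    translateForm Q a p v w = Q (smulDerivAt m T a⁻¹ p v) (smulDerivAt m T a⁻¹ p w) := rfl

/-- Two representatives of a coset differ by an element of T, which preserves Q. -/
theorem translateForm_eq
    (hπ : Manifold.IsSubmersion (𝓡 n) (𝓡 m) ∞ (QuotientGroup.mk : G → G ⧸ T))
    {Q : EuclideanSpace ℝ (Fin m) →L[ℝ] EuclideanSpace ℝ (Fin m) →L[ℝ] ℝ}
    (hQ : ∀ t ∈ T, ∀ v w, Q (smulDeriv m T t v) (smulDeriv m T t w) = Q v w) {a b : G} {p : G ⧸ T}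
    (ha : (a : G ⧸ T) = p) (hb : (b : G ⧸ T) = p) :
    translateForm Q a p = translateForm Q b p := by
  have ht : b⁻¹ * a ∈ T := QuotientGroup.eq.1 (hb.trans ha.symm)
  have h := smulDerivAt_mul hπ (b⁻¹ * a) a⁻¹ p
  have e : a⁻¹ • p = ((1 : G) : G ⧸ T) := by
    rw [← ha, MulAction.Quotient.smul_mk]
    simp
  rw [mul_assoc, mul_inv_cancel, mul_one, e] at h
  ext v w
  rw [translateForm_apply, translateForm_apply, h]
  exact (hQ _ ht _ _).symm

theorem trivializationAt_symm_eq_chartSymmDeriv {M : Type*} [TopologicalSpace M]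
    [ChartedSpace (EuclideanSpace ℝ (Fin m)) M] [IsManifold (𝓡 m) ∞ M] {p x : M}
    (hx : x ∈ (extChartAt (𝓡 m) p).source) (v : EuclideanSpace ℝ (Fin m)) :
    (trivializationAt (EuclideanSpace ℝ (Fin m)) (TangentSpace (𝓡 m)) p).symm x v =
      chartSymmDeriv p (extChartAt (𝓡 m) p x) v := by
  have h := TangentBundle.symmL_trivializationAt (I := 𝓡 m) (x₀ := p) (x := x) (by simpa using hx)
  rw [ModelWithCorners.range_eq_univ, mfderivWithin_univ] at h
  rw [← Trivialization.symmL_apply (R := ℝ) _ (by simpa using hx), h]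
  rfl

/-- A global choice of representatives cannot be expected to be continuous. Since the translated
form does not depend on the representative, a smooth local section σ may be used instead. In
coordinates the form is then Q pulled back by the differential at y = z of y ↦ σ(z)⁻¹ · y, which is
smooth in z. -/
theorem contMDiffAt_translateForm
    (hπ : Manifold.IsSubmersion (𝓡 n) (𝓡 m) ∞ (QuotientGroup.mk : G → G ⧸ T))
    {Q : EuclideanSpace ℝ (Fin m) →L[ℝ] EuclideanSpace ℝ (Fin m) →L[ℝ] ℝ}
    (s : ∀ p : G ⧸ T, TangentSpace (𝓡 m) p →L[ℝ] TangentSpace (𝓡 m) p →L[ℝ] ℝ)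
    (hs : ∀ (p : G ⧸ T) (a : G), (a : G ⧸ T) = p → s p = translateForm Q a p) (p₀ : G ⧸ T) :
    ContMDiffAt (𝓡 m)
      ((𝓡 m).prod 𝓘(ℝ, EuclideanSpace ℝ (Fin m) →L[ℝ] EuclideanSpace ℝ (Fin m) →L[ℝ] ℝ)) ∞
      (fun p => TotalSpace.mk' (EuclideanSpace ℝ (Fin m) →L[ℝ] EuclideanSpace ℝ (Fin m) →L[ℝ] ℝ)
        (E := fun p : G ⧸ T => TangentSpace (𝓡 m) p →L[ℝ] TangentSpace (𝓡 m) p →L[ℝ] ℝ)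
        p (s p)) p₀ := by
  rw [contMDiffAt_section]
  obtain ⟨a₀, ha₀⟩ := QuotientGroup.mk_surjective p₀
  obtain ⟨σ, hσ1, hσ, hσe⟩ := hπ.exists_section a₀
  rw [ha₀] at hσ1 hσ hσe
  set z₀ := extChartAt (𝓡 m) p₀ p₀ with hz₀
  let H : EuclideanSpace ℝ (Fin m) × EuclideanSpace ℝ (Fin m) → EuclideanSpace ℝ (Fin m) :=
    fun q => extChartAt (𝓡 m) ((1 : G) : G ⧸ T)
      ((σ ((extChartAt (𝓡 m) p₀).symm q.1))⁻¹ • (extChartAt (𝓡 m) p₀).symm q.2)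
  have e₀ : (σ p₀)⁻¹ • p₀ = ((1 : G) : G ⧸ T) := by
    rw [hσ1, ← ha₀, MulAction.Quotient.smul_mk]
    simp
  have hH : ContDiffAt ℝ ∞ H (z₀, z₀) := by
    refine ContMDiffAt.contDiffAt ?_
    have h1 : ContMDiffAt 𝓘(ℝ, EuclideanSpace ℝ (Fin m) × EuclideanSpace ℝ (Fin m)) (𝓡 m) ∞
        (fun q : EuclideanSpace ℝ (Fin m) × EuclideanSpace ℝ (Fin m) =>
          (extChartAt (𝓡 m) p₀).symm q.1) (z₀, z₀) :=
      (contMDiffAt_extChartAt_symm_self p₀).comp (z₀, z₀) contDiffAt_fst.contMDiffAt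
    have h2 : ContMDiffAt 𝓘(ℝ, EuclideanSpace ℝ (Fin m) × EuclideanSpace ℝ (Fin m)) (𝓡 m) ∞
        (fun q : EuclideanSpace ℝ (Fin m) × EuclideanSpace ℝ (Fin m) =>
          (extChartAt (𝓡 m) p₀).symm q.2) (z₀, z₀) :=
      (contMDiffAt_extChartAt_symm_self p₀).comp (z₀, z₀) contDiffAt_snd.contMDiffAt
    have h3 := ContMDiffAt.comp_of_eq (x := (z₀, z₀)) hσ h1 (extChartAt_to_inv (I := 𝓡 m) p₀)
    refine ContMDiffAt.comp_of_eq (y := ((1 : G) : G ⧸ T)) (contMDiffAt_extChartAt (I := 𝓡 m))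
      (ContMDiffAt.smul_quotient hπ h3.inv h2) ?_
    simp only [hz₀]
    rw [extChartAt_to_inv, e₀]
  let A : EuclideanSpace ℝ (Fin m) → EuclideanSpace ℝ (Fin m) →L[ℝ] EuclideanSpace ℝ (Fin m) :=
    fun z => fderiv ℝ (fun y => H (z, y)) z
  have hA : ContDiffAt ℝ ∞ A z₀ :=
    ContDiffAt.fderiv (f := fun z y => H (z, y)) (g := fun z => z) (n := ∞) hH contDiffAt_id
      (by simp)
  have hB : ContDiffAt ℝ ∞ (fun z => Q.bilinearComp (A z) (A z)) z₀ := by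
    refine contDiffAt_clm_of_forall_apply fun v => contDiffAt_clm_of_forall_apply fun w => ?_
    have h1 (v : EuclideanSpace ℝ (Fin m)) : ContDiffAt ℝ ∞ (fun z => A z v) z₀ :=
      hA.clm_apply contDiffAt_const
    exact (Q.contDiff.contDiffAt.comp z₀ (h1 v)).clm_apply (h1 w)
  have hC : ContMDiffAt (𝓡 m)
      𝓘(ℝ, EuclideanSpace ℝ (Fin m) →L[ℝ] EuclideanSpace ℝ (Fin m) →L[ℝ] ℝ) ∞
      (fun x => Q.bilinearComp (A (extChartAt (𝓡 m) p₀ x)) (A (extChartAt (𝓡 m) p₀ x))) p₀ :=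
    hB.contMDiffAt.comp p₀ (contMDiffAt_extChartAt (I := 𝓡 m))
  refine hC.congr_of_eventuallyEq ?_
  filter_upwards [hσe, extChartAt_source_mem_nhds (I := 𝓡 m) p₀] with x hx hxs
  have hxs' : x ∈ (trivializationAt (EuclideanSpace ℝ (Fin m)) (TangentSpace (𝓡 m)) p₀).baseSet := by
    simpa using hxs
  have e₁ : (σ x)⁻¹ • x = ((1 : G) : G ⧸ T) := by
    have h : (σ x)⁻¹ • ((σ x : G) : G ⧸ T) = ((1 : G) : G ⧸ T) := by
      rw [MulAction.Quotient.smul_mk]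
      simp
    rwa [hx] at h
  have hAx (v : EuclideanSpace ℝ (Fin m)) : A (extChartAt (𝓡 m) p₀ x) v =
      smulDerivAt m T (σ x)⁻¹ x (chartSymmDeriv p₀ (extChartAt (𝓡 m) p₀ x) v) := by
    have h1 : HasMFDerivAt 𝓘(ℝ, EuclideanSpace ℝ (Fin m)) (𝓡 m) (extChartAt (𝓡 m) p₀).symm
        (extChartAt (𝓡 m) p₀ x) (chartSymmDeriv p₀ (extChartAt (𝓡 m) p₀ x)) :=
      ((contMDiffAt_extChartAt_symm_of_mem ((extChartAt (𝓡 m) p₀).map_source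
        hxs)).mdifferentiableAt (by simp)).hasMFDerivAt
    have h2 : HasMFDerivAt (𝓡 m) (𝓡 m) (fun q : G ⧸ T => (σ x)⁻¹ • q)
        ((extChartAt (𝓡 m) p₀).symm (extChartAt (𝓡 m) p₀ x)) (smulDerivAt m T (σ x)⁻¹ x) := by
      rw [(extChartAt (𝓡 m) p₀).left_inv hxs]
      exact hasMFDerivAt_smulDerivAt hπ _ _
    have h3 : HasMFDerivAt 𝓘(ℝ, EuclideanSpace ℝ (Fin m)) (𝓡 m)
        (fun y => (σ x)⁻¹ • (extChartAt (𝓡 m) p₀).symm y) (extChartAt (𝓡 m) p₀ x)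
        ((smulDerivAt m T (σ x)⁻¹ x).comp (chartSymmDeriv p₀ (extChartAt (𝓡 m) p₀ x))) :=
      h2.comp _ h1
    have e₂ : (σ x)⁻¹ • (extChartAt (𝓡 m) p₀).symm (extChartAt (𝓡 m) p₀ x) =
        ((1 : G) : G ⧸ T) := by
      rw [(extChartAt (𝓡 m) p₀).left_inv hxs, e₁]
    obtain ⟨L, hL, hLv⟩ := h3.exists_hasFDerivAt_extChartAt (p := ((1 : G) : G ⧸ T))
      (by rw [e₂]; exact mem_extChartAt_source _)
    rw [e₂, chartSymmDeriv_self] at hLv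
    have e₃ : A (extChartAt (𝓡 m) p₀ x) = L := by
      simp only [A, H]
      rw [(extChartAt (𝓡 m) p₀).left_inv hxs]
      exact hL.fderiv
    rw [e₃]
    exact hLv v
  refine ContinuousLinearMap.ext fun v => ContinuousLinearMap.ext fun w => ?_
  refine (inCoordinates_apply_eq₂ (F₁ := EuclideanSpace ℝ (Fin m))
    (F₂ := EuclideanSpace ℝ (Fin m)) (F₃ := ℝ) (E₃ := Bundle.Trivial (G ⧸ T) ℝ) (ϕ := s x)
    hxs' hxs' (Set.mem_univ _)).trans ?_
  rw [trivializationAt_symm_eq_chartSymmDeriv hxs, trivializationAt_symm_eq_chartSymmDeriv hxs,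
    hs x (σ x) hx]
  simp only [Bundle.Trivial.fiberBundle_trivializationAt', Bundle.Trivial.linearMapAt_trivialization]
  change translateForm Q (σ x) x _ _ = Q (A _ v) (A _ w)
  rw [hAx, hAx]
  rfl

/-- A `T`-invariant inner product on the tangent space at the base point extends to an invariant
Riemannian metric. -/
theorem exists_invariantMetric
    (hπ : Manifold.IsSubmersion (𝓡 n) (𝓡 m) ∞ (QuotientGroup.mk : G → G ⧸ T))
    (Q : EuclideanSpace ℝ (Fin m) →L[ℝ] EuclideanSpace ℝ (Fin m) →L[ℝ] ℝ)
    (hsymm : ∀ v w, Q v w = Q w v) (hpos : ∀ v, v ≠ 0 → 0 < Q v v)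
    (hQ : ∀ t ∈ T, ∀ v w, Q (smulDeriv m T t v) (smulDeriv m T t w) = Q v w) :
    ∃ g : SmoothRiemannianMetric m (G ⧸ T), IsInvariantMetric G g ∧
      metricAt g ((1 : G) : G ⧸ T) = Q := by
  have hrep (p : G ⧸ T) (a : G) (ha : (a : G ⧸ T) = p) :
      translateForm Q (Quotient.out p) p = translateForm Q a p :=
    translateForm_eq hπ hQ (QuotientGroup.out_eq' p) ha
  let g : SmoothRiemannianMetric m (G ⧸ T) :=
    { inner := fun p => translateForm Q (Quotient.out p) p
      symm := fun p v w => hsymm _ _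
      pos := fun p v hv => hpos _ fun h => hv (smulDerivAt_injective hπ _ p
        (h.trans (map_zero (smulDerivAt m T _ p)).symm))
      isVonNBounded := fun p => isVonNBounded_of_posDef (translateForm Q (Quotient.out p) p)
        fun v hv => hpos _ fun h => hv (smulDerivAt_injective hπ _ p
          (h.trans (map_zero (smulDerivAt m T _ p)).symm))
      contMDiff := fun p => contMDiffAt_translateForm hπ _ hrep p }
  refine ⟨g, fun a p v w => ?_, ?_⟩
  · have h1 : ((a * Quotient.out p : G) : G ⧸ T) = a • p := by
      conv_rhs => rw [← QuotientGroup.out_eq' p]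
      rfl
    have h2 := smulDerivAt_mul hπ (a * Quotient.out p)⁻¹ a p
    have h3 : (a * Quotient.out p)⁻¹ * a = (Quotient.out p)⁻¹ := by simp
    rw [h3] at h2
    have key (v w : EuclideanSpace ℝ (Fin m)) : translateForm Q (Quotient.out (a • p)) (a • p)
        (smulDerivAt m T a p v) (smulDerivAt m T a p w) =
          translateForm Q (Quotient.out p) p v w := by
      rw [hrep _ _ h1, translateForm_apply, translateForm_apply, h2]
      rfl
    exact key v w
  · change translateForm Q (Quotient.out ((1 : G) : G ⧸ T)) ((1 : G) : G ⧸ T) = Q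
    rw [hrep _ 1 rfl]
    ext v w
    rw [translateForm_apply, inv_one, smulDerivAt_one]
    rfl

end InvariantMetrics

/-! ### An invariant inner product on the Lie algebra, by averaging. -/

section InvariantInnerProduct

variable {n : ℕ} {G : Type*} [TopologicalSpace G] [Group G]
  [ChartedSpace (EuclideanSpace ℝ (Fin n)) G] [LieGroup (𝓡 n) ∞ G]

/-- At 1 this follows from differentiability of `Ad` in the chart; multiplicativity of `Ad` moves it
to every point. It makes the averaged integrand continuous. -/
theorem continuous_lieAd (Y : GroupLieAlgebra (𝓡 n) G) :
    Continuous (Y := EuclideanSpace ℝ (Fin n)) (fun g : G => lieAd g Y) := by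
  have : IsTopologicalGroup G := topologicalGroup_of_lieGroup (𝓡 n) ∞
  have h1 : ContinuousAt (Y := EuclideanSpace ℝ (Fin n)) (fun g : G => lieAd g Y) 1 := by
    have h2 := (hasFDerivAt_lieAd_chart (n := n) (G := G) Y).continuousAt
    have h3 : ContinuousAt ((fun x => fderiv ℝ (fun y => conjChart n G (x, y)) (chartOne n G) Y) ∘
        extChartAt (𝓡 n) (1 : G)) 1 := ContinuousAt.comp h2 (continuousAt_extChartAt (1 : G))
    refine h3.congr ?_
    filter_upwards [extChartAt_source_mem_nhds (I := 𝓡 n) (1 : G)] with g hg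
    have e := (extChartAt (𝓡 n) (1 : G)).left_inv hg
    change fderiv ℝ (fun y => conjChart n G (extChartAt (𝓡 n) (1 : G) g, y)) (chartOne n G) Y = _
    simp only [conjChart, e]
    rfl
  refine continuous_iff_continuousAt.2 fun g => ?_
  let A : EuclideanSpace ℝ (Fin n) →L[ℝ] EuclideanSpace ℝ (Fin n) := lieAd (n := n) g
  have h4 : ContinuousAt (Y := EuclideanSpace ℝ (Fin n))
      (fun h : G => A (lieAd (g⁻¹ * h) Y)) g := by
    refine A.continuous.continuousAt.comp (f := fun h : G =>
      (lieAd (g⁻¹ * h) Y : EuclideanSpace ℝ (Fin n))) ?_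
    refine ContinuousAt.comp_of_eq (f := fun h : G => g⁻¹ * h) (y := 1) h1 ?_ (inv_mul_cancel g)
    fun_prop
  refine h4.congr (Eventually.of_forall fun h => ?_)
  change lieAd g (lieAd (g⁻¹ * h) Y) = lieAd h Y
  rw [← lieAd_mul_apply, mul_inv_cancel_left]

open MeasureTheory in
/-- A compact Lie group has an invariant inner product on its Lie algebra. -/
theorem exists_lieAd_invariant_form [CompactSpace G] [T2Space G] :
    ∃ B : LinearMap.BilinForm ℝ (GroupLieAlgebra (𝓡 n) G),
      (∀ X Y, B X Y = B Y X) ∧ (∀ X, X ≠ 0 → 0 < B X X) ∧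
      ∀ g X Y, B (lieAd g X) (lieAd g Y) = B X Y := by
  have : IsTopologicalGroup G := topologicalGroup_of_lieGroup (𝓡 n) ∞
  let : MeasurableSpace G := borel G
  have : BorelSpace G := ⟨rfl⟩
  let μ : Measure G := Measure.haar
  let ad (X : GroupLieAlgebra (𝓡 n) G) (g : G) : EuclideanSpace ℝ (Fin n) := lieAd g⁻¹ X
  have had (X) : Continuous (ad X) := (continuous_lieAd X).comp continuous_inv
  have hadd (X Y g) : ad (X + Y) g = ad X g + ad Y g := map_add (lieAd g⁻¹) X Y
  have hsmul (c : ℝ) (X g) : ad (c • X) g = c • ad X g := map_smul (lieAd g⁻¹) c X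
  have hcont (X Y) : Continuous fun g => inner ℝ (ad X g) (ad Y g) := (had X).inner (had Y)
  have hintegrable (X Y) : Integrable (fun g => inner ℝ (ad X g) (ad Y g)) μ :=
    (hcont X Y).integrable_of_hasCompactSupport (HasCompactSupport.of_compactSpace _)
  let B : LinearMap.BilinForm ℝ (GroupLieAlgebra (𝓡 n) G) :=
    LinearMap.mk₂ ℝ (fun X Y => ∫ g, inner ℝ (ad X g) (ad Y g) ∂μ)
      (fun X Y Z => by
        simp only [hadd, inner_add_left]
        exact integral_add (hintegrable X Z) (hintegrable Y Z))
      (fun c X Y => by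
        simp only [hsmul, real_inner_smul_left]
        exact integral_const_mul _ _)
      (fun X Y Z => by
        simp only [hadd, inner_add_right]
        exact integral_add (hintegrable X Y) (hintegrable X Z))
      (fun c X Y => by
        simp only [hsmul, real_inner_smul_right]
        exact integral_const_mul _ _)
  refine ⟨B, fun X Y => ?_, fun X hX => ?_, fun h X Y => ?_⟩
  · exact integral_congr_ae (Eventually.of_forall fun g => real_inner_comm _ _)
  · refine (hcont X X).integral_pos_of_hasCompactSupport_nonneg_nonzero (x := 1)
      (HasCompactSupport.of_compactSpace _) (fun g => real_inner_self_nonneg) ?_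
    have e : ad X 1 = X := by
      simp only [ad, inv_one, lieAd_one]
      rfl
    rw [e]
    exact inner_self_ne_zero.2 hX
  -- Left translation of the variable by h⁻¹ turns Ad(g⁻¹)X into Ad(g⁻¹)Ad(h)X.
  · have h1 := integral_mul_left_eq_self (μ := μ) (fun g => inner ℝ (ad X g) (ad Y g)) h⁻¹
    refine Eq.trans ?_ h1
    refine integral_congr_ae (Eventually.of_forall fun g => ?_)
    have e (X) : ad X (h⁻¹ * g) = ad (lieAd h X) g := by
      change lieAd (h⁻¹ * g)⁻¹ X = lieAd g⁻¹ (lieAd h X)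
      rw [← lieAd_mul_apply, mul_inv_rev, inv_inv]
    simp only [e]

/-- Invariance is required only along exp(sZ): the lemma thus applies to a fully invariant form and,
for Z in 𝔱, to a merely T-invariant one. The proof differentiates at s = 0. -/
theorem lie_invariant_of_lieAd_invariant [T2Space G]
    {B : LinearMap.BilinForm ℝ (GroupLieAlgebra (𝓡 n) G)} {Z : GroupLieAlgebra (𝓡 n) G}
    (hB : ∀ s X Y, B (lieAd (oneParam Z s) X) (lieAd (oneParam Z s) Y) = B X Y)
    (X Y : GroupLieAlgebra (𝓡 n) G) :
    B ⁅Z, X⁆ Y = -B X ⁅Z, Y⁆ := by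
  let b : EuclideanSpace ℝ (Fin n) →ₗ[ℝ] EuclideanSpace ℝ (Fin n) →ₗ[ℝ] ℝ := B
  let β : EuclideanSpace ℝ (Fin n) →L[ℝ] EuclideanSpace ℝ (Fin n) →L[ℝ] ℝ :=
    LinearMap.toContinuousLinearMap
      ((LinearMap.toContinuousLinearMap : (EuclideanSpace ℝ (Fin n) →ₗ[ℝ] ℝ) ≃ₗ[ℝ] _).toLinearMap.comp b)
  have h1 := β.hasFDerivAt.comp_hasDerivAt (0 : ℝ) (hasDerivAt_lieAd_oneParam_zero Z X)
  have h2 := h1.clm_apply (hasDerivAt_lieAd_oneParam_zero Z Y)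
  have h3 : HasDerivAt (fun _ : ℝ => B X Y) 0 0 := hasDerivAt_const _ _
  have h4 := h2.unique (h3.congr_of_eventuallyEq (Eventually.of_forall fun s =>
    hB s X Y))
  have e0 (Y : GroupLieAlgebra (𝓡 n) G) : lieAd (oneParam Z 0) Y = Y := by
    rw [oneParam_zero, lieAd_one]; rfl
  have h5 : B ⁅Z, X⁆ (lieAd (oneParam Z 0) Y) + B (lieAd (oneParam Z 0) X) ⁅Z, Y⁆ = 0 := h4
  rw [e0, e0] at h5
  linarith

end InvariantInnerProduct

/-- A conjugation on a complex Lie algebra together with an invariant bilinear form whose associated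
Hermitian form is positive definite. -/
structure CompactRealForm (V : Type*) [LieRing V] [LieAlgebra ℂ V] where
  conj : V → V
  form : V →ₗ[ℂ] V →ₗ[ℂ] ℂ
  conj_add : ∀ Z W : V, conj (Z + W) = conj Z + conj W
  conj_smul : ∀ (c : ℂ) Z, conj (c • Z) = star c • conj Z
  conj_conj : ∀ Z, conj (conj Z) = Z
  conj_lie : ∀ Z W : V, conj ⁅Z, W⁆ = ⁅conj Z, conj W⁆
  form_symm : ∀ Z W, form Z W = form W Z
  form_lie : ∀ Z W U : V, form ⁅Z, W⁆ U = -form W ⁅Z, U⁆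
  form_conj : ∀ Z W, form (conj Z) (conj W) = star (form Z W)
  form_pos : ∀ Z, Z ≠ 0 → 0 < (form Z (conj Z)).re

/-- `Z` is a weight vector of weight `α` for the subspace `𝔥`. -/
def IsWeightVector {V : Type*} [LieRing V] [LieAlgebra ℂ V] (𝔥 : Submodule ℂ V)
    (α : Module.Dual ℂ 𝔥) (Z : V) : Prop :=
  ∀ H : 𝔥, ⁅(H : V), Z⁆ = α H • Z

/-! ### Root theory from a positive invariant Hermitian form. -/

section RootSpaces

variable {V : Type*} [LieRing V] [LieAlgebra ℂ V]

namespace IsWeightVector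

variable {𝔥 : Submodule ℂ V} {α β : Module.Dual ℂ 𝔥} {Z W : V}

theorem lie (hZ : IsWeightVector 𝔥 α Z) (hW : IsWeightVector 𝔥 β W) :
    IsWeightVector 𝔥 (α + β) ⁅Z, W⁆ := by
  intro H
  rw [leibniz_lie, hZ H, hW H, smul_lie, lie_smul, LinearMap.add_apply, add_smul]

theorem add (hZ : IsWeightVector 𝔥 α Z) (hW : IsWeightVector 𝔥 α W) :
    IsWeightVector 𝔥 α (Z + W) := by
  intro H
  rw [lie_add, hZ H, hW H, smul_add]

theorem smul (c : ℂ) (hZ : IsWeightVector 𝔥 α Z) : IsWeightVector 𝔥 α (c • Z) := by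
  intro H
  rw [lie_smul, hZ H, smul_comm]

theorem neg (hZ : IsWeightVector 𝔥 α Z) : IsWeightVector 𝔥 α (-Z) := by
  simpa using hZ.smul (-1)

theorem sub (hZ : IsWeightVector 𝔥 α Z) (hW : IsWeightVector 𝔥 α W) :
    IsWeightVector 𝔥 α (Z - W) := by
  rw [sub_eq_add_neg]
  exact hZ.add hW.neg

theorem eq_zero_of_ne (hZ : IsWeightVector 𝔥 α Z) (hZ' : IsWeightVector 𝔥 β Z) (h : α ≠ β) :
    Z = 0 := by
  by_contra hne
  refine h (LinearMap.ext fun H => ?_)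
  have h1 := (hZ H).symm.trans (hZ' H)
  exact smul_left_injective ℂ hne h1

end IsWeightVector

namespace CompactRealForm

variable (C : CompactRealForm V)

theorem conj_zero : C.conj 0 = 0 := by
  have := C.conj_smul 0 0
  simpa using this

theorem conj_neg (Z : V) : C.conj (-Z) = -C.conj Z := by
  have := C.conj_smul (-1) Z
  simpa using this

theorem conj_eq_zero_iff {Z : V} : C.conj Z = 0 ↔ Z = 0 := by
  constructor
  · intro h
    rw [← C.conj_conj Z, h, C.conj_zero]
  · rintro rfl
    exact C.conj_zero

/-- The squared norm of the associated Hermitian form. -/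
def normSq (Z : V) : ℝ := (C.form Z (C.conj Z)).re

theorem form_conj_self (Z : V) : C.form Z (C.conj Z) = (C.normSq Z : ℂ) := by
  have h := C.form_conj Z (C.conj Z)
  rw [C.conj_conj, C.form_symm] at h
  exact (Complex.conj_eq_iff_re.1 h.symm).symm

theorem normSq_pos {Z : V} (h : Z ≠ 0) : 0 < C.normSq Z := C.form_pos Z h

theorem normSq_nonneg (Z : V) : 0 ≤ C.normSq Z := by
  by_cases h : Z = 0
  · simp [h, normSq]
  · exact (C.normSq_pos h).le

theorem eq_zero_of_form_conj_self {Z : V} (h : C.form Z (C.conj Z) = 0) : Z = 0 := by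
  by_contra hne
  have := C.form_pos Z hne
  rw [h] at this
  simp at this

theorem form_lie_conj (E Z W : V) :
    C.form ⁅E, Z⁆ (C.conj W) = -C.form Z (C.conj ⁅C.conj E, W⁆) := by
  rw [C.form_lie, C.conj_lie, C.conj_conj]

variable {C} {𝔥 : Submodule ℂ V} {α β : Module.Dual ℂ 𝔥} {E F Z W : V}

/-- The adjoint of ad H is -ad(conj H); compare both on the eigenvector Z. -/
theorem apply_conj (hZ : IsWeightVector 𝔥 α Z) (h0 : Z ≠ 0) (H : 𝔥) (H' : 𝔥)
    (hH : (H' : V) = C.conj H) : α H' = -star (α H) := by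
  have h1 := C.form_lie_conj H Z Z
  rw [← hH, hZ H, hZ H', C.conj_smul, map_smul, map_smul, LinearMap.smul_apply, C.form_conj_self,
    smul_eq_mul, smul_eq_mul, ← neg_mul] at h1
  have h2 : (C.normSq Z : ℂ) ≠ 0 := by exact_mod_cast (C.normSq_pos h0).ne'
  have h3 := mul_right_cancel₀ h2 h1
  rw [h3, star_neg, star_star, neg_neg]

theorem isWeightVector_conj (h𝔥 : ∀ H ∈ 𝔥, C.conj H ∈ 𝔥) (hZ : IsWeightVector 𝔥 α Z) :
    IsWeightVector 𝔥 (-α) (C.conj Z) := by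
  intro H
  by_cases h0 : Z = 0
  · simp [h0, C.conj_zero]
  let H' : 𝔥 := ⟨C.conj H, h𝔥 H H.2⟩
  have h1 := apply_conj hZ h0 H H' rfl
  have h2 : ⁅(H : V), C.conj Z⁆ = C.conj ⁅(H' : V), Z⁆ := by
    rw [C.conj_lie, C.conj_conj]
  rw [h2, hZ H', C.conj_smul, h1, star_neg, star_star, LinearMap.neg_apply]

/-- By invariance of the form, ad H may act on either factor, so a nonzero value would force equal
weights. -/
theorem form_conj_eq_zero (h𝔥 : ∀ H ∈ 𝔥, C.conj H ∈ 𝔥) (hZ : IsWeightVector 𝔥 α Z)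
    (hW : IsWeightVector 𝔥 β W) (h : α ≠ β) : C.form Z (C.conj W) = 0 := by
  by_contra hne
  refine h (LinearMap.ext fun H => ?_)
  have h1 := C.form_lie H Z (C.conj W)
  rw [hZ H, isWeightVector_conj h𝔥 hW H, map_smul, map_smul, LinearMap.smul_apply,
    LinearMap.neg_apply, neg_smul, neg_neg, smul_eq_mul, smul_eq_mul] at h1
  exact mul_right_cancel₀ hne h1

theorem lie_conj_self_mem (h𝔥 : ∀ H ∈ 𝔥, C.conj H ∈ 𝔥)
    (hcent : ∀ Z, IsWeightVector 𝔥 0 Z → Z ∈ 𝔥) (hE : IsWeightVector 𝔥 α E) :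
    (⁅C.conj E, E⁆ : V) ∈ 𝔥 := by
  refine hcent _ ?_
  have := (isWeightVector_conj h𝔥 hE).lie hE
  rwa [neg_add_cancel] at this

/-- The element h = [conj E, E] plays the role of a coroot. Pair [h, F] with F: by the Jacobi
identity only -[E, [conj E, F]] survives, and -ad E is the adjoint of ad(conj E), so a squared norm
appears. -/
theorem apply_coroot_of_lie_eq_zero (hF : IsWeightVector 𝔥 β F) (h0 : F ≠ 0) (hEF : ⁅E, F⁆ = 0)
    {h : 𝔥} (hh : (h : V) = ⁅C.conj E, E⁆) :
    β h = ((C.normSq ⁅C.conj E, F⁆ / C.normSq F : ℝ) : ℂ) := by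
  have hN : (C.normSq F : ℂ) ≠ 0 := by exact_mod_cast (C.normSq_pos h0).ne'
  have h1 : C.form ⁅(h : V), F⁆ (C.conj F) = (C.normSq ⁅C.conj E, F⁆ : ℂ) := by
    rw [hh, lie_lie, hEF, lie_zero, zero_sub, map_neg, LinearMap.neg_apply, C.form_lie_conj,
      neg_neg, C.form_conj_self]
  rw [hF h, map_smul, LinearMap.smul_apply, C.form_conj_self, smul_eq_mul] at h1
  push_cast
  rw [eq_div_iff hN, h1]

/-- The lowest-weight counterpart of `apply_coroot_of_lie_eq_zero`; the value now has the opposite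
sign. -/
theorem apply_coroot_of_conj_lie_eq_zero (hW : IsWeightVector 𝔥 β W) (h0 : W ≠ 0)
    (hEW : ⁅C.conj E, W⁆ = 0) {h : 𝔥} (hh : (h : V) = ⁅C.conj E, E⁆) :
    β h = ((-(C.normSq ⁅E, W⁆ / C.normSq W) : ℝ) : ℂ) := by
  have hN : (C.normSq W : ℂ) ≠ 0 := by exact_mod_cast (C.normSq_pos h0).ne'
  have h1 : C.form ⁅(h : V), W⁆ (C.conj W) = -(C.normSq ⁅E, W⁆ : ℂ) := by
    rw [hh, lie_lie, hEW, lie_zero, sub_zero, C.form_lie_conj, C.conj_conj, C.form_conj_self]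
  rw [hW h, map_smul, LinearMap.smul_apply, C.form_conj_self, smul_eq_mul] at h1
  push_cast
  rw [← neg_div, eq_div_iff hN, h1]

/-- Pairing [conj E, E] with H gives -α(H)‖E‖², so its vanishing would make α zero. -/
theorem lie_conj_self_ne_zero (h𝔥 : ∀ H ∈ 𝔥, C.conj H ∈ 𝔥) (hE : IsWeightVector 𝔥 α E)
    (h0 : E ≠ 0) (hα : α ≠ 0) : (⁅C.conj E, E⁆ : V) ≠ 0 := by
  intro hz
  refine hα (LinearMap.ext fun H => ?_)
  have hN : (C.normSq E : ℂ) ≠ 0 := by exact_mod_cast (C.normSq_pos h0).ne'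
  have h2 : C.form ⁅C.conj E, E⁆ (H : V) = -(α H * C.form E (C.conj E)) := by
    rw [C.form_lie, ← lie_skew, isWeightVector_conj h𝔥 hE H]
    simp
  rw [hz, C.form_conj_self] at h2
  simpa [hN] using h2.symm

theorem apply_coroot_self_pos (h𝔥 : ∀ H ∈ 𝔥, C.conj H ∈ 𝔥) (hE : IsWeightVector 𝔥 α E)
    (h0 : E ≠ 0) (hα : α ≠ 0) {h : 𝔥} (hh : (h : V) = ⁅C.conj E, E⁆) : 0 < (α h).re := by
  rw [apply_coroot_of_lie_eq_zero hE h0 (lie_self E) hh, Complex.ofReal_re]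
  have := C.normSq_pos h0
  have := C.normSq_pos (lie_conj_self_ne_zero h𝔥 hE h0 hα)
  positivity

/-- Root spaces are one-dimensional. -/
theorem exists_eq_smul (h𝔥 : ∀ H ∈ 𝔥, C.conj H ∈ 𝔥) (hcent : ∀ Z, IsWeightVector 𝔥 0 Z → Z ∈ 𝔥)
    (hα : α ≠ 0) (hE : IsWeightVector 𝔥 α E) (h0 : E ≠ 0) (hF : IsWeightVector 𝔥 α F) :
    ∃ c : ℂ, F = c • E := by
  have hN : (C.normSq E : ℂ) ≠ 0 := by exact_mod_cast (C.normSq_pos h0).ne'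
  -- A vector F of weight α orthogonal to E vanishes. Indeed [conj E, F] lies in 𝔥, so bracketing it
  -- with E gives a multiple of E, orthogonal to F; hence [conj E, F] = 0. A nonzero F would then
  -- give α(h) ≤ 0, against α(h) > 0.
  have key (F : V) (hF : IsWeightVector 𝔥 α F) (hFE : C.form F (C.conj E) = 0) : F = 0 := by
    by_contra hF0
    have hmem : (⁅C.conj E, F⁆ : V) ∈ 𝔥 := by
      refine hcent _ ?_
      have := (isWeightVector_conj h𝔥 hE).lie hF
      rwa [neg_add_cancel] at this
    have hz : ⁅C.conj E, F⁆ = 0 := by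
      refine C.eq_zero_of_form_conj_self ?_
      rw [C.form_lie_conj, C.conj_conj, ← lie_skew, hE ⟨_, hmem⟩, C.conj_neg, C.conj_smul, map_neg,
        map_smul, hFE]
      simp
    have h1 := apply_coroot_of_conj_lie_eq_zero hF hF0 hz
      (h := ⟨_, lie_conj_self_mem h𝔥 hcent hE⟩) rfl
    have h2 := apply_coroot_self_pos h𝔥 hE h0 hα (h := ⟨_, lie_conj_self_mem h𝔥 hcent hE⟩) rfl
    rw [h1, Complex.ofReal_re] at h2
    have h3 := C.normSq_pos hF0
    have h4 := C.normSq_nonneg ⁅E, F⁆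
    have h5 : 0 ≤ C.normSq ⁅E, F⁆ / C.normSq F := by positivity
    linarith
  refine ⟨C.form F (C.conj E) / C.normSq E, sub_eq_zero.1 (key _ (hF.sub (hE.smul _)) ?_)⟩
  rw [map_sub, LinearMap.sub_apply, map_smul, LinearMap.smul_apply, C.form_conj_self, smul_eq_mul,
    div_mul_cancel₀ _ hN, sub_self]

/-- The bracket of root vectors vanishes only if the sum of the roots is not a root. -/
theorem eq_zero_of_lie_eq_zero (h𝔥 : ∀ H ∈ 𝔥, C.conj H ∈ 𝔥)
    (hcent : ∀ Z, IsWeightVector 𝔥 0 Z → Z ∈ 𝔥)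
    (hα : α ≠ 0) (hβ : β ≠ 0) (hE : IsWeightVector 𝔥 α E) (hE0 : E ≠ 0)
    (hF : IsWeightVector 𝔥 β F) (hF0 : F ≠ 0) (hEF : ⁅E, F⁆ = 0)
    (hW : IsWeightVector 𝔥 (α + β) W) : W = 0 := by
  by_contra hW0
  have hkW : IsWeightVector 𝔥 β ⁅C.conj E, W⁆ := by
    have := (isWeightVector_conj h𝔥 hE).lie hW
    rwa [neg_add_cancel_left] at this
  obtain ⟨c, hc⟩ := exists_eq_smul h𝔥 hcent hβ hF hF0 hkW
  -- The vector [conj E, W] has weight β, hence is a multiple of F and is killed by ad E. Its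
  -- squared norm, moved through the adjoint, is therefore zero.
  have hz : ⁅C.conj E, W⁆ = 0 := by
    refine C.eq_zero_of_form_conj_self ?_
    rw [C.form_lie_conj, C.conj_conj, hc, lie_smul, hEF, smul_zero, C.conj_zero, map_zero, neg_zero]
  -- Now (α+β)(h) ≤ 0, whereas α(h) > 0 and β(h) ≥ 0.
  have h1 := apply_coroot_of_conj_lie_eq_zero hW hW0 hz
    (h := ⟨_, lie_conj_self_mem h𝔥 hcent hE⟩) rfl
  have h2 := apply_coroot_self_pos h𝔥 hE hE0 hα (h := ⟨_, lie_conj_self_mem h𝔥 hcent hE⟩) rfl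
  have h3 := apply_coroot_of_lie_eq_zero hF hF0 hEF (h := ⟨_, lie_conj_self_mem h𝔥 hcent hE⟩) rfl
  have h4 := congrArg Complex.re h1
  rw [LinearMap.add_apply, Complex.add_re, h3, Complex.ofReal_re, Complex.ofReal_re] at h4
  have h5 : 0 ≤ C.normSq ⁅E, W⁆ / C.normSq W := div_nonneg (C.normSq_nonneg _) (C.normSq_nonneg _)
  have h6 : 0 ≤ C.normSq ⁅C.conj E, F⁆ / C.normSq F :=
    div_nonneg (C.normSq_nonneg _) (C.normSq_nonneg _)
  linarith

/-- If each `e i + e (bar i)` commutes with the sum of all the weight vectors, then weight vectors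
whose weights are not opposite commute. -/
theorem lie_eq_zero_of_sum_lie_eq_zero [FiniteDimensional ℂ V] (h𝔥 : ∀ H ∈ 𝔥, C.conj H ∈ 𝔥)
    {ι : Type*} [Fintype ι] {e : ι → V} {γ : ι → Module.Dual ℂ 𝔥} {bar : ι → ι}
    (hγ : Function.Injective γ) (hbar : ∀ i, γ (bar i) = -γ i)
    (he : ∀ i, IsWeightVector 𝔥 (γ i) (e i))
    (hsum : ∀ i, ⁅∑ j, e j, e i + e (bar i)⁆ = 0) {i j : ι} (hij : j ≠ bar i) : ⁅e j, e i⁆ = 0 := by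
  classical
  have hbb (i) : bar (bar i) = i := hγ (by rw [hbar, hbar, neg_neg])
  let b := Module.finBasis ℂ 𝔥
  -- All that matters about q is that it is definite and satisfies the parallelogram law.
  let q : Module.Dual ℂ 𝔥 → ℝ := fun α => ∑ k, ‖α (b k)‖ ^ 2
  have hq0 (α) (h : q α ≤ 0) : α = 0 := by
    have h1 : q α = 0 := le_antisymm h (Finset.sum_nonneg fun k _ => sq_nonneg _)
    rw [Finset.sum_eq_zero_iff_of_nonneg fun k _ => sq_nonneg _] at h1
    refine b.ext fun k => ?_
    simpa using h1 k (Finset.mem_univ k)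
  have hpar (α β) : q (α + β) + q (α - β) = 2 * (q α + q β) := by
    simp only [q, ← Finset.sum_add_distrib, Finset.mul_sum]
    refine Finset.sum_congr rfl fun k _ => ?_
    have := parallelogram_law_with_norm ℂ (α (b k)) (β (b k))
    simp only [LinearMap.add_apply, LinearMap.sub_apply]
    nlinarith
  by_contra hne
  let S : Finset ι := Finset.univ.filter fun i => ∃ j, j ≠ bar i ∧ ⁅e j, e i⁆ ≠ 0
  have hS : S.Nonempty := ⟨i, by simp only [S, Finset.mem_filter, Finset.mem_univ, true_and]
                                 exact ⟨j, hij, hne⟩⟩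
  -- Among the indices with a nonzero bracket against a non-opposite vector, take one of maximal
  -- length.
  obtain ⟨i₀, hi₀, hmax⟩ := S.exists_max_image (fun i => q (γ i)) hS
  simp only [S, Finset.mem_filter, Finset.mem_univ, true_and] at hi₀ hmax
  obtain ⟨j₀, hj₀, hu⟩ := hi₀
  set u : V := ⁅e j₀, e i₀⁆ with hu_def
  have huw : IsWeightVector 𝔥 (γ j₀ + γ i₀) u := (he j₀).lie (he i₀)
  -- Pair the relation for i₀ with conj u, where u = [e j₀, e i₀]. By injectivity of γ the first sum
  -- contributes ‖u‖² alone, so some term of the second sum must cancel it.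
  have h1 : ∑ k, C.form ⁅e k, e i₀⁆ (C.conj u) + ∑ k, C.form ⁅e k, e (bar i₀)⁆ (C.conj u) = 0 := by
    have h := hsum i₀
    rw [lie_add, sum_lie, sum_lie] at h
    have := congrArg (fun Z => C.form Z (C.conj u)) h
    simpa [map_add, map_sum, LinearMap.sum_apply] using this
  have h2 : ∑ k, C.form ⁅e k, e i₀⁆ (C.conj u) = (C.normSq u : ℂ) := by
    rw [Finset.sum_eq_single j₀, ← hu_def, C.form_conj_self]
    · intro k _ hk
      refine form_conj_eq_zero h𝔥 ((he k).lie (he i₀)) huw fun h => hk (hγ ?_)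
      exact add_right_cancel h
    · simp
  have h3 : ∃ k, C.form ⁅e k, e (bar i₀)⁆ (C.conj u) ≠ 0 := by
    by_contra! hall
    rw [h2, Finset.sum_eq_zero fun k _ => hall k, add_zero] at h1
    have : C.normSq u = 0 := by exact_mod_cast h1
    exact (C.normSq_pos hu).ne' this
  obtain ⟨k, hk⟩ := h3
  have hk0 : ⁅e k, e (bar i₀)⁆ ≠ 0 := by
    intro h
    rw [h] at hk
    simp at hk
  -- The cancelling term has the weight of u, which gives γ k = γ j₀ + 2 γ i₀.
  have hkγ : γ k + -γ i₀ = γ j₀ + γ i₀ := by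
    by_contra h
    rw [← hbar] at h
    exact hk (form_conj_eq_zero h𝔥 ((he k).lie (he (bar i₀))) huw h)
  have hki : k ≠ i₀ := by
    rintro rfl
    refine hj₀ (hγ ?_)
    rw [hbar, eq_neg_iff_add_eq_zero, ← hkγ, add_neg_cancel]
  have hkS := hmax k ⟨bar i₀, fun h => hki (by rw [← hbb k, ← h, hbb]), by
    rw [← lie_skew]; exact neg_ne_zero.2 hk0⟩
  have hjS := hmax j₀ ⟨i₀, fun h => hj₀ (by rw [h, hbb]), by
    rw [← lie_skew]; exact neg_ne_zero.2 hu⟩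
  -- With center γ j₀ + γ i₀ and half-difference γ i₀, the law gives q(γ k) + q(γ j₀) = 2 q(γ j₀ + γ
  -- i₀) + 2 q(γ i₀). Both terms on the left are at most q(γ i₀), so the center is zero and j₀ is
  -- opposite to i₀.
  have h4 := hpar (γ j₀ + γ i₀) (γ i₀)
  rw [add_sub_cancel_right] at h4
  have h5 : γ j₀ + γ i₀ + γ i₀ = γ k := by rw [← hkγ]; abel
  rw [h5] at h4
  have h6 := hq0 (γ j₀ + γ i₀) (by linarith)
  exact hj₀ (hγ (by rw [hbar, eq_neg_iff_add_eq_zero, h6]))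

end CompactRealForm

end RootSpaces

/-! ### The complexification, its conjugation and the extended form. -/

section Complexification

variable {𝔤 : Type*} [LieRing 𝔤] [LieAlgebra ℝ 𝔤]

theorem tensor_lie_add (Z W U : ℂ ⊗[ℝ] 𝔤) : ⁅Z, W + U⁆ = ⁅Z, W⁆ + ⁅Z, U⁆ := lie_add Z W U

theorem tensor_lie_zero (Z : ℂ ⊗[ℝ] 𝔤) : ⁅Z, (0 : ℂ ⊗[ℝ] 𝔤)⁆ = 0 := lie_zero Z

theorem tensor_smul_lie (c : ℂ) (Z W : ℂ ⊗[ℝ] 𝔤) : ⁅c • Z, W⁆ = c • ⁅Z, W⁆ := smul_lie c Z W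

theorem exists_eq_one_tmul_add_I_tmul (Z : ℂ ⊗[ℝ] 𝔤) :
    ∃ X Y : 𝔤, Z = (1 : ℂ) ⊗ₜ[ℝ] X + Complex.I ⊗ₜ[ℝ] Y := by
  induction Z using TensorProduct.induction_on with
  | zero => exact ⟨0, 0, by simp⟩
  | tmul c X =>
    refine ⟨c.re • X, c.im • X, ?_⟩
    rw [← TensorProduct.smul_tmul, ← TensorProduct.smul_tmul, ← TensorProduct.add_tmul]
    congr 1
    apply Complex.ext <;> simp
  | add Z W hZ hW =>
    obtain ⟨X, Y, rfl⟩ := hZ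
    obtain ⟨X', Y', rfl⟩ := hW
    refine ⟨X + X', Y + Y', ?_⟩
    rw [TensorProduct.tmul_add, TensorProduct.tmul_add]
    abel

variable (𝔤) in
/-- The conjugation of `ℂ ⊗ 𝔤` with respect to `𝔤`. -/
def complexConj : ℂ ⊗[ℝ] 𝔤 →ₗ[ℝ] ℂ ⊗[ℝ] 𝔤 :=
  LinearMap.rTensor 𝔤 Complex.conjAe.toLinearMap

theorem complexConj_tmul (c : ℂ) (X : 𝔤) : complexConj 𝔤 (c ⊗ₜ X) = star c ⊗ₜ X := rfl

theorem complexConj_smul (c : ℂ) (Z : ℂ ⊗[ℝ] 𝔤) :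
    complexConj 𝔤 (c • Z) = star c • complexConj 𝔤 Z := by
  induction Z using TensorProduct.induction_on with
  | zero => simp
  | tmul d X =>
    rw [TensorProduct.smul_tmul', complexConj_tmul, complexConj_tmul, TensorProduct.smul_tmul',
      smul_eq_mul, smul_eq_mul, star_mul']
  | add Z W hZ hW => rw [smul_add, map_add, map_add, smul_add, hZ, hW]

theorem complexConj_complexConj (Z : ℂ ⊗[ℝ] 𝔤) : complexConj 𝔤 (complexConj 𝔤 Z) = Z := by
  induction Z using TensorProduct.induction_on with
  | zero => simp
  | tmul d X => rw [complexConj_tmul, complexConj_tmul, star_star]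
  | add Z W hZ hW => rw [map_add, map_add, hZ, hW]

theorem complexConj_lie (Z W : ℂ ⊗[ℝ] 𝔤) :
    complexConj 𝔤 ⁅Z, W⁆ = ⁅complexConj 𝔤 Z, complexConj 𝔤 W⁆ := by
  induction Z using TensorProduct.induction_on with
  | zero => simp
  | tmul c X =>
    induction W using TensorProduct.induction_on with
    | zero => rw [tensor_lie_zero, map_zero, tensor_lie_zero]
    | tmul d Y =>
      rw [LieAlgebra.ExtendScalars.bracket_tmul, complexConj_tmul, complexConj_tmul,
        complexConj_tmul, LieAlgebra.ExtendScalars.bracket_tmul, star_mul']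
    | add Z W hZ hW => rw [tensor_lie_add, map_add, map_add, tensor_lie_add, hZ, hW]
  | add Z W hZ hW => rw [add_lie, map_add, map_add, add_lie, hZ, hW]

variable {B : LinearMap.BilinForm ℝ 𝔤}

theorem baseChange_form_conj (Z W : ℂ ⊗[ℝ] 𝔤) :
    B.baseChange ℂ (complexConj 𝔤 Z) (complexConj 𝔤 W) = star (B.baseChange ℂ Z W) := by
  induction Z using TensorProduct.induction_on with
  | zero => simp
  | tmul c X =>
    induction W using TensorProduct.induction_on with
    | zero => simp
    | tmul d Y =>
      simp only [complexConj_tmul, LinearMap.BilinForm.baseChange_tmul]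
      simp
    | add Z W hZ hW => rw [map_add, map_add, map_add, hZ, hW, star_add]
  | add Z W hZ hW =>
    rw [map_add, map_add, map_add, LinearMap.add_apply, LinearMap.add_apply, hZ, hW, star_add]

theorem baseChange_form_lie (hB : ∀ Z X Y : 𝔤, B ⁅Z, X⁆ Y = -B X ⁅Z, Y⁆) (Z W U : ℂ ⊗[ℝ] 𝔤) :
    B.baseChange ℂ ⁅Z, W⁆ U = -B.baseChange ℂ W ⁅Z, U⁆ := by
  induction Z using TensorProduct.induction_on with
  | zero => simp
  | tmul c X =>
    induction W using TensorProduct.induction_on with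
    | zero => rw [tensor_lie_zero]; simp
    | tmul d Y =>
      induction U using TensorProduct.induction_on with
      | zero => rw [tensor_lie_zero]; simp
      | tmul f Y' =>
        simp only [LieAlgebra.ExtendScalars.bracket_tmul, LinearMap.BilinForm.baseChange_tmul, hB]
        rw [neg_smul, mul_comm c d, mul_assoc]
      | add Z W hZ hW => rw [map_add, tensor_lie_add, map_add, hZ, hW, neg_add]
    | add Z W hZ hW =>
      rw [tensor_lie_add, map_add, map_add, LinearMap.add_apply, LinearMap.add_apply, hZ, hW, neg_add]
  | add Z W hZ hW =>
    rw [add_lie, add_lie, map_add, map_add, LinearMap.add_apply, hZ, hW, neg_add]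

theorem baseChange_form_conj_self (hsymm : ∀ X Y, B X Y = B Y X) (X Y : 𝔤) :
    B.baseChange ℂ ((1 : ℂ) ⊗ₜ[ℝ] X + Complex.I ⊗ₜ[ℝ] Y)
      (complexConj 𝔤 ((1 : ℂ) ⊗ₜ[ℝ] X + Complex.I ⊗ₜ[ℝ] Y)) = ((B X X + B Y Y : ℝ) : ℂ) := by
  simp only [map_add, complexConj_tmul, LinearMap.add_apply, LinearMap.BilinForm.baseChange_tmul,
    hsymm Y X]
  apply Complex.ext <;> simp

/-- `B` is an inner product for which the operators `ad Z` are skew-symmetric. -/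
structure IsInvariantInnerProduct (B : LinearMap.BilinForm ℝ 𝔤) : Prop where
  symm : ∀ X Y, B X Y = B Y X
  pos : ∀ X, X ≠ 0 → 0 < B X X
  lie : ∀ Z X Y : 𝔤, B ⁅Z, X⁆ Y = -B X ⁅Z, Y⁆

/-- The compact real form of the complexification of a Lie algebra with an invariant inner
product. -/
def compactRealForm (hB : IsInvariantInnerProduct B) : CompactRealForm (ℂ ⊗[ℝ] 𝔤) where
  conj := complexConj 𝔤
  form := B.baseChange ℂ
  conj_add := map_add _
  conj_smul := complexConj_smul
  conj_conj := complexConj_complexConj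
  conj_lie := complexConj_lie
  form_symm := (LinearMap.BilinForm.IsSymm.baseChange ℂ ⟨hB.symm⟩).eq
  form_lie := baseChange_form_lie hB.lie
  form_conj := baseChange_form_conj
  form_pos := by
    intro Z hZ
    obtain ⟨X, Y, rfl⟩ := exists_eq_one_tmul_add_I_tmul Z
    rw [baseChange_form_conj_self hB.symm, Complex.ofReal_re]
    have hnn (X : 𝔤) : 0 ≤ B X X := by
      by_cases h : X = 0
      · simp [h]
      · exact (hB.pos X h).le
    by_cases hX : X = 0
    · have hY : Y ≠ 0 := by
        rintro rfl
        simp [hX] at hZ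
      have := hB.pos Y hY
      have := hnn X
      linarith
    · have := hB.pos X hX
      have := hnn Y
      linarith

theorem one_tmul_injective : Function.Injective (fun X : 𝔤 => (1 : ℂ) ⊗ₜ[ℝ] X) :=
  Module.FaithfullyFlat.tensorProduct_mk_injective (A := ℝ) (B := ℂ) 𝔤

variable {𝔱 : Submodule ℝ 𝔤}

/-- The complexified subspace is spanned over ℂ by the vectors 1 ⊗ H, so complex-linear conditions
need checking only there. -/
theorem baseChange_induction {P : ℂ ⊗[ℝ] 𝔤 → Prop} (h0 : P 0) (hadd : ∀ Z W, P Z → P W → P (Z + W))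
    (hsmul : ∀ (c : ℂ) Z, P Z → P (c • Z)) (hone : ∀ H ∈ 𝔱, P ((1 : ℂ) ⊗ₜ[ℝ] H)) {Z : ℂ ⊗[ℝ] 𝔤}
    (hZ : Z ∈ 𝔱.baseChange ℂ) : P Z := by
  rw [Submodule.baseChange_eq_span] at hZ
  induction hZ using Submodule.span_induction with
  | mem Z h =>
    obtain ⟨H, hH, rfl⟩ := h
    exact hone H hH
  | zero => exact h0
  | add Z W _ _ hZ hW => exact hadd Z W hZ hW
  | smul c Z _ hZ => exact hsmul c Z hZ

theorem complexConj_mem_baseChange (Z : ℂ ⊗[ℝ] 𝔤) (hZ : Z ∈ 𝔱.baseChange ℂ) :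
    complexConj 𝔤 Z ∈ 𝔱.baseChange ℂ := by
  refine baseChange_induction (P := fun Z => complexConj 𝔤 Z ∈ 𝔱.baseChange ℂ) ?_ ?_ ?_ ?_ hZ
  · rw [map_zero]; exact Submodule.zero_mem _
  · intro Z W hZ hW
    rw [map_add]; exact Submodule.add_mem _ hZ hW
  · intro c Z hZ
    rw [complexConj_smul]; exact Submodule.smul_mem _ _ hZ
  · intro H hH
    rw [complexConj_tmul, star_one]
    exact Submodule.tmul_mem_baseChange_of_mem _ hH

/-- Adding the conjugate equation isolates X; multiplying the rest by -i isolates Y. -/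
theorem one_tmul_add_I_tmul_eq_zero {X Y : 𝔤}
    (h : (1 : ℂ) ⊗ₜ[ℝ] X + Complex.I ⊗ₜ[ℝ] Y = 0) : X = 0 ∧ Y = 0 := by
  have h1 := congrArg (complexConj 𝔤) h
  rw [map_add, complexConj_tmul, complexConj_tmul, map_zero, star_one] at h1
  have hI : (star Complex.I) = -Complex.I := Complex.conj_I
  rw [hI, TensorProduct.neg_tmul] at h1
  have hX : (1 : ℂ) ⊗ₜ[ℝ] ((2 : ℝ) • X) = (1 : ℂ) ⊗ₜ[ℝ] (0 : 𝔤) := by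
    rw [TensorProduct.tmul_zero, two_smul, TensorProduct.tmul_add]
    have := congrArg₂ (· + ·) h h1
    simp only [add_zero] at this
    rw [← this]
    abel
  have hX0 : X = 0 := by simpa using one_tmul_injective hX
  refine ⟨hX0, ?_⟩
  rw [hX0, TensorProduct.tmul_zero, zero_add] at h
  have h2 := congrArg (fun Z => -Complex.I • Z) h
  simp only [TensorProduct.smul_tmul', smul_zero, smul_eq_mul, neg_mul, Complex.I_mul_I,
    neg_neg] at h2
  exact one_tmul_injective (h2.trans (TensorProduct.tmul_zero 𝔤 (1 : ℂ)).symm)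

/-- The complexification of a self-centralizing subspace is self-centralizing. -/
theorem mem_baseChange_of_isWeightVector_zero
    (hcent : ∀ Z, (∀ H ∈ 𝔱, ⁅H, Z⁆ = 0) → Z ∈ 𝔱) (Z : ℂ ⊗[ℝ] 𝔤)
    (hZ : IsWeightVector (𝔱.baseChange ℂ) 0 Z) : Z ∈ 𝔱.baseChange ℂ := by
  obtain ⟨X, Y, rfl⟩ := exists_eq_one_tmul_add_I_tmul Z
  have h1 : ∀ H ∈ 𝔱, ⁅H, X⁆ = 0 ∧ ⁅H, Y⁆ = 0 := by
    intro H hH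
    have h := hZ ⟨_, Submodule.tmul_mem_baseChange_of_mem (1 : ℂ) hH⟩
    rw [LinearMap.zero_apply, zero_smul, lie_add, LieAlgebra.ExtendScalars.bracket_tmul,
      LieAlgebra.ExtendScalars.bracket_tmul, one_mul, one_mul] at h
    exact one_tmul_add_I_tmul_eq_zero h
  exact Submodule.add_mem _
    (Submodule.tmul_mem_baseChange_of_mem _ (hcent X fun H hH => (h1 H hH).1))
    (Submodule.tmul_mem_baseChange_of_mem _ (hcent Y fun H hH => (h1 H hH).2))

/-- Operators commuting with `𝔱` preserve weight vectors. -/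
theorem IsWeightVector.baseChange {A : 𝔤 →ₗ[ℝ] 𝔤} (hA : ∀ H ∈ 𝔱, ∀ Y, A ⁅H, Y⁆ = ⁅H, A Y⁆)
    {α : Module.Dual ℂ (𝔱.baseChange ℂ)} {Z : ℂ ⊗[ℝ] 𝔤}
    (hZ : IsWeightVector (𝔱.baseChange ℂ) α Z) :
    IsWeightVector (𝔱.baseChange ℂ) α (A.baseChange ℂ Z) := by
  intro H
  have key : ∀ Z, A.baseChange ℂ ⁅(H : ℂ ⊗[ℝ] 𝔤), Z⁆ = ⁅(H : ℂ ⊗[ℝ] 𝔤), A.baseChange ℂ Z⁆ := by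
    refine baseChange_induction (P := fun H => ∀ Z, A.baseChange ℂ ⁅H, Z⁆ = ⁅H, A.baseChange ℂ Z⁆)
      ?_ ?_ ?_ ?_ H.2
    · intro Z; simp
    · intro H H' hH hH' Z
      rw [add_lie, map_add, hH, hH', add_lie]
    · intro c H hH Z
      rw [tensor_smul_lie, map_smul, hH, tensor_smul_lie]
    · intro H hH Z
      induction Z using TensorProduct.induction_on with
      | zero => rw [tensor_lie_zero, map_zero, tensor_lie_zero]
      | tmul c Y =>
        rw [LieAlgebra.ExtendScalars.bracket_tmul, LinearMap.baseChange_tmul,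
          LinearMap.baseChange_tmul, LieAlgebra.ExtendScalars.bracket_tmul, hA H hH]
      | add Z W hZ hW => rw [tensor_lie_add, map_add, map_add, tensor_lie_add, hZ, hW]
  rw [← key, hZ H, map_smul]

theorem complexConj_baseChange (A : 𝔤 →ₗ[ℝ] 𝔤) (Z : ℂ ⊗[ℝ] 𝔤) :
    complexConj 𝔤 (A.baseChange ℂ Z) = A.baseChange ℂ (complexConj 𝔤 Z) := by
  induction Z using TensorProduct.induction_on with
  | zero => simp
  | tmul c Y =>
    rw [LinearMap.baseChange_tmul, complexConj_tmul, complexConj_tmul, LinearMap.baseChange_tmul]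
  | add Z W hZ hW => rw [map_add, map_add, map_add, map_add, hZ, hW]

theorem baseChange_form_symm_op {A : 𝔤 →ₗ[ℝ] 𝔤} (hA : ∀ X Y, B (A X) Y = B X (A Y))
    (Z W : ℂ ⊗[ℝ] 𝔤) :
    B.baseChange ℂ (A.baseChange ℂ Z) W = B.baseChange ℂ Z (A.baseChange ℂ W) := by
  induction Z using TensorProduct.induction_on with
  | zero => simp
  | tmul c X =>
    induction W using TensorProduct.induction_on with
    | zero => simp
    | tmul d Y =>
      simp only [LinearMap.baseChange_tmul, LinearMap.BilinForm.baseChange_tmul, hA]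
    | add Z W hZ hW => rw [map_add, map_add, map_add, hZ, hW]
  | add Z W hZ hW =>
    rw [map_add, map_add, map_add, LinearMap.add_apply, LinearMap.add_apply, hZ, hW]

end Complexification

/-! ### Orthogonal projections for a positive definite form. -/

section OrthogonalProjection

variable {V : Type*} [AddCommGroup V] [Module ℝ V]

theorem eq_of_forall_form_eq {B : LinearMap.BilinForm ℝ V} (hpos : ∀ x, x ≠ 0 → 0 < B x x)
    {x y : V} (h : ∀ z, B x z = B y z) : x = y := by
  by_contra hne
  have h1 := hpos (x - y) (sub_ne_zero.2 hne)
  rw [LinearMap.map_sub₂, h, sub_self] at h1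
  exact lt_irrefl _ h1

/-- Positivity makes B an isomorphism onto the dual, and A is b followed by its inverse. -/
theorem exists_form_apply_eq [FiniteDimensional ℝ V] {B : LinearMap.BilinForm ℝ V}
    (hpos : ∀ x, x ≠ 0 → 0 < B x x) (b : LinearMap.BilinForm ℝ V) :
    ∃ A : V →ₗ[ℝ] V, ∀ x y, B (A x) y = b x y := by
  have hinj : Function.Injective B := fun x y h =>
    eq_of_forall_form_eq hpos fun z => by rw [h]
  have hsurj : Function.Surjective B :=
    (LinearMap.injective_iff_surjective_of_finrank_eq_finrank
      Subspace.dual_finrank_eq.symm).1 hinj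
  obtain ⟨R, hR⟩ := B.exists_rightInverse_of_surjective (LinearMap.range_eq_top.2 hsurj)
  exact ⟨R ∘ₗ b, fun x y => DFunLike.congr_fun (DFunLike.congr_fun hR (b x)) y⟩

/-- `P` is the orthogonal projection onto `U` with respect to `B`. -/
structure IsFormProjection (B : LinearMap.BilinForm ℝ V) (U : Submodule ℝ V) (P : V →ₗ[ℝ] V) :
    Prop where
  mem : ∀ x, P x ∈ U
  eq_self : ∀ x ∈ U, P x = x
  symm : ∀ x y, B (P x) y = B x (P y)

theorem exists_isFormProjection [FiniteDimensional ℝ V] {B : LinearMap.BilinForm ℝ V}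
    (hsymm : ∀ x y, B x y = B y x) (hpos : ∀ x, x ≠ 0 → 0 < B x x) (U : Submodule ℝ V) :
    ∃ P, IsFormProjection B U P := by
  have hrefl : B.IsRefl := fun x y h => by rw [hsymm, h]
  have hc : IsCompl U (B.orthogonal U) := by
    rw [LinearMap.BilinForm.isCompl_orthogonal_iff_disjoint hrefl, Submodule.disjoint_def]
    intro x hx hx'
    by_contra hne
    exact (hpos x hne).ne' (hx' x hx)
  have hz (x y : V) : B (U.projection _ hc x) (y - U.projection _ hc y) = 0 := by
    have h1 : y - U.projection _ hc y ∈ B.orthogonal U := Submodule.sub_projection_mem hc y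
    exact h1 _ (Submodule.projection_apply_mem hc x)
  refine ⟨U.projection _ hc, fun x => Submodule.projection_apply_mem hc x,
    fun x hx => Submodule.projection_apply_left hc ⟨x, hx⟩, fun x y => ?_⟩
  have h1 := hz x y
  have h2 := hz y x
  rw [map_sub, sub_eq_zero] at h1 h2
  rw [h1, hsymm x, h2, hsymm]

namespace IsFormProjection

variable {B : LinearMap.BilinForm ℝ V} {U : Submodule ℝ V} {P : V →ₗ[ℝ] V}

theorem eq_zero (hP : IsFormProjection B U P) (hpos : ∀ x, x ≠ 0 → 0 < B x x) {x : V}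
    (hx : ∀ y ∈ U, B x y = 0) : P x = 0 :=
  eq_of_forall_form_eq hpos fun y => by
    rw [hP.symm, hx _ (hP.mem y), map_zero, LinearMap.zero_apply]

theorem nonneg (hP : IsFormProjection B U P) (hpos : ∀ x, x ≠ 0 → 0 < B x x) (x : V) :
    0 ≤ B (P x) x := by
  rw [← hP.eq_self _ (hP.mem x), hP.symm]
  by_cases h : P x = 0
  · simp [h]
  · exact (hpos _ h).le

/-- A map that preserves U together with its adjoint also preserves the orthogonal complement, so it
commutes with the projection. -/
theorem comm (hP : IsFormProjection B U P) (hpos : ∀ x, x ≠ 0 → 0 < B x x) {D D' : V → V}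
    (hD : ∀ x y, B (D x) y = B x (D' y)) (hU : ∀ x ∈ U, D x ∈ U) (hU' : ∀ x ∈ U, D' x ∈ U)
    (x : V) : P (D x) = D (P x) := by
  refine eq_of_forall_form_eq hpos fun y => ?_
  rw [hP.symm, hD, ← hP.eq_self _ (hU' _ (hP.mem y)), ← hP.symm, ← hD, ← hP.symm,
    hP.eq_self _ (hU _ (hP.mem x))]

end IsFormProjection

end OrthogonalProjection

/-! ### Real root spaces, scalar operators and strongly orthogonal roots. -/

section RealRootSpaces

variable {𝔤 : Type*} [LieRing 𝔤] [LieAlgebra ℝ 𝔤] {B : LinearMap.BilinForm ℝ 𝔤}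
  {𝔱 : Submodule ℝ 𝔤} {α β : Module.Dual ℂ (𝔱.baseChange ℂ)}

/-- The real root space as a subspace. -/
def realRootSubmodule (𝔱 : Submodule ℝ 𝔤) (α : Module.Dual ℂ (𝔱.baseChange ℂ)) :
    Submodule ℝ 𝔤 :=
  ((complexRootSpace 𝔱 α ⊔ complexRootSpace 𝔱 (-α)).restrictScalars ℝ).comap
    (TensorProduct.mk ℝ ℂ 𝔤 1)

theorem isLieRoot_iff : IsLieRoot 𝔱 α ↔
    α ≠ 0 ∧ ∃ Z : ℂ ⊗[ℝ] 𝔤, Z ≠ 0 ∧ IsWeightVector (𝔱.baseChange ℂ) α Z := by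
  rw [IsLieRoot, Submodule.ne_bot_iff]
  refine and_congr Iff.rfl (exists_congr fun Z => ?_)
  rw [and_comm]
  rfl

theorem apply_mem_realRootSubmodule {A : 𝔤 →ₗ[ℝ] 𝔤} (hA : ∀ H ∈ 𝔱, ∀ Y, A ⁅H, Y⁆ = ⁅H, A Y⁆)
    {X : 𝔤} (hX : X ∈ realRootSubmodule 𝔱 α) : A X ∈ realRootSubmodule 𝔱 α := by
  obtain ⟨E, hE, F, hF, h⟩ := Submodule.mem_sup.1 hX
  refine Submodule.mem_sup.2 ⟨A.baseChange ℂ E, IsWeightVector.baseChange hA hE,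
    A.baseChange ℂ F, IsWeightVector.baseChange hA hF, ?_⟩
  rw [← map_add, h]
  exact LinearMap.baseChange_tmul _ _ _

theorem ne_neg_self_of_ne_zero (hα : α ≠ 0) : α ≠ -α := by
  intro h
  have h1 : (2 : ℂ) • α = 0 := by
    rw [two_smul]
    nth_rewrite 2 [h]
    exact add_neg_cancel α
  exact hα ((smul_eq_zero.1 h1).resolve_left two_ne_zero)

theorem isWeightVector_complexConj (hB : IsInvariantInnerProduct B)
    {Z : ℂ ⊗[ℝ] 𝔤}
    (hZ : IsWeightVector (𝔱.baseChange ℂ) α Z) :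
    IsWeightVector (𝔱.baseChange ℂ) (-α) (complexConj 𝔤 Z) :=
  CompactRealForm.isWeightVector_conj (C := compactRealForm hB)
    complexConj_mem_baseChange hZ

/-- A vector of a real root space is the real part of a root vector. -/
theorem exists_rootVector (hB : IsInvariantInnerProduct B)
    (hα : α ≠ 0) {X : 𝔤} (hX : X ∈ realRootSpace 𝔱 α) :
    ∃ E : ℂ ⊗[ℝ] 𝔤, IsWeightVector (𝔱.baseChange ℂ) α E ∧
      (1 : ℂ) ⊗ₜ[ℝ] X = E + complexConj 𝔤 E := by
  obtain ⟨E, hE, F, hF, h⟩ := Submodule.mem_sup.1 hX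
  refine ⟨E, hE, ?_⟩
  have hσE := isWeightVector_complexConj hB hE
  have hσF := isWeightVector_complexConj hB hF
  rw [neg_neg] at hσF
  have h1 : complexConj 𝔤 ((1 : ℂ) ⊗ₜ[ℝ] X) = (1 : ℂ) ⊗ₜ[ℝ] X := by
    rw [complexConj_tmul, star_one]
  rw [← h, map_add] at h1
  have h2 : E - complexConj 𝔤 F = complexConj 𝔤 E - F := by
    rw [sub_eq_sub_iff_add_eq_add]
    exact h1.symm
  -- The difference conj E - F has weight -α and, by reality of X, also weight α; hence it vanishes
  -- and F = conj E.
  have h3 : complexConj 𝔤 E - F = 0 := by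
    refine IsWeightVector.eq_zero_of_ne ?_ (hσE.sub hF) (ne_neg_self_of_ne_zero hα)
    rw [← h2]
    exact IsWeightVector.sub hE hσF
  rw [← h, sub_eq_zero.1 h3]

theorem baseChange_form_one_tmul (X Y : 𝔤) :
    B.baseChange ℂ ((1 : ℂ) ⊗ₜ[ℝ] X) ((1 : ℂ) ⊗ₜ[ℝ] Y) = (B X Y : ℂ) := by
  rw [LinearMap.BilinForm.baseChange_tmul]
  simp

/-- The weights ±α and ±β are distinct in all four combinations, so every pairing of root components
vanishes. -/
theorem form_eq_zero_of_ne (hB : IsInvariantInnerProduct B)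
    (hα : α ≠ 0) (hβ : β ≠ 0) (hαβ : α ≠ β) (hαβ' : α ≠ -β) {X Y : 𝔤}
    (hX : X ∈ realRootSpace 𝔱 α) (hY : Y ∈ realRootSpace 𝔱 β) : B X Y = 0 := by
  obtain ⟨E, hE, hXE⟩ := exists_rootVector hB hα hX
  obtain ⟨F, hF, hYF⟩ := exists_rootVector hB hβ hY
  have hσE := isWeightVector_complexConj hB hE
  have hσF := isWeightVector_complexConj hB hF
  have key {γ δ : Module.Dual ℂ (𝔱.baseChange ℂ)} {Z W : ℂ ⊗[ℝ] 𝔤}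
      (hZ : IsWeightVector (𝔱.baseChange ℂ) γ Z) (hW : IsWeightVector (𝔱.baseChange ℂ) δ W)
      (h : γ ≠ δ) : B.baseChange ℂ Z (complexConj 𝔤 W) = 0 :=
    CompactRealForm.form_conj_eq_zero (C := compactRealForm hB)
      complexConj_mem_baseChange hZ hW h
  have h1 := key hE hF hαβ
  have h2 := key hE hσF hαβ'
  have h3 := key hσE hF fun h => hαβ' (by rw [← h, neg_neg])
  have h4 := key hσE hσF fun h => hαβ (neg_injective h)
  rw [complexConj_complexConj] at h2 h4
  have := baseChange_form_one_tmul (B := B) X Y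
  rw [hXE, hYF, map_add, map_add, LinearMap.add_apply, LinearMap.add_apply,
    h1, h2, h3, h4] at this
  simpa using this.symm

theorem isWeightVector_zero_one_tmul (hab : ∀ H ∈ 𝔱, ∀ H' ∈ 𝔱, ⁅H, H'⁆ = 0) {H : 𝔤} (hH : H ∈ 𝔱) :
    IsWeightVector (𝔱.baseChange ℂ) 0 ((1 : ℂ) ⊗ₜ[ℝ] H) := by
  intro K
  rw [LinearMap.zero_apply, zero_smul]
  refine baseChange_induction (P := fun K => ⁅K, (1 : ℂ) ⊗ₜ[ℝ] H⁆ = 0) ?_ ?_ ?_ ?_ K.2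
  · exact zero_lie _
  · intro Z W hZ hW
    rw [add_lie, hZ, hW, add_zero]
  · intro c Z hZ
    rw [tensor_smul_lie, hZ, smul_zero]
  · intro K hK
    rw [LieAlgebra.ExtendScalars.bracket_tmul, hab K hK H hH, TensorProduct.tmul_zero]

theorem form_eq_zero_of_mem_cartan (hB : IsInvariantInnerProduct B)
    (hab : ∀ H ∈ 𝔱, ∀ H' ∈ 𝔱, ⁅H, H'⁆ = 0) (hα : α ≠ 0) {X H : 𝔤}
    (hX : X ∈ realRootSpace 𝔱 α) (hH : H ∈ 𝔱) : B X H = 0 := by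
  obtain ⟨E, hE, hXE⟩ := exists_rootVector hB hα hX
  have hσE := isWeightVector_complexConj hB hE
  have key {γ : Module.Dual ℂ (𝔱.baseChange ℂ)} {Z : ℂ ⊗[ℝ] 𝔤}
      (hZ : IsWeightVector (𝔱.baseChange ℂ) γ Z) (h : γ ≠ 0) :
      B.baseChange ℂ Z ((1 : ℂ) ⊗ₜ[ℝ] H) = 0 := by
    have := CompactRealForm.form_conj_eq_zero (C := compactRealForm hB)
      complexConj_mem_baseChange hZ (isWeightVector_zero_one_tmul hab hH) h
    change B.baseChange ℂ Z (complexConj 𝔤 ((1 : ℂ) ⊗ₜ[ℝ] H)) = 0 at this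
    rwa [complexConj_tmul, star_one] at this
  have := baseChange_form_one_tmul (B := B) X H
  rw [hXE, map_add, LinearMap.add_apply, key hE hα, key hσE (neg_ne_zero.2 hα)] at this
  simpa using this.symm

theorem rootVector_ne_zero {X : 𝔤} (hX0 : X ≠ 0) {E : ℂ ⊗[ℝ] 𝔤}
    (hXE : (1 : ℂ) ⊗ₜ[ℝ] X = E + complexConj 𝔤 E) : E ≠ 0 := by
  rintro rfl
  rw [map_zero, add_zero] at hXE
  exact hX0 (one_tmul_injective (hXE.trans (TensorProduct.tmul_zero 𝔤 (1 : ℂ)).symm))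

/-- Symmetric operators commuting with `𝔱` are scalar on the real root spaces. -/
theorem exists_apply_eq_smul (hB : IsInvariantInnerProduct B)
    (hcent : ∀ Z, (∀ H ∈ 𝔱, ⁅H, Z⁆ = 0) → Z ∈ 𝔱)
    {A : 𝔤 →ₗ[ℝ] 𝔤} (hA : ∀ H ∈ 𝔱, ∀ Y, A ⁅H, Y⁆ = ⁅H, A Y⁆)
    (hAsymm : ∀ X Y, B (A X) Y = B X (A Y)) (hα : α ≠ 0) {X : 𝔤}
    (hX : X ∈ realRootSpace 𝔱 α) : ∃ c : ℝ, A X = c • X := by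
  by_cases hX0 : X = 0
  · exact ⟨0, by simp [hX0]⟩
  obtain ⟨E, hE, hXE⟩ := exists_rootVector hB hα hX
  have hE0 := rootVector_ne_zero hX0 hXE
  let C := compactRealForm hB
  obtain ⟨c, hc⟩ := CompactRealForm.exists_eq_smul (C := C)
    complexConj_mem_baseChange (mem_baseChange_of_isWeightVector_zero hcent) hα hE hE0
    (IsWeightVector.baseChange hA hE)
  have hcσ : A.baseChange ℂ (complexConj 𝔤 E) = star c • complexConj 𝔤 E := by
    rw [← complexConj_baseChange, hc, complexConj_smul]
  have h1 := baseChange_form_symm_op hAsymm E (complexConj 𝔤 E)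
  have hN : B.baseChange ℂ E (complexConj 𝔤 E) ≠ 0 := by
    intro h
    exact hE0 (C.eq_zero_of_form_conj_self h)
  rw [hc, hcσ, map_smul, map_smul, LinearMap.smul_apply, smul_eq_mul, smul_eq_mul] at h1
  -- Symmetry of A forces the eigenvalue on the complex root line to be real.
  have h2 : star c = c := (mul_right_cancel₀ hN h1).symm
  have h3 : ((c.re : ℝ) : ℂ) = c := Complex.conj_eq_iff_re.1 h2
  refine ⟨c.re, one_tmul_injective ?_⟩
  change (1 : ℂ) ⊗ₜ[ℝ] A X = (1 : ℂ) ⊗ₜ[ℝ] (c.re • X)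
  rw [← LinearMap.baseChange_tmul, TensorProduct.tmul_smul, hXE, map_add, hc, hcσ, h2, ← smul_add,
    ← h3]
  exact Complex.coe_smul _ _

/-- The brackets [E, F] and [E, conj F] have the nonzero weights α + β and α - β, which are not
roots; the other two brackets are their conjugates. -/
theorem lie_eq_zero_of_not_isLieRoot (hB : IsInvariantInnerProduct B)
    (hα : α ≠ 0) (hβ : β ≠ 0) (hαβ : α ≠ β) (hαβ' : α ≠ -β)
    (hadd : ¬ IsLieRoot 𝔱 (α + β)) (hsub : ¬ IsLieRoot 𝔱 (α - β)) {X Y : 𝔤}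
    (hX : X ∈ realRootSpace 𝔱 α) (hY : Y ∈ realRootSpace 𝔱 β) : ⁅X, Y⁆ = 0 := by
  obtain ⟨E, hE, hXE⟩ := exists_rootVector hB hα hX
  obtain ⟨F, hF, hYF⟩ := exists_rootVector hB hβ hY
  have hσF := isWeightVector_complexConj hB hF
  have key {γ : Module.Dual ℂ (𝔱.baseChange ℂ)} {Z : ℂ ⊗[ℝ] 𝔤}
      (hZ : IsWeightVector (𝔱.baseChange ℂ) γ Z) (h : γ ≠ 0) (hγ : ¬ IsLieRoot 𝔱 γ) : Z = 0 := by
    by_contra hZ0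
    exact hγ (isLieRoot_iff.2 ⟨h, Z, hZ0, hZ⟩)
  have h1 : ⁅E, F⁆ = 0 :=
    key (hE.lie hF) (fun h => hαβ' (eq_neg_of_add_eq_zero_left h)) hadd
  have h2 : ⁅E, complexConj 𝔤 F⁆ = 0 := by
    refine key (hE.lie hσF) ?_ ?_
    · rw [← sub_eq_add_neg]
      exact sub_ne_zero.2 hαβ
    · rwa [← sub_eq_add_neg]
  have h3 : ⁅complexConj 𝔤 E, complexConj 𝔤 F⁆ = 0 := by rw [← complexConj_lie, h1, map_zero]
  have h4 : ⁅complexConj 𝔤 E, F⁆ = 0 := by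
    rw [← complexConj_complexConj F, ← complexConj_lie, h2, map_zero]
  refine one_tmul_injective ?_
  change (1 : ℂ) ⊗ₜ[ℝ] ⁅X, Y⁆ = (1 : ℂ) ⊗ₜ[ℝ] (0 : 𝔤)
  rw [← one_mul (1 : ℂ), ← LieAlgebra.ExtendScalars.bracket_tmul, one_mul,
    TensorProduct.tmul_zero, hXE, hYF, add_lie, tensor_lie_add, tensor_lie_add, h1, h2, h3, h4]
  simp

/-- If every `X p` commutes with the sum of all of them, then the roots are pairwise strongly
orthogonal. -/
theorem not_isLieRoot_of_sum_lie_eq_zero (hB : IsInvariantInnerProduct B)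
    [FiniteDimensional ℝ 𝔤]
    (hcent : ∀ Z, (∀ H ∈ 𝔱, ⁅H, Z⁆ = 0) → Z ∈ 𝔱) {ι : Type*} [Fintype ι]
    {α : ι → Module.Dual ℂ (𝔱.baseChange ℂ)} (hα : ∀ p, α p ≠ 0)
    (hdist : ∀ p q, p ≠ q → α p ≠ α q ∧ α p ≠ -α q) {X : ι → 𝔤}
    (hX : ∀ p, X p ∈ realRootSpace 𝔱 (α p)) (hX0 : ∀ p, X p ≠ 0)
    (hcomm : ∀ p, ⁅∑ q, X q, X p⁆ = 0) (p q : ι) :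
    ¬ IsLieRoot 𝔱 (α p + α q) ∧ ¬ IsLieRoot 𝔱 (α p - α q) := by
  let C := compactRealForm hB
  choose E hE hXE using fun p => exists_rootVector hB (hα p) (hX p)
  have hE0 p := rootVector_ne_zero (hX0 p) (hXE p)
  have hσE p := isWeightVector_complexConj hB (hE p)
  have hσE0 p : complexConj 𝔤 (E p) ≠ 0 := fun h => hE0 p (C.conj_eq_zero_iff.1 h)
  have hcent' := mem_baseChange_of_isWeightVector_zero hcent
  -- The Boolean distinguishes E_p, of weight α_p, from its conjugate, of weight -α_p; `bar`
  -- exchanges them.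
  let e : ι × Bool → ℂ ⊗[ℝ] 𝔤 := fun i => if i.2 then E i.1 else complexConj 𝔤 (E i.1)
  let γ : ι × Bool → Module.Dual ℂ (𝔱.baseChange ℂ) := fun i => if i.2 then α i.1 else -α i.1
  let bar : ι × Bool → ι × Bool := fun i => (i.1, !i.2)
  have hγ : Function.Injective γ := by
    rintro ⟨p, a⟩ ⟨q, b⟩ h
    by_cases hpq : p = q
    · subst hpq
      have := ne_neg_self_of_ne_zero (hα p)
      cases a <;> cases b <;> simp_all [γ]
    · have h1 := hdist p q hpq
      have h2 : -α p ≠ α q := fun h => h1.2 (by rw [← h, neg_neg])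
      cases a <;> cases b <;> simp_all [γ]
  have hbar i : γ (bar i) = -γ i := by
    rcases i with ⟨p, a⟩
    cases a <;> simp [γ, bar]
  have he i : IsWeightVector (𝔱.baseChange ℂ) (γ i) (e i) := by
    rcases i with ⟨p, a⟩
    cases a
    · simpa [γ, e] using hσE p
    · simpa [γ, e] using hE p
  have hebar (i : ι × Bool) : e i + e (bar i) = (1 : ℂ) ⊗ₜ[ℝ] X i.1 := by
    rcases i with ⟨p, a⟩
    cases a
    · simp [e, bar, hXE, add_comm]
    · simp [e, bar, hXE]
  have hsum : ∑ j, e j = (1 : ℂ) ⊗ₜ[ℝ] ∑ q, X q := by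
    rw [Fintype.sum_prod_type, TensorProduct.tmul_sum]
    refine Finset.sum_congr rfl fun p _ => ?_
    rw [Fintype.sum_bool, hXE]
    simp [e]
  have hlie (i) : ⁅∑ j, e j, e i + e (bar i)⁆ = 0 := by
    rw [hsum, hebar, LieAlgebra.ExtendScalars.bracket_tmul, hcomm, TensorProduct.tmul_zero]
  have key {i j : ι × Bool} (hij : j ≠ bar i) : ⁅e j, e i⁆ = 0 :=
    CompactRealForm.lie_eq_zero_of_sum_lie_eq_zero (C := C) complexConj_mem_baseChange
      hγ hbar he hlie hij
  have fin {i j : ι × Bool} (hij : j ≠ bar i) : ¬ IsLieRoot 𝔱 (γ j + γ i) := by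
    intro h
    obtain ⟨-, W, hW0, hW⟩ := isLieRoot_iff.1 h
    have hγ0 (i) : γ i ≠ 0 := by
      rcases i with ⟨p, a⟩
      cases a <;> simp [γ, hα p]
    have he0 (i) : e i ≠ 0 := by
      rcases i with ⟨p, a⟩
      cases a
      · simpa [e] using hσE0 p
      · simpa [e] using hE0 p
    exact hW0 (CompactRealForm.eq_zero_of_lie_eq_zero (C := C) complexConj_mem_baseChange hcent'
      (hγ0 j) (hγ0 i) (he j) (he0 j) (he i) (he0 i) (key hij) hW)
  constructor
  -- This includes p = q, where it says that 2α_p is not a root.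
  · exact fin (i := (q, true)) (j := (p, true)) (by simp [bar])
  · by_cases hpq : p = q
    -- For p = q the two vectors are opposite, and 0 is not a root by definition.
    · rw [hpq, sub_self]
      exact fun h => h.1 rfl
    · rw [sub_eq_add_neg]
      exact fin (i := (q, false)) (j := (p, true)) (by simpa [bar] using hpq)

end RealRootSpaces

/-! ### Invariant metrics as operators, and the two implications. -/

section Equigeodesics

variable {n m : ℕ} {G : Type*} [TopologicalSpace G] [Group G]
  [ChartedSpace (EuclideanSpace ℝ (Fin n)) G] [LieGroup (𝓡 n) ∞ G] [T2Space G] {T : Subgroup G}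
  [ChartedSpace (EuclideanSpace ℝ (Fin m)) (G ⧸ T)] [IsManifold (𝓡 m) ∞ (G ⧸ T)]
  {B : LinearMap.BilinForm ℝ (GroupLieAlgebra (𝓡 n) G)}

theorem finiteDimensional_groupLieAlgebra : FiniteDimensional ℝ (GroupLieAlgebra (𝓡 n) G) :=
  inferInstanceAs (FiniteDimensional ℝ (EuclideanSpace ℝ (Fin n)))

theorem form_lieAd_left (hAd : ∀ (g : G) X Y, B (lieAd g X) (lieAd g Y) = B X Y) (g : G)
    (X Y : GroupLieAlgebra (𝓡 n) G) : B (lieAd g X) Y = B X (lieAd g⁻¹ Y) := by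
  rw [← hAd g X, lieAd_apply_inv]

theorem IsFormProjection.lieAd_comm {U : Submodule ℝ (GroupLieAlgebra (𝓡 n) G)}
    {P : GroupLieAlgebra (𝓡 n) G →ₗ[ℝ] GroupLieAlgebra (𝓡 n) G} (hP : IsFormProjection B U P)
    (hpos : ∀ X, X ≠ 0 → 0 < B X X) (hAd : ∀ (g : G) X Y, B (lieAd g X) (lieAd g Y) = B X Y)
    (hU : ∀ t ∈ T, ∀ X ∈ U, lieAd t X ∈ U) {t : G} (ht : t ∈ T) (X : GroupLieAlgebra (𝓡 n) G) :
    P (lieAd t X) = lieAd t (P X) :=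
  hP.comm hpos (D := lieAd t) (D' := lieAd t⁻¹) (form_lieAd_left hAd t) (hU t ht)
    (hU _ (T.inv_mem ht)) X

theorem lieAd_mem_realRootSubmodule
    (hπ : Manifold.IsSubmersion (𝓡 n) (𝓡 m) ∞ (QuotientGroup.mk : G → G ⧸ T))
    (hT : ∀ a ∈ T, ∀ b ∈ T, a * b = b * a)
    {α : Module.Dual ℂ ((subgroupLieAlgebra (n := n) T).baseChange ℂ)} {t : G} (ht : t ∈ T)
    {X : GroupLieAlgebra (𝓡 n) G}
    (hX : X ∈ realRootSubmodule (subgroupLieAlgebra (n := n) T) α) :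
    lieAd t X ∈ realRootSubmodule (subgroupLieAlgebra (n := n) T) α :=
  apply_mem_realRootSubmodule (A := (lieAd (n := n) t).toLinearMap)
    (fun _ hH Y => (lie_lieAd_of_commute (lieAd_eq_self_of_mem hπ hT ht hH) Y).symm) hX

/-- A positive definite symmetric operator commuting with `Ad T` defines an invariant metric on the
orthogonal complement of the Lie algebra of `T`. -/
theorem exists_invariantMetric_of_operator
    (hπ : Manifold.IsSubmersion (𝓡 n) (𝓡 m) ∞ (QuotientGroup.mk : G → G ⧸ T))
    (hT : ∀ a ∈ T, ∀ b ∈ T, a * b = b * a)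
    (hsymm : ∀ X Y, B X Y = B Y X) (hpos : ∀ X, X ≠ 0 → 0 < B X X)
    (hAd : ∀ (g : G) X Y, B (lieAd g X) (lieAd g Y) = B X Y)
    {S P : GroupLieAlgebra (𝓡 n) G →ₗ[ℝ] GroupLieAlgebra (𝓡 n) G}
    (hS : ∀ X Y, B (S X) Y = B X (S Y)) (hSpos : ∀ X, X ≠ 0 → 0 < B (S X) X)
    (hSAd : ∀ t ∈ T, ∀ X, S (lieAd t X) = lieAd t (S X))
    (hP : IsFormProjection B (subgroupLieAlgebra (n := n) T) P) :
    ∃ g : SmoothRiemannianMetric m (G ⧸ T), IsInvariantMetric G g ∧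
      ∀ X Y, metricAt g ((1 : G) : G ⧸ T) (projDeriv n m T X) (projDeriv n m T Y) =
        B (S (X - P X)) (Y - P Y) := by
  obtain ⟨R, hR⟩ := (projDeriv n m T).toLinearMap.exists_rightInverse_of_surjective
    (LinearMap.range_eq_top.2 (projDeriv_surjective hπ))
  have hR (v : EuclideanSpace ℝ (Fin m)) : projDeriv n m T (R v) = v := DFunLike.congr_fun hR v
  -- The map 1 - P kills 𝔱 = ker dπ, so s does not depend on the right inverse R: it is the inverse
  -- of dπ on the orthogonal complement of 𝔱.
  let s : EuclideanSpace ℝ (Fin m) →ₗ[ℝ] GroupLieAlgebra (𝓡 n) G := (LinearMap.id - P) ∘ₗ R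
  have hs (X) : s (projDeriv n m T X) = X - P X := by
    have h1 : R (projDeriv n m T X) - X ∈ subgroupLieAlgebra (n := n) T := by
      rw [mem_subgroupLieAlgebra_iff hπ, map_sub, hR, sub_self]
    have h2 := hP.eq_self _ h1
    rw [map_sub] at h2
    change R (projDeriv n m T X) - P (R (projDeriv n m T X)) = X - P X
    rw [sub_eq_sub_iff_sub_eq_sub]
    exact h2.symm
  have hPAd {t : G} (ht : t ∈ T) (X) : P (lieAd t X) = lieAd t (P X) :=
    hP.lieAd_comm hpos hAd (T := T)
      (fun t ht H hH => by rwa [lieAd_eq_self_of_mem hπ hT ht hH]) ht X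
  have hsAd {t : G} (ht : t ∈ T) (v : EuclideanSpace ℝ (Fin m)) :
      s (smulDeriv m T t v) = lieAd t (s v) := by
    obtain ⟨X, rfl⟩ := projDeriv_surjective (n := n) hπ v
    rw [← projDeriv_lieAd hπ ht, hs, hs, map_sub, hPAd ht]
  have hs0 (v : EuclideanSpace ℝ (Fin m)) (hv : v ≠ 0) : s v ≠ 0 := by
    obtain ⟨X, rfl⟩ := projDeriv_surjective (n := n) hπ v
    rw [hs, Ne, sub_eq_zero]
    intro h
    refine hv ((mem_subgroupLieAlgebra_iff hπ X).1 ?_)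
    rw [h]
    exact hP.mem X
  let q : EuclideanSpace ℝ (Fin m) →ₗ[ℝ] EuclideanSpace ℝ (Fin m) →ₗ[ℝ] ℝ :=
    LinearMap.compl₁₂ (B ∘ₗ S) s s
  let Q : EuclideanSpace ℝ (Fin m) →L[ℝ] EuclideanSpace ℝ (Fin m) →L[ℝ] ℝ :=
    LinearMap.toContinuousLinearMap
      ((LinearMap.toContinuousLinearMap :
        (EuclideanSpace ℝ (Fin m) →ₗ[ℝ] ℝ) ≃ₗ[ℝ] _).toLinearMap.comp q)
  have hQ (v w) : Q v w = B (S (s v)) (s w) := rfl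
  obtain ⟨g, hg, hgQ⟩ := exists_invariantMetric hπ Q
    (fun v w => by rw [hQ, hQ, hS, hsymm]) (fun v hv => hSpos _ (hs0 v hv))
    (fun t ht v w => by rw [hQ, hQ, hsAd ht, hsAd ht, hSAd t ht, hAd])
  exact ⟨g, hg, fun X Y => by rw [hgQ, hQ, hs, hs]⟩

/-- The form on the Lie algebra induced by an invariant metric. -/
theorem exists_form_of_isInvariantMetric
    (hπ : Manifold.IsSubmersion (𝓡 n) (𝓡 m) ∞ (QuotientGroup.mk : G → G ⧸ T))
    {g : SmoothRiemannianMetric m (G ⧸ T)} (hg : IsInvariantMetric G g) :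
    ∃ b : LinearMap.BilinForm ℝ (GroupLieAlgebra (𝓡 n) G),
      (∀ X Y, b X Y = metricAt g ((1 : G) : G ⧸ T) (projDeriv n m T X) (projDeriv n m T Y)) ∧
      (∀ X Y, b X Y = b Y X) ∧
      ∀ t ∈ T, ∀ X Y, b (lieAd t X) (lieAd t Y) = b X Y := by
  let b : LinearMap.BilinForm ℝ (GroupLieAlgebra (𝓡 n) G) :=
    LinearMap.mk₂ ℝ (fun X Y => metricAt g ((1 : G) : G ⧸ T) (projDeriv n m T X) (projDeriv n m T Y))
      (fun X Y Z => by rw [map_add, map_add]; rfl) (fun c X Y => by rw [map_smul, map_smul]; rfl)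
      (fun X Y Z => by rw [map_add, map_add]) (fun c X Y => by rw [map_smul, map_smul])
  have hb (X Y) : b X Y = metricAt g ((1 : G) : G ⧸ T) (projDeriv n m T X) (projDeriv n m T Y) := rfl
  refine ⟨b, hb, fun X Y => by rw [hb, hb, metricAt_symm], fun t ht X Y => ?_⟩
  have h1 := hg.metricAt_smulDeriv t (projDeriv n m T X) (projDeriv n m T Y)
  have h2 : t • ((1 : G) : G ⧸ T) = ((1 : G) : G ⧸ T) := by
    change ((t * 1 : G) : G ⧸ T) = _
    rw [QuotientGroup.eq]
    simpa using ht
  rw [h2] at h1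
  rw [hb, hb, projDeriv_lieAd hπ ht, projDeriv_lieAd hπ ht, h1]

variable {ι : Type*} [Fintype ι]
  {α : ι → Module.Dual ℂ ((subgroupLieAlgebra (n := n) T).baseChange ℂ)}
  {X : ι → GroupLieAlgebra (𝓡 n) G}

/-- The metric is represented by a symmetric operator A commuting with ad 𝔱. It is scalar on each
real root space, so AX commutes with X and B(AX, [X, Y]) = -B([X, AX], Y) = 0. -/
theorem isGeodesic_of_not_isLieRoot [CompactSpace G]
    (hπ : Manifold.IsSubmersion (𝓡 n) (𝓡 m) ∞ (QuotientGroup.mk : G → G ⧸ T))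
    (hT : IsMaximalTorus T) (hα : ∀ p, α p ≠ 0)
    (hdist : ∀ p q, p ≠ q → α p ≠ α q ∧ α p ≠ -α q)
    (hX : ∀ p, X p ∈ realRootSpace (subgroupLieAlgebra (n := n) T) (α p))
    (hroot : ∀ p q, ¬ IsLieRoot (subgroupLieAlgebra (n := n) T) (α p + α q) ∧
      ¬ IsLieRoot (subgroupLieAlgebra (n := n) T) (α p - α q))
    {g : SmoothRiemannianMetric m (G ⧸ T)} (hg : IsInvariantMetric G g) :
    IsGeodesic g (fun s => oneParam (∑ p, X p) s • ((1 : G) : G ⧸ T)) := by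
  have := finiteDimensional_groupLieAlgebra (n := n) (G := G)
  rw [isGeodesic_oneParam_iff hπ hg]
  obtain ⟨B, hsymm, hpos, hAd⟩ := exists_lieAd_invariant_form (n := n) (G := G)
  have hB : IsInvariantInnerProduct B :=
    ⟨hsymm, hpos, fun Z => lie_invariant_of_lieAd_invariant fun s => hAd (oneParam Z s)⟩
  obtain ⟨b, hb, hbsymm, hbAd⟩ := exists_form_of_isInvariantMetric hπ hg
  obtain ⟨A, hA⟩ := exists_form_apply_eq hpos b
  have hAsymm (X Y) : B (A X) Y = B X (A Y) := by rw [hA, hbsymm, ← hA, hsymm]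
  have hAlie : ∀ H ∈ subgroupLieAlgebra (n := n) T, ∀ Y, A ⁅H, Y⁆ = ⁅H, A Y⁆ := by
    intro H hH Y
    refine eq_of_forall_form_eq hpos fun Z => ?_
    rw [hA, hB.lie, hA]
    exact lie_invariant_of_lieAd_invariant
      (fun s => hbAd _ ((mem_subgroupLieAlgebra_iff_oneParam hπ H).1 hH s)) Y Z
  choose c hc using fun p => exists_apply_eq_smul hB
    (fun Z hZ => hT.mem_subgroupLieAlgebra_of_forall_lie_eq_zero hπ hZ) hAlie hAsymm (hα p) (hX p)
  have hcomm (p q) : ⁅X p, X q⁆ = 0 := by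
    by_cases hpq : p = q
    · rw [hpq, lie_self]
    · exact lie_eq_zero_of_not_isLieRoot hB (hα p) (hα q) (hdist p q hpq).1 (hdist p q hpq).2
        (hroot p q).1 (hroot p q).2 (hX p) (hX q)
  have h0 : ⁅∑ p, X p, A (∑ p, X p)⁆ = 0 := by
    rw [map_sum, sum_lie]
    refine Finset.sum_eq_zero fun p _ => ?_
    rw [lie_sum]
    refine Finset.sum_eq_zero fun q _ => ?_
    rw [hc, lie_smul, hcomm, smul_zero]
  intro Y
  have h1 := hB.lie (∑ p, X p) (A (∑ p, X p)) Y
  rw [h0, map_zero, LinearMap.zero_apply, hA, hb] at h1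
  exact neg_eq_zero.1 h1.symm

/-- One metric per p suffices: for the operator 1 + P, with P the projection onto the real root
space of α_p, the geodesic condition becomes [X, X + X_p] = 0. -/
theorem sum_lie_eq_zero_of_forall_isGeodesic [CompactSpace G]
    (hπ : Manifold.IsSubmersion (𝓡 n) (𝓡 m) ∞ (QuotientGroup.mk : G → G ⧸ T))
    (hT : IsMaximalTorus T) (hB : IsInvariantInnerProduct B)
    (hAd : ∀ (g : G) X Y, B (lieAd g X) (lieAd g Y) = B X Y) (hα : ∀ p, α p ≠ 0)
    (hdist : ∀ p q, p ≠ q → α p ≠ α q ∧ α p ≠ -α q)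
    (hX : ∀ p, X p ∈ realRootSpace (subgroupLieAlgebra (n := n) T) (α p))
    (hgeod : ∀ g : SmoothRiemannianMetric m (G ⧸ T), IsInvariantMetric G g →
      IsGeodesic g (fun s => oneParam (∑ p, X p) s • ((1 : G) : G ⧸ T))) (p : ι) :
    ⁅∑ q, X q, X p⁆ = 0 := by
  have := finiteDimensional_groupLieAlgebra (n := n) (G := G)
  have hcomm := hT.1.2.2
  obtain ⟨P, hP⟩ := exists_isFormProjection hB.symm hB.pos
    (realRootSubmodule (subgroupLieAlgebra (n := n) T) (α p))
  obtain ⟨P₀, hP₀⟩ := exists_isFormProjection hB.symm hB.pos (subgroupLieAlgebra (n := n) T)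
  obtain ⟨g, hg, hgB⟩ := exists_invariantMetric_of_operator hπ hcomm hB.symm hB.pos hAd
    (S := LinearMap.id + P) (P := P₀)
    (fun X Y => by
      rw [LinearMap.add_apply, LinearMap.add_apply, map_add, map_add, LinearMap.add_apply, hP.symm]
      rfl)
    (fun X hX => by
      rw [LinearMap.add_apply, map_add, LinearMap.add_apply]
      exact add_pos_of_pos_of_nonneg (hB.pos X hX) (hP.nonneg hB.pos X))
    (fun t ht X => by
      rw [LinearMap.add_apply, LinearMap.add_apply, map_add, hP.lieAd_comm hB.pos hAd
        (fun t ht X hX => lieAd_mem_realRootSubmodule hπ hcomm ht hX) ht]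
      rfl)
    hP₀
  -- The other summands lie in real root spaces orthogonal to that of α_p.
  have hPX : P (∑ q, X q) = X p := by
    classical
    rw [map_sum, Finset.sum_eq_single p, hP.eq_self _ (hX p)]
    · intro q _ hq
      exact hP.eq_zero hB.pos fun Y hY =>
        form_eq_zero_of_ne hB (hα q) (hα p) (hdist q p hq).1 (hdist q p hq).2 (hX q) hY
    · simp
  have hP₀X (q) : P₀ (X q) = 0 := hP₀.eq_zero hB.pos fun H hH =>
    form_eq_zero_of_mem_cartan hB
      (fun H hH H' hH' => lie_eq_zero_of_mem_subgroupLieAlgebra hπ hcomm hH hH') (hα q) (hX q) hH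
  have hP₀sum : P₀ (∑ q, X q) = 0 := by
    rw [map_sum]
    exact Finset.sum_eq_zero fun q _ => hP₀X q
  -- The vector X + X_p is orthogonal to 𝔱, so the 𝔱-component of [X, Y] does not contribute.
  have key (Y) : B (∑ q, X q + X p) ⁅∑ q, X q, Y⁆ = 0 := by
    have h0 : P₀ (∑ q, X q + X p) = 0 := by rw [map_add, hP₀sum, hP₀X, add_zero]
    have h1 := (isGeodesic_oneParam_iff hπ hg _).1 (hgeod g hg) Y
    rw [hgB, hP₀sum, sub_zero, LinearMap.add_apply, LinearMap.id_apply, hPX, map_sub, ← hP₀.symm,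
      h0, map_zero, LinearMap.zero_apply, sub_zero] at h1
    exact h1
  refine eq_of_forall_form_eq hB.pos fun Y => ?_
  have h2 := hB.lie (∑ q, X q) (∑ q, X q + X p) Y
  rw [key, neg_zero, lie_add, lie_self, zero_add] at h2
  rw [h2, map_zero, LinearMap.zero_apply]

end Equigeodesics

/-- Here `G ⧸ T` carries its smooth structure as a homogeneous space, that is, the unique one for
which the projection `G → G ⧸ T` is a smooth submersion. -/
theorem theoremA {n m : ℕ} {G : Type*} [TopologicalSpace G] [Group G]
    [ChartedSpace (EuclideanSpace ℝ (Fin n)) G] [LieGroup (𝓡 n) ∞ G]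
    [T2Space G] [CompactSpace G] [ConnectedSpace G]
    (hG : LieAlgebra.IsSimple ℝ (GroupLieAlgebra (𝓡 n) G))
    (T : Subgroup G) (hT : IsMaximalTorus T)
    [ChartedSpace (EuclideanSpace ℝ (Fin m)) (G ⧸ T)] [IsManifold (𝓡 m) ∞ (G ⧸ T)]
    (hπ : Manifold.IsSubmersion (𝓡 n) (𝓡 m) ∞ (QuotientGroup.mk : G → G ⧸ T))
    (r : ℕ)
    (α : Fin r → Module.Dual ℂ ((subgroupLieAlgebra (n := n) T).baseChange ℂ))
    (hα : ∀ p, IsLieRoot (subgroupLieAlgebra (n := n) T) (α p))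
    (hdist : ∀ p q, p ≠ q → α p ≠ α q ∧ α p ≠ -α q)
    (X : Fin r → GroupLieAlgebra (𝓡 n) G)
    (hX : ∀ p, X p ∈ realRootSpace (subgroupLieAlgebra (n := n) T) (α p))
    (hX0 : ∀ p, X p ≠ 0) :
    IsEquigeodesic G m
        (fun t : ℝ => (lieExp (n := n) (t • ∑ p, X p) : G) • ((1 : G) : G ⧸ T)) ↔
      ∀ p q, ¬ IsLieRoot (subgroupLieAlgebra (n := n) T) (α p + α q) ∧
        ¬ IsLieRoot (subgroupLieAlgebra (n := n) T) (α p - α q) := by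
  have := finiteDimensional_groupLieAlgebra (n := n) (G := G)
  simp only [lieExp_smul]
  constructor
  · intro h
    obtain ⟨B, hsymm, hpos, hAd⟩ := exists_lieAd_invariant_form (n := n) (G := G)
    have hB : IsInvariantInnerProduct B :=
      ⟨hsymm, hpos, fun Z => lie_invariant_of_lieAd_invariant fun s => hAd (oneParam Z s)⟩
    exact not_isLieRoot_of_sum_lie_eq_zero hB
      (fun Z hZ => hT.mem_subgroupLieAlgebra_of_forall_lie_eq_zero hπ hZ) (fun p => (hα p).1) hdist
      hX hX0 (sum_lie_eq_zero_of_forall_isGeodesic hπ hT hB hAd (fun p => (hα p).1) hdist hX h)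
  · intro h g hg
    exact isGeodesic_of_not_isLieRoot hπ hT (fun p => (hα p).1) hdist hX h hg
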